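/- Let $X$ be a complex Banach space. A closed, densely defined, injective operator $A$ on $X$ with dense range is sectorial of type $\omega\in[0,\pi)$ if every $\lambda$ with $|\arg\lambda|>\omega$ belongs to the resolvent set and, for each $\sigma>\omega$, $\|\lambda R(\lambda,A)\|$ is bounded on $\{\lambda\neq0: |\arg\lambda|\ge\sigma\}$, where $R(\lambda,A)=(\lambda-A)^{-1}$; it is sectorial if it is so for some $\omega$, and $\omega(A)$ denotes the infimum of such $\omega$. Write $\Sigma_\sigma=\{z\ne0:|\arg z|<\sigma\}$. A sectorial operator $A$ admits an $H^\infty(\Sigma_\sigma)$-calculus, $\sigma>\omega(A)$, if for every bounded analytic $f$ on $\Sigma_\sigma$ the operator $f(A)$ is bounded, that is, there is a bounded operator $f(A)$ on $X$ such that for all $n\ge1$, $\omega(A)<\nu<\sigma$ and $x\in X$ $$f(A)\varphi_n(A)x=\frac{-1}{2\pi i}\int_{\Gamma_\nu}\varphi_n(\zeta)f(\zeta)R(\zeta,A)x\,d\zeta,$$ where $\varphi_n(z)=\frac{n}{n+z}-\frac1{1+nz}$, $\varphi_n(A)=\frac1nR(-\frac1n,A)-nR(-n,A)$ and $\Gamma_\nu=\{|t|e^{i(\operatorname{sgn}t)\nu}:-\infty<t<\infty\}$.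 $A$ is $H^\infty$-sectorial if it is sectorial and this holds for some $\sigma\in(0,\pi)$; $\omega_H(A)$ is the infimum of such $\sigma$. A set $\mathcal F$ of bounded operators is R-bounded if for some $C$ and all $n$, $T_1,\dots,T_n\in\mathcal F$, $x_1,\dots,x_n\in X$ one has $(\mathbb E\|\sum_k\epsilon_kT_kx_k\|^2)^{1/2}\le C(\mathbb E\|\sum_k\epsilon_kx_k\|^2)^{1/2}$ with independent Rademacher variables $\epsilon_k$. A sectorial operator $A$ is R-sectorial if, for some $\sigma\in(0,\pi)$, the resolvent exists for $|\arg\lambda|>\sigma$ and $\{\lambda R(\lambda,A):|\arg\lambda|>\sigma\}$ is R-bounded; $\omega_R(A)$ is the infimum of such $\sigma$. $X$ has property $(\alpha)$ if there is $C$ with $$\Big(\mathbb E\Big\|\sum_{j,k=1}^n\alpha_{jk}\epsilon_j\eta_kx_{jk}\Big\|^2\Big)^{1/2}\le C\max_{j,k}|\alpha_{jk}|\Big(\mathbb E\Big\|\sum_{j,k=1}^n\epsilon_j\eta_kx_{jk}\Big\|^2\Big)^{1/2}$$ for all $n$, $x_{jk}\in X$, $\alpha_{jk}\in\mathbb C$,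 where $(\epsilon_j)$, $(\eta_k)$ are mutually independent sequences of independent Rademacher variables. **Theorem.** Let $A$ and $B$ be sectorial operators on $X$ with commuting resolvents, such that $A$ is $H^\infty$-sectorial, $B$ is R-sectorial and $\omega_H(A)+\omega_R(B)<\pi$. Then $A+B$ with domain $\mathcal D(A)\cap\mathcal D(B)$ is closed; there is a constant $C$ with $$\|Ax\|+\|Bx\|\le C\|Ax+Bx\|\qquad(x\in\mathcal D(A)\cap\mathcal D(B));$$ and if $A$ or $B$ is invertible (has a bounded everywhere defined inverse), then so is $A+B$. If moreover $X$ has property $(\alpha)$, then $A+B$ is R-sectorial and $$\omega_R(A+B)\le\max(\omega_H(A),\omega_R(B)).$$ -/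

import Mathlib

namespace SectorialSum

open MeasureTheory Set

noncomputable section

/-! ### Resolvents of unbounded operators -/

section Resolvent

variable {X : Type*} [NormedAddCommGroup X] [NormedSpace ℂ X]

/-- The bounded operator `R` is the two-sided inverse of `z - A : D(A) → X`. -/
def IsResolventAt (A : X →ₗ.[ℂ] X) (z : ℂ) (R : X →L[ℂ] X) : Prop :=
  (∀ y : X, ∃ h : R y ∈ A.domain, z • R y - A ⟨R y, h⟩ = y) ∧
    ∀ x : A.domain, R (z • (x : X) - A x) = x

/-- The resolvent set of `A`. -/
def resolventSet (A : X →ₗ.[ℂ] X) : Set ℂ := {z | ∃ R, IsResolventAt A z R}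

theorem IsResolventAt.unique {A : X →ₗ.[ℂ] X} {z : ℂ} {R S : X →L[ℂ] X}
    (hR : IsResolventAt A z R) (hS : IsResolventAt A z S) : R = S := by
  ext y
  obtain ⟨h, hy⟩ := hS.1 y
  have h2 := hR.2 ⟨S y, h⟩
  simp only [hy] at h2
  exact h2

open Classical in
/-- The resolvent `R(z, A) = (z - A)⁻¹`; it is only meaningful for `z ∈ resolventSet A`. -/
def res (A : X →ₗ.[ℂ] X) (z : ℂ) : X →L[ℂ] X :=
  if h : ∃ R, IsResolventAt A z R then h.choose else 0

theorem isResolventAt_res {A : X →ₗ.[ℂ] X} {z : ℂ} (h : z ∈ resolventSet A) :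
    IsResolventAt A z (res A z) := by
  have h' : ∃ R, IsResolventAt A z R := h
  rw [res, dif_pos h']
  exact h'.choose_spec

/-- `A` is invertible: it has a bounded, everywhere defined inverse. -/
def IsInvertible (A : X →ₗ.[ℂ] X) : Prop := (0 : ℂ) ∈ resolventSet A

/-- Two unbounded operators commute if their resolvents commute. -/
def ResolventsCommute (A B : X →ₗ.[ℂ] X) : Prop :=
  ∀ z ∈ resolventSet A, ∀ w ∈ resolventSet B, Commute (res A z) (res B w)

end Resolvent

/-! ### Sectorial operators -/

section Sectorial

variable {X : Type*} [NormedAddCommGroup X] [NormedSpace ℂ X]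

/-- The open sector `{z ≠ 0 : |arg z| < σ}`. -/
def sector (σ : ℝ) : Set ℂ := {z | z ≠ 0 ∧ |z.arg| < σ}

/-- `A` is sectorial of type `ω`. (As `ω ≥ 0` and `arg 0 = 0`, the condition `ω < |arg z|`
excludes `z = 0`.) -/
structure IsSectorialOfType (A : X →ₗ.[ℂ] X) (ω : ℝ) : Prop where
  nonneg : 0 ≤ ω
  lt_pi : ω < Real.pi
  isClosed : A.IsClosed
  dense_domain : Dense (A.domain : Set X)
  injective : Function.Injective A
  dense_range : DenseRange A
  mem_resolventSet : ∀ z : ℂ, ω < |z.arg| → z ∈ resolventSet A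
  resolvent_bound : ∀ σ : ℝ, ω < σ → ∃ C : ℝ, ∀ z : ℂ, σ ≤ |z.arg| → ‖z • res A z‖ ≤ C

/-- `A` is sectorial. -/
def IsSectorial (A : X →ₗ.[ℂ] X) : Prop := ∃ ω, IsSectorialOfType A ω

/-- The angle of sectoriality `ω(A)`. -/
def sectorialAngle (A : X →ₗ.[ℂ] X) : ℝ := sInf {ω | IsSectorialOfType A ω}

end Sectorial

/-! ### The `H^∞` functional calculus -/

section HInfty

variable {X : Type*} [NormedAddCommGroup X] [NormedSpace ℂ X]

/-- `f` belongs to `H^∞(Σ_σ)`: it is bounded and analytic on the sector (values elsewhere are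
irrelevant). -/
def MemHInfty (σ : ℝ) (f : ℂ → ℂ) : Prop :=
  DifferentiableOn ℂ f (sector σ) ∧ ∃ M : ℝ, ∀ z ∈ sector σ, ‖f z‖ ≤ M

/-- The contour integral `-1/(2πi) ∫_{Γ_ν} f(ζ) R(ζ, A) x dζ`, where `Γ_ν` is the boundary of
`Σ_ν`, run through from `∞ e^{-iν}` to `0` to `∞ e^{iν}`. -/
def cauchyIntegral (A : X →ₗ.[ℂ] X) (ν : ℝ) (f : ℂ → ℂ) (x : X) : X :=
  (-1 / (2 * Real.pi * Complex.I) : ℂ) •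
    ∫ t in Ioi (0 : ℝ),
      ((Complex.exp (ν * Complex.I) * f (t * Complex.exp (ν * Complex.I))) •
          res A (t * Complex.exp (ν * Complex.I)) x -
        (Complex.exp (-ν * Complex.I) * f (t * Complex.exp (-ν * Complex.I))) •
          res A (t * Complex.exp (-ν * Complex.I)) x)

/-- The regularizing functions `φ_n(z) = n/(n+z) - 1/(1+nz)`. -/
def regFun (n : ℕ) (z : ℂ) : ℂ := n / (n + z) - 1 / (1 + n * z)

/-- The operators `φ_n(A) = n⁻¹ R(-n⁻¹, A) - n R(-n, A)`, which for sectorial `A` form a bounded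
approximate identity. -/
def regOp (A : X →ₗ.[ℂ] X) (n : ℕ) : X →L[ℂ] X :=
  ((n : ℂ)⁻¹) • res A (-(n : ℂ)⁻¹) - (n : ℂ) • res A (-(n : ℂ))

/-- For `f ∈ H^∞(Σ_σ)` with `σ > ω(A)`: the (in general unbounded) operator `f(A)`, defined by
regularization `f(A) φ_n(A) = (φ_n f)(A)` with `(φ_n f)(A)` given by the absolutely convergent
Cauchy integral, is the bounded operator `T`. -/
def IsHInftyValue (A : X →ₗ.[ℂ] X) (σ : ℝ) (f : ℂ → ℂ) (T : X →L[ℂ] X) : Prop :=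
  ∀ n : ℕ, 1 ≤ n → ∀ ν : ℝ, sectorialAngle A < ν → ν < σ → ∀ x : X,
    T (regOp A n x) = cauchyIntegral A ν (fun z => regFun n z * f z) x

/-- `A` admits an `H^∞(Σ_σ)`-calculus: `f(A)` is bounded for every `f ∈ H^∞(Σ_σ)`. -/
def HasHInftyCalculus (A : X →ₗ.[ℂ] X) (σ : ℝ) : Prop :=
  sectorialAngle A < σ ∧ ∀ f : ℂ → ℂ, MemHInfty σ f → ∃ T : X →L[ℂ] X, IsHInftyValue A σ f T

/-- The sectorial operator `A` is `H^∞`-sectorial. -/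
def IsHInftySectorial (A : X →ₗ.[ℂ] X) : Prop :=
  IsSectorial A ∧ ∃ σ : ℝ, 0 < σ ∧ σ < Real.pi ∧ HasHInftyCalculus A σ

/-- The angle `ω_H(A)`. -/
def hInftyAngle (A : X →ₗ.[ℂ] X) : ℝ :=
  sInf {σ | 0 < σ ∧ σ < Real.pi ∧ HasHInftyCalculus A σ}

end HInfty

/-! ### Rademacher averages, R-sectoriality and property (α) -/

section Rademacher

variable {X : Type*} [NormedAddCommGroup X] [NormedSpace ℂ X]

/-- `(𝔼 ‖∑ₖ εₖ xₖ‖²)^{1/2}` for independent Rademacher variables `εₖ`: the joint law of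
`ε₁, …, εₙ` is the uniform distribution on `{1, -1}ⁿ`. -/
def radNorm {n : ℕ} (x : Fin n → X) : ℝ :=
  √((∑ ε : Fin n → ℤˣ, ‖∑ k, ((ε k : ℤ) : ℂ) • x k‖ ^ 2) / 2 ^ n)

/-- `(𝔼 ‖∑ⱼₖ εⱼ ηₖ xⱼₖ‖²)^{1/2}` for mutually independent Rademacher sequences `ε`, `η`. -/
def radNorm₂ {n : ℕ} (x : Fin n → Fin n → X) : ℝ :=
  √((∑ ε : Fin n → ℤˣ, ∑ η : Fin n → ℤˣ,
    ‖∑ j, ∑ k, (((ε j : ℤ) : ℂ) * ((η k : ℤ) : ℂ)) • x j k‖ ^ 2) / (2 ^ n * 2 ^ n))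

/-- R-boundedness of a set of bounded operators. -/
def RBounded (F : Set (X →L[ℂ] X)) : Prop :=
  ∃ C : ℝ, ∀ (n : ℕ) (T : Fin n → X →L[ℂ] X) (x : Fin n → X), (∀ k, T k ∈ F) →
    radNorm (fun k => T k (x k)) ≤ C * radNorm x

/-- The set of all `z R(z, A)` with `|arg z| > σ` is (well defined and) R-bounded. -/
def HasRBoundedResolvent (A : X →ₗ.[ℂ] X) (σ : ℝ) : Prop :=
  (∀ z : ℂ, σ < |z.arg| → z ∈ resolventSet A) ∧
    RBounded {T : X →L[ℂ] X | ∃ z : ℂ, σ < |z.arg| ∧ T = z • res A z}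

/-- The operator `A` is R-sectorial. -/
def IsRSectorial (A : X →ₗ.[ℂ] X) : Prop :=
  IsSectorial A ∧ ∃ σ : ℝ, 0 < σ ∧ σ < Real.pi ∧ HasRBoundedResolvent A σ

/-- The angle `ω_R(A)`. -/
def rAngle (A : X →ₗ.[ℂ] X) : ℝ :=
  sInf {σ | 0 < σ ∧ σ < Real.pi ∧ HasRBoundedResolvent A σ}

variable (X) in
/-- Property (α); `M` stands for (any bound of) `maxⱼₖ |aⱼₖ|`. -/
def PropertyAlpha : Prop :=
  ∃ C : ℝ, ∀ (n : ℕ) (x : Fin n → Fin n → X) (a : Fin n → Fin n → ℂ) (M : ℝ),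
    (∀ j k, ‖a j k‖ ≤ M) →
      radNorm₂ (fun j k => a j k • x j k) ≤ C * M * radNorm₂ x

end Rademacher

end

end SectorialSum

open SectorialSum

namespace SectorialSum

open MeasureTheory Set Filter Topology

noncomputable section

/-! ### Geometry of sectors -/

/-! Everything rests on an a priori estimate for Ax. Put y = Ax + Bx - lx and D(z) = (z + B - l)⁻¹ =
-R(l - z, B). The resolvent equations give z R(z,A) D(z) y = R(z,A) Ax + D(z)(Bx - lx). If l - z
stays in the good region of B for all z in a sector around the spectrum of A, the last term is
holomorphic inside the contour Γ, so that ψ(A) A x = -1/(2πi) ∫_Γ ψ(z) R(z,A) z D(z) y dz for every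
decaying ψ (`SumData.bumpOp_apply_eq`). With ψ = 1 the integrand is only O(1/|z|), and the integral
diverges at both ends.

The remedy is to cut A into scales. For ψ_τ(z) = e^τ z/(e^τ + z)² the operators satisfy 30 ∫ ψ_τ(A)³
dτ = 1 strongly (`tendsto_integral_bumpCube`). Take τ = k + t and rescale the contour by e^τ: then
∑_k ψ_τ(A)³ A x becomes an integral in r, with weight O(e^{-|r|}), of diagonal sums ∑_k Ψ_k T_k Χ_k
y, where at z = e^{r+k+t±iν} one has Ψ_k = ψ_{k+t}(A), T_k = z D(z) and Χ_k = z R(z,A) ψ_{k+t}(A).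
The functions ∑ ±ψ_{k+t} are bounded uniformly in the signs and the number of terms, so the H^∞
calculus bounds ∑ ±Ψ_k and likewise ∑ ±Χ_k (`exists_unconditionalBound`). Randomizing the diagonal
sum by one family of signs, R-boundedness of the T_k then bounds it (`radMap_sum_le`). Integration
and passage to the limit give ‖Ax‖ ≤ C‖y‖ (`SumData.radMap_le`).

For l = 0 this yields closedness and injectivity. Dense range of A + B - l holds because the contour
integral of ψ_0² R(z,A) D(z) y solves the equation with right side ψ_0(A)² y
(`SumData.exists_solution`); with a lower bound this gives resolvents.

The estimate is proved for finitely many l_j and x_j at once, under a second family of random signs.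
Property (α) makes the operators z D_j(z) R-bounded for such double sums
(`PropertyAlpha.exists_rBound₂`). Hence the A R(l_j, A+B) are R-bounded, and so are the l_j R(l_j,
A+B). -/

theorem cos_sub_le_of_abs {a b s n : ℝ} (ha : |a| ≤ s) (hb : n ≤ |b|) (hb' : |b| ≤ Real.pi)
    (hsn : s < n) : Real.cos (a - b) ≤ Real.cos (n - s) := by
  have h0 : 0 ≤ s := (abs_nonneg a).trans ha
  have h1 : n - s ≤ |a - b| := by
    have := abs_sub_abs_le_abs_sub b a
    rw [abs_sub_comm]; linarith
  have h2 : |a - b| ≤ s + Real.pi := (abs_sub a b).trans (by linarith)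
  rw [← Real.cos_abs (a - b)]
  -- Past π the angle is reflected to 2π - |a - b| ≥ π - s ≥ n - s.
  rcases le_total |a - b| Real.pi with h | h
  · exact Real.cos_le_cos_of_nonneg_of_le_pi (by linarith) h h1
  · rw [← Real.cos_two_pi_sub]
    exact Real.cos_le_cos_of_nonneg_of_le_pi (by linarith) (by linarith) (by linarith)

/-- Law of cosines: with κ = cos(n - s), the square ‖z‖² + ‖w‖² - 2κ‖z‖‖w‖ exceeds (1 - κ)/2 · (‖z‖
+ ‖w‖)² by (1 + κ)/2 · (‖z‖ - ‖w‖)². All kernel bounds below come from this separation. -/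
theorem sector_sep {s n : ℝ} (hs : 0 ≤ s) (hsn : s < n) (hn : n ≤ Real.pi) :
    ∃ c : ℝ, 0 < c ∧ ∀ z w : ℂ, |z.arg| ≤ s → n ≤ |w.arg| → c * (‖z‖ + ‖w‖) ≤ ‖z - w‖ := by
  have hc : Real.cos (n - s) < 1 := by
    rw [← Real.cos_zero]
    exact Real.cos_lt_cos_of_nonneg_of_le_pi le_rfl (by linarith) (by linarith)
  have hc' := Real.neg_one_le_cos (n - s)
  refine ⟨√((1 - Real.cos (n - s)) / 2), Real.sqrt_pos.2 (by linarith), fun z w hz hw => ?_⟩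
  have h := cos_sub_le_of_abs hz hw (Complex.abs_arg_le_pi w) hsn
  refine abs_le_of_sq_le_sq' ?_ (norm_nonneg _) |>.2
  have e : ‖z - w‖ ^ 2 = ‖z‖ ^ 2 + ‖w‖ ^ 2 - 2 * (‖z‖ * ‖w‖) * Real.cos (z.arg - w.arg) := by
    rw [Real.cos_sub, Complex.sq_norm, Complex.sq_norm, Complex.sq_norm]
    have e1 := Complex.norm_mul_cos_arg z
    have e2 := Complex.norm_mul_cos_arg w
    have e3 := Complex.norm_mul_sin_arg z
    have e4 := Complex.norm_mul_sin_arg w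
    have : 2 * (‖z‖ * ‖w‖) * (Real.cos z.arg * Real.cos w.arg + Real.sin z.arg * Real.sin w.arg) =
      2 * ((‖z‖ * Real.cos z.arg) * (‖w‖ * Real.cos w.arg) +
        (‖z‖ * Real.sin z.arg) * (‖w‖ * Real.sin w.arg)) := by ring
    rw [this, e1, e2, e3, e4]
    simp only [Complex.normSq_apply, Complex.sub_re, Complex.sub_im]
    ring
  rw [mul_pow, Real.sq_sqrt (by linarith), e]
  have hp : 0 ≤ ‖z‖ * ‖w‖ := by positivity
  nlinarith [mul_le_mul_of_nonneg_left h hp, mul_nonneg (by linarith : 0 ≤ 1 + Real.cos (n - s))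
    (sq_nonneg (‖z‖ - ‖w‖))]

/-- `z ↦ Im (e^{-iφ} z)` in polar coordinates. -/
theorem norm_mul_sin_arg_sub (z : ℂ) (φ : ℝ) :
    ‖z‖ * Real.sin (z.arg - φ) = z.im * Real.cos φ - z.re * Real.sin φ := by
  rw [Real.sin_sub, ← Complex.norm_mul_cos_arg z, ← Complex.norm_mul_sin_arg z]
  ring

/-- Half-plane argument: if the sum had too large an argument, some line through 0 would have both
summands weakly on one side and their sum strictly on the other. -/
theorem arg_add_le_aux {z m : ℂ} {ν ρ : ℝ} (hν : 0 < ν) (hz : |z.arg| ≤ ν) (hm : |m.arg| ≤ ρ)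
    (h : ν + ρ < Real.pi) (hρν : ρ ≤ ν) : (z + m).arg ≤ ν := by
  by_contra! hlt
  obtain ⟨hz1, hz2⟩ := abs_le.1 hz
  obtain ⟨hm1, hm2⟩ := abs_le.1 hm
  have hl := Complex.arg_le_pi (z + m)
  have hne : 0 < ‖z + m‖ := by
    rw [norm_pos_iff]; rintro h0; rw [h0, Complex.arg_zero] at hlt; linarith
  have hpi := Real.pi_pos
  have E := fun φ => norm_mul_sin_arg_sub z φ
  have E' := fun φ => norm_mul_sin_arg_sub m φ
  have E'' := fun φ => norm_mul_sin_arg_sub (z + m) φ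
  simp only [Complex.add_re, Complex.add_im] at E''
  -- The line in direction ν separates unless z lies below the opposite ray, at angle ν - π. This
  -- forces ν > π/2, and then the line in direction π - ν works.
  by_cases hc : ν - Real.pi ≤ z.arg
  · have h1 : Real.sin (z.arg - ν) ≤ 0 :=
      Real.sin_nonpos_of_nonpos_of_neg_pi_le (by linarith) (by linarith)
    have h2 : Real.sin (m.arg - ν) ≤ 0 :=
      Real.sin_nonpos_of_nonpos_of_neg_pi_le (by linarith) (by linarith)
    have h3 : 0 < Real.sin ((z + m).arg - ν) :=
      Real.sin_pos_of_pos_of_lt_pi (by linarith) (by linarith)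
    have := mul_nonpos_of_nonneg_of_nonpos (norm_nonneg z) h1
    have := mul_nonpos_of_nonneg_of_nonpos (norm_nonneg m) h2
    have := mul_pos hne h3
    nlinarith [E ν, E' ν, E'' ν]
  · push Not at hc
    have h1 : Real.sin (z.arg - (Real.pi - ν)) ≤ 0 := by
      have : Real.sin (z.arg - (Real.pi - ν)) = -Real.sin (z.arg + ν) := by
        rw [← Real.sin_sub_pi]; ring_nf
      rw [this, neg_nonpos]
      exact Real.sin_nonneg_of_nonneg_of_le_pi (by linarith) (by linarith)
    have h2 : Real.sin (m.arg - (Real.pi - ν)) ≤ 0 :=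
      Real.sin_nonpos_of_nonpos_of_neg_pi_le (by linarith) (by linarith)
    have h3 : 0 < Real.sin ((z + m).arg - (Real.pi - ν)) :=
      Real.sin_pos_of_pos_of_lt_pi (by linarith) (by linarith)
    have := mul_nonpos_of_nonneg_of_nonpos (norm_nonneg z) h1
    have := mul_nonpos_of_nonneg_of_nonpos (norm_nonneg m) h2
    have := mul_pos hne h3
    nlinarith [E (Real.pi - ν), E' (Real.pi - ν), E'' (Real.pi - ν)]

theorem abs_arg_conj (z : ℂ) : |((starRingEnd ℂ) z).arg| = |z.arg| := by
  rw [Complex.arg_conj]; split_ifs with h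
  · rw [h]
  · rw [abs_neg]

theorem abs_arg_add_le {z m : ℂ} {ν ρ : ℝ} (hν : 0 < ν) (hρ : 0 < ρ) (hz : |z.arg| ≤ ν) (hm : |m.arg| ≤ ρ)
    (h : ν + ρ < Real.pi) : |(z + m).arg| ≤ max ν ρ := by
  wlog hρν : ρ ≤ ν generalizing z m ν ρ
  · rw [add_comm, max_comm]
    exact this hρ hν hm hz (by linarith) (by linarith)
  rw [max_eq_left hρν, abs_le]
  refine ⟨?_, arg_add_le_aux hν hz hm h hρν⟩
  have := arg_add_le_aux (z := (starRingEnd ℂ) z) (m := (starRingEnd ℂ) m)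
    hν (by rwa [abs_arg_conj]) (by rwa [abs_arg_conj]) h hρν
  rw [← map_add, Complex.arg_conj] at this
  split_ifs at this with h1
  · have := abs_nonneg z.arg; rw [h1]; linarith [Real.pi_pos]
  · linarith

theorem arg_exp_of_mem {w : ℂ} (h1 : -Real.pi < w.im) (h2 : w.im ≤ Real.pi) :
    (Complex.exp w).arg = w.im := by
  rw [Complex.arg_exp, toIocMod_eq_self]
  exact ⟨h1, by linarith⟩

/-- The closed sector without its vertex. -/
def closedSector (ν : ℝ) : Set ℂ := {z | z ≠ 0 ∧ |z.arg| ≤ ν}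

theorem exp_mem_closedSector {ν : ℝ} (hν : ν < Real.pi) {w : ℂ} (h : |w.im| ≤ ν) :
    Complex.exp w ∈ closedSector ν := by
  have h' := abs_le.1 h
  refine ⟨Complex.exp_ne_zero _, ?_⟩
  rwa [arg_exp_of_mem (by linarith) (by linarith)]

theorem le_abs_arg_exp {ν : ℝ} (hν0 : 0 < ν) {w : ℂ} (h1 : ν ≤ w.im)
    (h2 : w.im ≤ 2 * Real.pi - ν) : ν ≤ |(Complex.exp w).arg| := by
  rcases le_or_gt w.im Real.pi with h | h
  -- In the coordinate w = log z the complement of the sector is a strip centred at Im w = π; its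
  -- upper half is brought back to the principal branch by subtracting 2πi.
  · rw [arg_exp_of_mem (by linarith [Real.pi_pos]) h]
    exact h1.trans (le_abs_self _)
  · have e : Complex.exp w = Complex.exp (w - 2 * Real.pi * Complex.I) := by
      rw [Complex.exp_sub, Complex.exp_two_pi_mul_I, div_one]
    have him : (w - 2 * Real.pi * Complex.I).im = w.im - 2 * Real.pi := by simp
    rw [e, arg_exp_of_mem (by rw [him]; linarith) (by rw [him]; linarith), him, abs_of_neg
      (by linarith)]
    linarith

/-! ### Integrals over rays -/

variable {E : Type*} [NormedAddCommGroup E] [NormedSpace ℂ E]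

/-- The point `e^{r + iθ}`. -/
abbrev polar (θ r : ℝ) : ℂ := Complex.exp (r + θ * Complex.I)

theorem norm_polar (θ r : ℝ) : ‖polar θ r‖ = Real.exp r := by
  simp [polar, Complex.norm_exp]

theorem polar_add (θ r s : ℝ) : polar θ (r + s) = (Real.exp s : ℂ) * polar θ r := by
  simp only [polar]; push_cast; rw [← Complex.exp_add]; ring_nf

theorem polar_im (θ r : ℝ) : ((r : ℂ) + θ * Complex.I).im = θ := by simp

theorem min_exp (r : ℝ) : min (Real.exp r) (Real.exp r)⁻¹ = Real.exp (-|r|) := by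
  rw [← Real.exp_neg]
  rcases le_total 0 r with h | h
  · rw [abs_of_nonneg h, min_eq_right (Real.exp_le_exp.2 (by linarith))]
  · rw [abs_of_nonpos h, neg_neg, min_eq_left (Real.exp_le_exp.2 (by linarith))]

theorem integrable_exp_neg_abs : Integrable (fun r : ℝ => Real.exp (-|r|)) := by
  rw [← integrableOn_univ, ← Iic_union_Ioi (a := (0 : ℝ))]
  refine IntegrableOn.union ?_ ?_
  · refine (integrableOn_exp_Iic 0).congr_fun (fun x hx => ?_) measurableSet_Iic
    simp [abs_of_nonpos (mem_Iic.1 hx)]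
  · refine (integrableOn_exp_neg_Ioi 0).congr_fun (fun x hx => ?_) measurableSet_Ioi
    simp [abs_of_pos (mem_Ioi.1 hx)]

/-- The integral of `G` over the ray with angle `θ`, run through from `0` to `∞`. -/
def rayIntegral (θ : ℝ) (G : ℂ → E) : E := ∫ r : ℝ, polar θ r • G (polar θ r)

/-- `G` decays like `O(1)` at `0` and like `O(|z|⁻²)` at `∞` on `S`. -/
def DecaysOn (S : Set ℂ) (G : ℂ → E) : Prop :=
  ∃ C : ℝ, ∀ z ∈ S, ‖z • G z‖ ≤ C * min ‖z‖ ‖z‖⁻¹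

theorem DecaysOn.mono {S T : Set ℂ} {G : ℂ → E} (h : DecaysOn S G) (hTS : T ⊆ S) :
    DecaysOn T G := by
  obtain ⟨C, hC⟩ := h
  exact ⟨C, fun z hz => hC z (hTS hz)⟩

theorem rayIntegrable {S : Set ℂ} {G : ℂ → E} (hG : ContinuousOn G S) (hd : DecaysOn S G) {θ : ℝ}
    (hθ : ∀ r : ℝ, polar θ r ∈ S) : Integrable (fun r : ℝ => polar θ r • G (polar θ r)) := by
  obtain ⟨C, hC⟩ := hd
  refine Integrable.mono' (integrable_exp_neg_abs.const_mul C) ?_ (ae_of_all _ fun r => ?_)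
  · refine Continuous.aestronglyMeasurable ?_
    have hc : Continuous (fun r : ℝ => polar θ r) := by unfold polar; fun_prop
    exact hc.smul (hG.comp_continuous hc hθ)
  · have := hC _ (hθ r)
    rwa [norm_polar, min_exp] at this

/-- Cauchy's theorem on the rectangles with real part in [-n, n]; the vertical sides are O(e^{-n}).
-/
theorem integral_strip_eq [CompleteSpace E] {g : ℂ → E} {α β C : ℝ}
    (hg : DifferentiableOn ℂ g {w | w.im ∈ uIcc α β})
    (hb : ∀ w : ℂ, w.im ∈ uIcc α β → ‖g w‖ ≤ C * Real.exp (-|w.re|)) :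
    ∫ r : ℝ, g (r + α * Complex.I) = ∫ r : ℝ, g (r + β * Complex.I) := by
  have hint : ∀ θ ∈ uIcc α β, Integrable (fun r : ℝ => g (r + θ * Complex.I)) := by
    intro θ hθ
    refine Integrable.mono' (integrable_exp_neg_abs.const_mul C) ?_ (ae_of_all _ fun r => ?_)
    · refine Continuous.aestronglyMeasurable ?_
      exact hg.continuousOn.comp_continuous (by fun_prop) (fun r => by simpa using hθ)
    · simpa using hb (r + θ * Complex.I) (by simpa using hθ)
  have lim : ∀ θ ∈ uIcc α β, Tendsto (fun n : ℝ => ∫ r in (-n)..n, g (r + θ * Complex.I)) atTop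
      (𝓝 (∫ r : ℝ, g (r + θ * Complex.I))) := fun θ hθ =>
    intervalIntegral_tendsto_integral (hint θ hθ) tendsto_neg_atTop_atBot tendsto_id
  have side : ∀ s : ℝ → ℝ, (∀ n, |s n| = |n|) →
      Tendsto (fun n : ℝ => ∫ y in α..β, g (s n + y * Complex.I)) atTop (𝓝 0) := by
    intro s hs
    have h0 : Tendsto (fun n : ℝ => C * Real.exp (-|n|) * |β - α|) atTop (𝓝 0) := by
      have h1 : Tendsto (fun n : ℝ => Real.exp (-|n|)) atTop (𝓝 0) :=
        Real.tendsto_exp_neg_atTop_nhds_zero.comp tendsto_abs_atTop_atTop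
      simpa using (h1.const_mul C).mul_const |β - α|
    refine squeeze_zero_norm (fun n => ?_) h0
    refine intervalIntegral.norm_integral_le_of_norm_le_const fun y hy => ?_
    have := hb (s n + y * Complex.I) (by simpa using uIoc_subset_uIcc hy)
    simpa [hs] using this
  have key : ∀ n : ℝ, (∫ r in (-n)..n, g (r + α * Complex.I)) -
      (∫ r in (-n)..n, g (r + β * Complex.I)) =
      Complex.I • (∫ y in α..β, g ((-n : ℝ) + y * Complex.I)) -
      Complex.I • (∫ y in α..β, g (n + y * Complex.I)) := by
    intro n
    have := Complex.integral_boundary_rect_eq_zero_of_differentiableOn g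
      ((-n : ℝ) + α * Complex.I) (n + β * Complex.I)
      (hg.mono fun w hw => by simpa using hw.2)
    simp only [Complex.add_re, Complex.ofReal_re, Complex.mul_re, Complex.I_re, mul_zero,
      Complex.ofReal_im, Complex.I_im, mul_one, sub_self, add_zero, Complex.add_im,
      Complex.mul_im, zero_add] at this
    rw [← sub_eq_zero, ← this]
    abel
  have l1 := (lim α left_mem_uIcc).sub (lim β right_mem_uIcc)
  simp_rw [key] at l1
  have l2 := ((side (fun n => -n) (fun n => abs_neg n)).const_smul Complex.I).sub
    ((side id (fun n => rfl)).const_smul Complex.I)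
  rw [smul_zero, sub_zero] at l2
  exact sub_eq_zero.1 (tendsto_nhds_unique l1 l2)

/-- With z = e^w the rays become horizontal lines and dz = z dw, so turning a ray is moving a line
across a strip. -/
theorem rayIntegral_eq [CompleteSpace E] {S : Set ℂ} {G : ℂ → E} (hG : DifferentiableOn ℂ G S)
    (hd : DecaysOn S G) {α β : ℝ} (hS : ∀ w : ℂ, w.im ∈ uIcc α β → Complex.exp w ∈ S) :
    rayIntegral α G = rayIntegral β G := by
  obtain ⟨C, hC⟩ := hd
  refine integral_strip_eq (g := fun w => Complex.exp w • G (Complex.exp w)) (C := C) ?_ ?_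
  · exact Complex.differentiable_exp.differentiableOn.smul
      (hG.comp Complex.differentiable_exp.differentiableOn hS)
  · intro w hw
    have := hC _ (hS w hw)
    rwa [Complex.norm_exp, min_exp] at this

theorem rayIntegral_inside [CompleteSpace E] {ν : ℝ} (h0 : 0 ≤ ν) (hν : ν < Real.pi) {G : ℂ → E}
    (hG : DifferentiableOn ℂ G (closedSector ν)) (hd : DecaysOn (closedSector ν) G) :
    rayIntegral ν G = rayIntegral (-ν) G := by
  refine rayIntegral_eq hG hd fun w hw => exp_mem_closedSector hν ?_
  rw [uIcc_of_ge (by linarith)] at hw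
  exact abs_le.2 hw

/-- The ray at angle -ν is also the ray at angle 2π - ν, and it is reached from ν by turning through
the complement of the sector, across the negative axis. -/
theorem rayIntegral_outside [CompleteSpace E] {ν : ℝ} (h0 : 0 < ν) (hν : ν < Real.pi) {G : ℂ → E}
    (hG : DifferentiableOn ℂ G {z | ν ≤ |z.arg|}) (hd : DecaysOn {z | ν ≤ |z.arg|} G) :
    rayIntegral ν G = rayIntegral (-ν) G := by
  rw [rayIntegral_eq (β := 2 * Real.pi - ν) hG hd fun w hw => ?_]
  · unfold rayIntegral
    congr 1
    ext r
    have : polar (2 * Real.pi - ν) r = polar (-ν) r := by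
      unfold polar
      rw [← Complex.exp_periodic (r + ((-ν : ℝ) : ℂ) * Complex.I)]
      push_cast
      ring_nf
    rw [this]
  · rw [uIcc_of_le (by linarith)] at hw
    exact le_abs_arg_exp h0 hw.1 hw.2

end

end SectorialSum

namespace SectorialSum

open MeasureTheory Set Filter Topology

noncomputable section

variable {E : Type*} [NormedAddCommGroup E] [NormedSpace ℂ E]

/-! ### Contour integrals over the boundary of a sector -/

theorem abs_arg_polar {θ : ℝ} (h : |θ| < Real.pi) (r : ℝ) : |(polar θ r).arg| = |θ| := by
  have := abs_lt.1 h
  rw [polar, arg_exp_of_mem] <;> rw [polar_im] <;> linarith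

theorem polar_ne_zero (θ r : ℝ) : polar θ r ≠ 0 := Complex.exp_ne_zero _

/-- `-1/(2πi)` times the integral over the upper minus the integral over the lower ray. -/
def contourIntegral (ν : ℝ) (G : ℂ → E) : E :=
  (-1 / (2 * Real.pi * Complex.I) : ℂ) • (rayIntegral ν G - rayIntegral (-ν) G)

/-- Integrability over both rays of the contour. -/
def ContourIntegrable (ν : ℝ) (G : ℂ → E) : Prop :=
  Integrable (fun r : ℝ => polar ν r • G (polar ν r)) ∧
    Integrable (fun r : ℝ => polar (-ν) r • G (polar (-ν) r))

/-- The support of the contour with angle `ν`. -/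
def contour (ν : ℝ) : Set ℂ := {z | z ≠ 0 ∧ |z.arg| = ν}

theorem polar_mem_contour {ν : ℝ} (h0 : 0 ≤ ν) (hν : ν < Real.pi) (r : ℝ) :
    polar ν r ∈ contour ν :=
  ⟨polar_ne_zero _ _, by rw [abs_arg_polar (by rwa [abs_of_nonneg h0]), abs_of_nonneg h0]⟩

theorem polar_neg_mem_contour {ν : ℝ} (h0 : 0 ≤ ν) (hν : ν < Real.pi) (r : ℝ) :
    polar (-ν) r ∈ contour ν :=
  ⟨polar_ne_zero _ _, by
    rw [abs_arg_polar (by rwa [abs_neg, abs_of_nonneg h0]), abs_neg, abs_of_nonneg h0]⟩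

theorem contourIntegrable_of_decaysOn {ν : ℝ} (h0 : 0 ≤ ν) (hν : ν < Real.pi) {G : ℂ → E}
    (hG : ContinuousOn G (contour ν)) (hd : DecaysOn (contour ν) G) : ContourIntegrable ν G :=
  ⟨rayIntegrable hG hd (polar_mem_contour h0 hν), rayIntegrable hG hd (polar_neg_mem_contour h0 hν)⟩

theorem contourIntegral_add {ν : ℝ} {G H : ℂ → E} (hG : ContourIntegrable ν G)
    (hH : ContourIntegrable ν H) :
    contourIntegral ν (fun z => G z + H z) = contourIntegral ν G + contourIntegral ν H := by
  simp only [contourIntegral, rayIntegral, smul_add]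
  rw [integral_add hG.1 hH.1, integral_add hG.2 hH.2, ← smul_add]
  congr 1
  abel

theorem contourIntegral_congr {ν : ℝ} (h0 : 0 ≤ ν) (hν : ν < Real.pi) {G H : ℂ → E}
    (h : ∀ z ∈ contour ν, G z = H z) : contourIntegral ν G = contourIntegral ν H := by
  simp only [contourIntegral, rayIntegral, h _ (polar_mem_contour h0 hν _),
    h _ (polar_neg_mem_contour h0 hν _)]

theorem contourIntegral_clm {F : Type*} [NormedAddCommGroup F] [NormedSpace ℂ F] [CompleteSpace E]
    [CompleteSpace F] (T : E →L[ℂ] F) {ν : ℝ} {G : ℂ → E} (hG : ContourIntegrable ν G) :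
    contourIntegral ν (fun z => T (G z)) = T (contourIntegral ν G) := by
  simp only [contourIntegral, rayIntegral, map_smul, map_sub]
  rw [← T.integral_comp_comm hG.1, ← T.integral_comp_comm hG.2]
  simp only [map_smul]

theorem ContourIntegrable.clm {F : Type*} [NormedAddCommGroup F] [NormedSpace ℂ F]
    (T : E →L[ℂ] F) {ν : ℝ} {G : ℂ → E} (hG : ContourIntegrable ν G) :
    ContourIntegrable ν (fun z => T (G z)) := by
  refine ⟨?_, ?_⟩
  · simpa only [map_smul] using T.integrable_comp hG.1
  · simpa only [map_smul] using T.integrable_comp hG.2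

theorem ContourIntegrable.add {ν : ℝ} {G H : ℂ → E} (hG : ContourIntegrable ν G)
    (hH : ContourIntegrable ν H) : ContourIntegrable ν (fun z => G z + H z) := by
  refine ⟨?_, ?_⟩
  · simp only [smul_add]; exact hG.1.add hH.1
  · simp only [smul_add]; exact hG.2.add hH.2

theorem contourIntegral_inside [CompleteSpace E] {ν : ℝ} (h0 : 0 ≤ ν) (hν : ν < Real.pi)
    {G : ℂ → E} (hG : DifferentiableOn ℂ G (closedSector ν))
    (hd : DecaysOn (closedSector ν) G) : contourIntegral ν G = 0 := by
  rw [contourIntegral, rayIntegral_inside h0 hν hG hd, sub_self, smul_zero]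

theorem contourIntegral_outside [CompleteSpace E] {ν : ℝ} (h0 : 0 < ν) (hν : ν < Real.pi)
    {G : ℂ → E} (hG : DifferentiableOn ℂ G {z | ν ≤ |z.arg|})
    (hd : DecaysOn {z | ν ≤ |z.arg|} G) : contourIntegral ν G = 0 := by
  rw [contourIntegral, rayIntegral_outside h0 hν hG hd, sub_self, smul_zero]

theorem contour_subset_closedSector (ν : ℝ) : contour ν ⊆ closedSector ν :=
  fun _ hz => ⟨hz.1, hz.2.le⟩

theorem contour_subset_outside (ν : ℝ) : contour ν ⊆ {z | ν ≤ |z.arg|} :=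
  fun _ hz => hz.2.ge

theorem arg_neg_ofReal {a : ℝ} (ha : 0 < a) : (-(a : ℂ)).arg = Real.pi := by
  rw [← Complex.ofReal_neg, Complex.arg_ofReal_of_neg (by linarith)]

/-! ### A scalar contour integral -/

theorem div_sq_le_min {x : ℝ} (hx : 0 < x) : x / (1 + x) ^ 2 ≤ min x x⁻¹ := by
  refine le_min ?_ ?_
  · rw [div_le_iff₀ (by positivity)]; nlinarith [mul_pos hx hx, mul_pos (mul_pos hx hx) hx]
  · rw [div_le_iff₀ (by positivity), inv_mul_eq_div, le_div_iff₀ hx]; nlinarith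

theorem integral_exp_div_one_add_sq :
    ∫ r : ℝ, Real.exp r / (1 + Real.exp r ^ 2) = Real.pi / 2 := by
  have hd : ∀ r : ℝ, HasDerivAt (fun r => Real.arctan (Real.exp r))
      (Real.exp r / (1 + Real.exp r ^ 2)) r := by
    intro r
    have := (Real.hasDerivAt_exp r).arctan
    convert this using 1
    ring
  have hi : Integrable (fun r : ℝ => Real.exp r / (1 + Real.exp r ^ 2)) := by
    refine Integrable.mono' integrable_exp_neg_abs ?_ (ae_of_all _ fun r => ?_)
    · refine Continuous.aestronglyMeasurable ?_
      exact Real.continuous_exp.div (by fun_prop) (fun r => by positivity)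
    · rw [Real.norm_of_nonneg (by positivity), ← min_exp]
      have hx := Real.exp_pos r
      refine le_min ?_ ?_
      · rw [div_le_iff₀ (by positivity)]; nlinarith [pow_pos hx 3]
      · rw [div_le_iff₀ (by positivity), inv_mul_eq_div, le_div_iff₀ hx]; nlinarith
  rw [integral_of_hasDerivAt_of_tendsto hd hi (m := 0) (n := Real.pi / 2)]
  · ring
  · have := Real.continuous_arctan.tendsto 0
    rw [Real.arctan_zero] at this
    exact this.comp Real.tendsto_exp_atBot
  · exact (Real.tendsto_arctan_atTop.mono_right nhdsWithin_le_nhds).comp Real.tendsto_exp_atTop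

theorem rayIntegral_pi_div_two (s : ℝ) (hs : s = 1 ∨ s = -1) :
    rayIntegral (s * (Real.pi / 2)) (fun z : ℂ => 2 / (z ^ 2 - 1)) =
      -(s * Real.pi * Complex.I) := by
  have h : ∀ r : ℝ, polar (s * (Real.pi / 2)) r • (2 / (polar (s * (Real.pi / 2)) r ^ 2 - 1)) =
      (-2 * s * Complex.I) * ((Real.exp r / (1 + Real.exp r ^ 2) : ℝ) : ℂ) := by
    intro r
    have e : polar (s * (Real.pi / 2)) r = Real.exp r * (s * Complex.I) := by
      rw [polar, Complex.exp_add, Complex.ofReal_exp]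
      congr 1
      rcases hs with rfl | rfl
      · push_cast; rw [one_mul, Complex.exp_pi_div_two_mul_I, one_mul]
      · push_cast; rw [neg_one_mul, ← neg_div, Complex.exp_neg_pi_div_two_mul_I]; ring
    have h1 : (1 + (Real.exp r : ℂ) ^ 2) ≠ 0 := by
      have : (1 + Real.exp r ^ 2 : ℝ) ≠ 0 := by positivity
      exact_mod_cast this
    have hs2 : (s : ℂ) ^ 2 = 1 := by rcases hs with rfl | rfl <;> simp
    have h2 : (Real.exp r * (s * Complex.I) : ℂ) ^ 2 - 1 = -(1 + (Real.exp r : ℂ) ^ 2) := by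
      rw [mul_pow, mul_pow, hs2, Complex.I_sq]; ring
    rw [e, smul_eq_mul, h2]
    push_cast at h1 ⊢
    field_simp
  rw [rayIntegral]
  simp_rw [h]
  rw [integral_const_mul, integral_complex_ofReal, integral_exp_div_one_add_sq]
  push_cast
  ring

theorem differentiableOn_two_div_sq_sub_one {S : Set ℂ} (hS : ∀ z ∈ S, z ≠ 1 ∧ z ≠ -1) :
    DifferentiableOn ℂ (fun z : ℂ => 2 / (z ^ 2 - 1)) S := by
  intro z hz
  refine DifferentiableAt.differentiableWithinAt ?_
  refine (differentiableAt_const _).div (by fun_prop) ?_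
  have := hS z hz
  intro h
  have h2 : (z - 1) * (z + 1) = 0 := by linear_combination h
  rcases mul_eq_zero.1 h2 with h3 | h3
  · exact this.1 (sub_eq_zero.1 h3)
  · exact this.2 (eq_neg_of_add_eq_zero_left h3)

/-- The wedge between this ray and the half of the imaginary axis on the same side contains neither
pole ±1. The ray can thus be turned onto that half axis, where the integral is an arctangent. -/
theorem rayIntegral_two_div_sq_sub_one {ν : ℝ} (h0 : 0 < |ν|) (hν : |ν| < Real.pi) (s : ℝ)
    (hs : s = 1 ∨ s = -1) (hsν : |ν| = s * ν) :
    rayIntegral ν (fun z : ℂ => 2 / (z ^ 2 - 1)) = -(s * Real.pi * Complex.I) := by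
  have hpi := Real.pi_pos
  rw [← rayIntegral_pi_div_two s hs]
  obtain ⟨c, hc, hcs⟩ := sector_sep (s := max |ν| (Real.pi / 2)) (n := Real.pi) (by positivity)
    (max_lt hν (by linarith)) le_rfl
  obtain ⟨d, hd, hds⟩ := sector_sep (s := 0) (n := min |ν| (Real.pi / 2)) le_rfl
    (lt_min h0 (by linarith)) ((min_le_left _ _).trans hν.le)
  set S : Set ℂ := {z | z ≠ 0 ∧ min |ν| (Real.pi / 2) ≤ |z.arg| ∧ |z.arg| ≤ max |ν| (Real.pi / 2)}
    with hS
  have b1 : ∀ z ∈ S, c * (1 + ‖z‖) ≤ ‖z + 1‖ := by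
    intro z hz
    have := hcs z (-1) hz.2.2 (by rw [Complex.arg_neg_one]; exact le_abs_self _)
    simpa [add_comm] using this
  have b2 : ∀ z ∈ S, d * (1 + ‖z‖) ≤ ‖z - 1‖ := by
    intro z hz
    have := hds 1 z (by simp) hz.2.1
    rw [norm_sub_rev]
    simpa using this
  refine rayIntegral_eq (S := S) ?_ ?_ ?_
  · refine differentiableOn_two_div_sq_sub_one fun z hz => ⟨?_, ?_⟩
    · rintro rfl
      have := b2 1 hz
      simp at this; linarith
    · rintro rfl
      have := b1 (-1) hz
      simp at this; linarith
  · refine ⟨2 / (c * d), fun z hz => ?_⟩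
    have hz0 : 0 < ‖z‖ := norm_pos_iff.2 hz.1
    have e : z ^ 2 - 1 = (z + 1) * (z - 1) := by ring
    rw [norm_smul, norm_div, e, norm_mul, Complex.norm_ofNat]
    calc ‖z‖ * (2 / (‖z + 1‖ * ‖z - 1‖))
        ≤ ‖z‖ * (2 / ((c * (1 + ‖z‖)) * (d * (1 + ‖z‖)))) := by
          gcongr
          · exact b1 z hz
          · exact b2 z hz
      _ = 2 / (c * d) * (‖z‖ / (1 + ‖z‖) ^ 2) := by field_simp
      _ ≤ _ := by gcongr; exact div_sq_le_min hz0
  · intro w hw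
    have key : min |ν| (Real.pi / 2) ≤ |w.im| ∧ |w.im| ≤ max |ν| (Real.pi / 2) := by
      rcases hs with rfl | rfl
      · rw [one_mul] at hsν
        have h1 : 0 < ν := by rw [← hsν]; exact h0
        rw [one_mul, ← hsν] at hw
        have hw0 : 0 ≤ w.im := (le_min h0.le (by linarith)).trans hw.1
        rw [abs_of_nonneg hw0]
        exact hw
      · have h1 : ν < 0 := by linarith
        rw [neg_one_mul] at hsν hw
        have hν' : ν = -|ν| := by linarith
        have hw' : -w.im ∈ uIcc |ν| (Real.pi / 2) := by
          rw [hν', mem_uIcc] at hw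
          rw [mem_uIcc]
          rcases hw with hw | hw
          · right; constructor <;> linarith
          · left; constructor <;> linarith
        have hw0 : 0 ≤ -w.im := (le_min h0.le (by linarith)).trans hw'.1
        rw [← abs_neg w.im, abs_of_nonneg hw0]
        exact hw'
    have hlt : |w.im| < Real.pi := key.2.trans_lt (max_lt hν (by linarith))
    have := abs_lt.1 hlt
    refine ⟨Complex.exp_ne_zero _, ?_⟩
    rwa [arg_exp_of_mem (by linarith) (by linarith)]

/-- The one residue that the calculus needs, that of 2/(z² - 1) at z = 1. The contour runs clockwise
around the sector, which the sign in front of the integral compensates. -/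
theorem contourIntegral_two_div_sq_sub_one {ν : ℝ} (h0 : 0 < ν) (hν : ν < Real.pi) :
    contourIntegral ν (fun z : ℂ => 2 / (z ^ 2 - 1)) = 1 := by
  have ha : |ν| = ν := abs_of_pos h0
  rw [contourIntegral, rayIntegral_two_div_sq_sub_one (by rwa [ha]) (by rwa [ha]) 1 (Or.inl rfl)
    (by rw [ha, one_mul]), rayIntegral_two_div_sq_sub_one (by rwa [abs_neg, ha])
    (by rwa [abs_neg, ha]) (-1) (Or.inr rfl) (by rw [abs_neg, ha]; ring)]
  have : (Real.pi : ℂ) ≠ 0 := by exact_mod_cast Real.pi_ne_zero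
  have := Complex.I_ne_zero
  simp only [smul_eq_mul]
  push_cast
  field_simp
  ring

/-- `|a + z| ≥ c (1 + |z|)` on a closed sector, for `a > 0`. -/
theorem exists_le_norm_add {ν a : ℝ} (h0 : 0 ≤ ν) (hν : ν < Real.pi) (ha : 0 < a) :
    ∃ c : ℝ, 0 < c ∧ ∀ z ∈ closedSector ν, c * (1 + ‖z‖) ≤ ‖(a : ℂ) + z‖ := by
  obtain ⟨c, hc, h⟩ := sector_sep h0 hν le_rfl
  refine ⟨c * min a 1, by positivity, fun z hz => ?_⟩
  have := h z (-a) hz.2 (by rw [arg_neg_ofReal ha]; exact le_abs_self _)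
  rw [sub_neg_eq_add, add_comm z, norm_neg, Complex.norm_real, Real.norm_of_nonneg ha.le] at this
  refine le_trans ?_ this
  rw [mul_assoc]
  gcongr
  have h1 := min_le_left a 1
  have h2 := min_le_right a 1
  nlinarith [norm_nonneg z]

theorem add_ne_zero_of_mem_closedSector {ν a : ℝ} (h0 : 0 ≤ ν) (hν : ν < Real.pi) (ha : 0 < a)
    {z : ℂ} (hz : z ∈ closedSector ν) : (a : ℂ) + z ≠ 0 := by
  obtain ⟨c, hc, h⟩ := exists_le_norm_add h0 hν ha
  have := h z hz
  rw [← norm_pos_iff]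
  refine lt_of_lt_of_le ?_ this
  positivity

theorem inv_add_sub_inv_add_decays {ν a b : ℝ} (h0 : 0 ≤ ν) (hν : ν < Real.pi) (ha : 0 < a)
    (hb : 0 < b) :
    DecaysOn (closedSector ν) (fun z : ℂ => ((a : ℂ) + z)⁻¹ - ((b : ℂ) + z)⁻¹) := by
  obtain ⟨c, hc, h⟩ := exists_le_norm_add h0 hν ha
  obtain ⟨d, hd, h'⟩ := exists_le_norm_add h0 hν hb
  refine ⟨‖(b : ℂ) - a‖ / (c * d), fun z hz => ?_⟩
  have e : ((a : ℂ) + z)⁻¹ - ((b : ℂ) + z)⁻¹ = (b - a) / ((a + z) * (b + z)) := by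
    have := add_ne_zero_of_mem_closedSector h0 hν ha hz
    have := add_ne_zero_of_mem_closedSector h0 hν hb hz
    field_simp; ring
  simp only [e]
  rw [norm_smul, norm_div, norm_mul]
  calc ‖z‖ * (‖(b : ℂ) - a‖ / (‖(a : ℂ) + z‖ * ‖(b : ℂ) + z‖))
      ≤ ‖z‖ * (‖(b : ℂ) - a‖ / ((c * (1 + ‖z‖)) * (d * (1 + ‖z‖)))) := by
        gcongr
        · exact h z hz
        · exact h' z hz
    _ = ‖(b : ℂ) - a‖ / (c * d) * (‖z‖ / (1 + ‖z‖) ^ 2) := by field_simp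
    _ ≤ _ := by gcongr; exact div_sq_le_min (norm_pos_iff.2 hz.1)

theorem differentiableOn_inv_add {ν a : ℝ} (h0 : 0 ≤ ν) (hν : ν < Real.pi) (ha : 0 < a) :
    DifferentiableOn ℂ (fun z : ℂ => ((a : ℂ) + z)⁻¹) (closedSector ν) := fun z hz =>
  (DifferentiableAt.inv (by fun_prop)
    (add_ne_zero_of_mem_closedSector h0 hν ha hz)).differentiableWithinAt

theorem sub_one_ne_zero_of_mem_contour {ν : ℝ} (h0 : 0 < ν) {z : ℂ} (hz : z ∈ contour ν) :
    z - 1 ≠ 0 := by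
  intro h
  rw [sub_eq_zero] at h
  have := hz.2
  rw [h] at this
  simp at this
  linarith

theorem two_div_sq_sub_one_contourIntegrable {ν : ℝ} (h0 : 0 < ν) (hν : ν < Real.pi) :
    ContourIntegrable ν (fun z : ℂ => 2 / (z ^ 2 - 1)) := by
  obtain ⟨c, hc, hcs⟩ := exists_le_norm_add (a := 1) h0.le hν one_pos
  obtain ⟨d, hd, hds⟩ := sector_sep (s := 0) (n := ν) le_rfl h0 hν.le
  have ne : ∀ z ∈ contour ν, z + 1 ≠ 0 := fun z hz => by
    rw [add_comm]
    exact_mod_cast add_ne_zero_of_mem_closedSector h0.le hν one_pos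
      (contour_subset_closedSector ν hz)
  refine contourIntegrable_of_decaysOn h0.le hν ?_ ?_
  · refine (differentiableOn_two_div_sq_sub_one fun z hz => ⟨?_, ?_⟩).continuousOn
    · exact sub_ne_zero.1 (sub_one_ne_zero_of_mem_contour h0 hz)
    · exact fun h => ne z hz (by rw [h]; ring)
  · refine ⟨2 / (c * d), fun z hz => ?_⟩
    have e : z ^ 2 - 1 = (z + 1) * (z - 1) := by ring
    rw [norm_smul, norm_div, e, norm_mul, Complex.norm_ofNat]
    have hz0 : 0 < ‖z‖ := norm_pos_iff.2 hz.1
    calc ‖z‖ * (2 / (‖z + 1‖ * ‖z - 1‖))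
        ≤ ‖z‖ * (2 / ((c * (1 + ‖z‖)) * (d * (1 + ‖z‖)))) := by
          gcongr
          · have := hcs z (contour_subset_closedSector ν hz)
            rw [add_comm z 1]; exact_mod_cast this
          · have := hds 1 z (by simp) hz.2.ge
            rw [norm_sub_rev z 1]
            simpa using this
      _ = 2 / (c * d) * (‖z‖ / (1 + ‖z‖) ^ 2) := by field_simp
      _ ≤ _ := by gcongr; exact div_sq_le_min hz0

/-- Since 2/(z² - 1) = 1/(z - 1) - 1/(z + 1), replacing the pole -1 by -a changes the integrand by a
function that is holomorphic and decaying inside the sector. -/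
theorem inv_sub_one_sub_inv_add_contourIntegrable {ν a : ℝ} (h0 : 0 < ν) (hν : ν < Real.pi)
    (ha : 0 < a) : ContourIntegrable ν (fun z : ℂ => (z - 1)⁻¹ - ((a : ℂ) + z)⁻¹) ∧
      contourIntegral ν (fun z : ℂ => (z - 1)⁻¹ - ((a : ℂ) + z)⁻¹) = 1 := by
  have hd := inv_add_sub_inv_add_decays h0.le hν one_pos ha
  have hdiff : DifferentiableOn ℂ (fun z : ℂ => (((1 : ℝ) : ℂ) + z)⁻¹ - ((a : ℂ) + z)⁻¹)
      (closedSector ν) :=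
    (differentiableOn_inv_add h0.le hν one_pos).sub (differentiableOn_inv_add h0.le hν ha)
  have e : ∀ z ∈ contour ν, (z - 1)⁻¹ - ((a : ℂ) + z)⁻¹ =
      2 / (z ^ 2 - 1) + ((((1 : ℝ) : ℂ) + z)⁻¹ - ((a : ℂ) + z)⁻¹) := by
    intro z hz
    have h1 := sub_one_ne_zero_of_mem_contour h0 hz
    have h2 := add_ne_zero_of_mem_closedSector h0.le hν one_pos (contour_subset_closedSector ν hz)
    have : z ^ 2 - 1 = (z - 1) * (((1 : ℝ) : ℂ) + z) := by push_cast; ring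
    rw [this]
    field_simp
    push_cast
    ring
  have i1 := two_div_sq_sub_one_contourIntegrable h0 hν
  have i2 := contourIntegrable_of_decaysOn h0.le hν
    (hdiff.continuousOn.mono (contour_subset_closedSector ν))
    (hd.mono (contour_subset_closedSector ν))
  refine ⟨?_, ?_⟩
  · have := i1.add i2
    unfold ContourIntegrable at this ⊢
    simpa only [e _ (polar_mem_contour h0.le hν _), e _ (polar_neg_mem_contour h0.le hν _)]
      using this
  · rw [contourIntegral_congr h0.le hν e, contourIntegral_add i1 i2,
      contourIntegral_two_div_sq_sub_one h0 hν, contourIntegral_inside h0.le hν hdiff hd, add_zero]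

end

end SectorialSum

namespace SectorialSum

open MeasureTheory Set Filter Topology

noncomputable section

variable {X : Type*} [NormedAddCommGroup X] [NormedSpace ℂ X]

/-! ### Resolvent algebra -/

theorem res_mem_domain {A : X →ₗ.[ℂ] X} {z : ℂ} (hz : z ∈ resolventSet A) (y : X) :
    res A z y ∈ A.domain := ((isResolventAt_res hz).1 y).1

theorem map_res {A : X →ₗ.[ℂ] X} {z : ℂ} (hz : z ∈ resolventSet A) (y : X) :
    A ⟨res A z y, res_mem_domain hz y⟩ = z • res A z y - y := by
  obtain ⟨h, e⟩ := (isResolventAt_res hz).1 y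
  rw [eq_sub_iff_add_eq, ← sub_eq_iff_eq_add'.1 e]

theorem res_map {A : X →ₗ.[ℂ] X} {z : ℂ} (hz : z ∈ resolventSet A) (x : A.domain) :
    res A z (A x) = z • res A z x - x := by
  have := (isResolventAt_res hz).2 x
  rw [map_sub, map_smul] at this
  rw [eq_sub_iff_add_eq, ← sub_eq_iff_eq_add'.1 this]

theorem res_sub_res {A : X →ₗ.[ℂ] X} {z w : ℂ} (hz : z ∈ resolventSet A) (hw : w ∈ resolventSet A) :
    res A z - res A w = (w - z) • (res A z * res A w) := by
  ext y
  have h := res_map hz ⟨res A w y, res_mem_domain hw y⟩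
  rw [map_res hw, map_sub, map_smul] at h
  simp only [sub_apply, smul_apply,
    mul_apply_eq_comp, sub_smul]
  simp only at h
  rw [sub_eq_iff_eq_add] at h
  rw [h]
  abel

theorem res_commute {A : X →ₗ.[ℂ] X} {z w : ℂ} (hz : z ∈ resolventSet A)
    (hw : w ∈ resolventSet A) : Commute (res A z) (res A w) := by
  rcases eq_or_ne z w with rfl | h
  · exact Commute.refl _
  have h1 := res_sub_res hz hw
  have h2 := res_sub_res hw hz
  have h3 : (w - z) • (res A z * res A w) = (w - z) • (res A w * res A z) := by
    rw [← h1, ← neg_sub z w, neg_smul, ← h2, neg_sub]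
  exact smul_right_injective _ (sub_ne_zero.2 h.symm) h3

/-- `S` is contained in the resolvent set, and `‖z R(z, A)‖ ≤ M` on `S`. -/
def ResolventBoundOn (A : X →ₗ.[ℂ] X) (S : Set ℂ) (M : ℝ) : Prop :=
  ∀ z ∈ S, z ∈ resolventSet A ∧ ‖z • res A z‖ ≤ M

theorem ResolventBoundOn.mono {A : X →ₗ.[ℂ] X} {S T : Set ℂ} {M : ℝ}
    (h : ResolventBoundOn A S M) (hTS : T ⊆ S) : ResolventBoundOn A T M :=
  fun z hz => h z (hTS hz)

/-- The resolvent identity and the bound on `S` give continuity, and the identity again gives the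
difference quotient. As the bound is only known on `S`, the derivative is taken within `S`. -/
theorem hasDerivWithinAt_res {A : X →ₗ.[ℂ] X} {S : Set ℂ} {M : ℝ}
    (h : ResolventBoundOn A S M) {z : ℂ} (hz : z ∈ S) (hz0 : z ≠ 0) :
    HasDerivWithinAt (res A) (-(res A z * res A z)) S z := by
  have hb : ∀ w ∈ S, w ≠ 0 → ‖res A w‖ ≤ M / ‖w‖ := fun w hw hw0 => by
    rw [le_div_iff₀ (norm_pos_iff.2 hw0), mul_comm, ← norm_smul]
    exact (h w hw).2
  have hcont : ContinuousWithinAt (res A) S z := by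
    rw [ContinuousWithinAt, tendsto_iff_norm_sub_tendsto_zero]
    have hlim : Tendsto (fun w : ℂ => ‖z - w‖ * ((M / ‖w‖) * ‖res A z‖)) (𝓝[S] z) (𝓝 0) := by
      have hc : ContinuousAt (fun w : ℂ => ‖z - w‖ * ((M / ‖w‖) * ‖res A z‖)) z := by
        refine ContinuousAt.mul (by fun_prop) (ContinuousAt.mul ?_ continuousAt_const)
        exact continuousAt_const.div continuous_norm.continuousAt (norm_ne_zero_iff.2 hz0)
      have := hc.tendsto
      simp only [sub_self, norm_zero, zero_mul] at this
      exact this.mono_left nhdsWithin_le_nhds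
    refine squeeze_zero' (Eventually.of_forall fun w => norm_nonneg _) ?_ hlim
    have hne : ∀ᶠ w in 𝓝[S] z, w ≠ 0 :=
      nhdsWithin_le_nhds (isOpen_ne.mem_nhds hz0)
    filter_upwards [hne, self_mem_nhdsWithin] with w hw0 hwS
    rw [res_sub_res (h w hwS).1 (h z hz).1, norm_smul]
    gcongr
    exact (norm_mul_le _ _).trans (by gcongr; exact hb w hwS hw0)
  rw [hasDerivWithinAt_iff_tendsto_slope]
  have h1 : Tendsto (fun w => -(res A w * res A z)) (𝓝[S \ {z}] z) (𝓝 (-(res A z * res A z))) :=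
    ((hcont.mono sdiff_subset).tendsto.mul_const _).neg
  refine h1.congr' ?_
  filter_upwards [self_mem_nhdsWithin] with w hw
  have hwz : w - z ≠ 0 := sub_ne_zero.2 hw.2
  rw [slope_def_module, res_sub_res (h w hw.1).1 (h z hz).1, ← neg_sub w z, neg_smul, smul_neg,
    smul_smul, inv_mul_cancel₀ hwz, one_smul]

theorem differentiableOn_res {A : X →ₗ.[ℂ] X} {S : Set ℂ} {M : ℝ}
    (h : ResolventBoundOn A S M) (hS : (0 : ℂ) ∉ S) : DifferentiableOn ℂ (res A) S :=
  fun _ hz => (hasDerivWithinAt_res h hz fun h0 => hS (h0 ▸ hz)).differentiableWithinAt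

theorem differentiableOn_res_apply {A : X →ₗ.[ℂ] X} {S : Set ℂ} {M : ℝ}
    (h : ResolventBoundOn A S M) (hS : (0 : ℂ) ∉ S) (x : X) :
    DifferentiableOn ℂ (fun z => res A z x) S :=
  (differentiableOn_res h hS).clm_apply (differentiableOn_const x)

/-- The complement of an open sector of angle `ν`. -/
abbrev outside (ν : ℝ) : Set ℂ := {z | ν ≤ |z.arg|}

theorem zero_notMem_outside {ν : ℝ} (hν : 0 < ν) : (0 : ℂ) ∉ outside ν := by
  simp [outside, hν]

theorem neg_ofReal_mem_outside {ν a : ℝ} (hν : ν < Real.pi) (ha : 0 < a) :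
    -(a : ℂ) ∈ outside ν := by
  simp only [outside, mem_ofPred_eq, arg_neg_ofReal ha, abs_of_pos Real.pi_pos]
  exact hν.le

/-- `(s + A)⁻¹` as a bounded operator. -/
def shiftInv (A : X →ₗ.[ℂ] X) (s : ℝ) : X →L[ℂ] X := -res A (-(s : ℂ))

/-! ### A functional calculus for decaying functions -/

/-- `g` decays at `0` and `∞`, is holomorphic on the sector, and `g(A) = G`. -/
structure IsCalculus (A : X →ₗ.[ℂ] X) (ν : ℝ) (g : ℂ → ℂ) (G : X →L[ℂ] X) : Prop where
  diff : DifferentiableOn ℂ g (closedSector ν)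
  bound : ∃ C : ℝ, ∀ z ∈ closedSector ν, ‖g z‖ ≤ C * min ‖z‖ ‖z‖⁻¹
  eq : ∀ x, contourIntegral ν (fun z => g z • res A z x) = G x

variable {A : X →ₗ.[ℂ] X} {ν M : ℝ}

theorem contourIntegrable_smul_res (hA : ResolventBoundOn A (outside ν) M)
    (h0 : 0 < ν) (hν : ν < Real.pi) {g : ℂ → ℂ} (hg : ContinuousOn g (contour ν))
    (hb : ∃ C : ℝ, ∀ z ∈ contour ν, ‖g z‖ ≤ C * min ‖z‖ ‖z‖⁻¹) (x : X) :
    ContourIntegrable ν (fun z => g z • res A z x) := by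
  obtain ⟨C, hC⟩ := hb
  have hr := differentiableOn_res_apply hA (zero_notMem_outside h0) x
  refine contourIntegrable_of_decaysOn h0.le hν
    (hg.smul (hr.continuousOn.mono (contour_subset_outside ν))) ⟨C * (M * ‖x‖), fun z hz => ?_⟩
  have h1 := hC z hz
  have h2 := (hA z (contour_subset_outside ν hz)).2
  calc ‖z • g z • res A z x‖ = ‖g z‖ * ‖(z • res A z) x‖ := by
        rw [smul_comm, norm_smul, smul_apply]
    _ ≤ (C * min ‖z‖ ‖z‖⁻¹) * (M * ‖x‖) := by
        gcongr
        · exact (norm_nonneg _).trans h1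
        · exact (ContinuousLinearMap.le_opNorm _ _).trans (by gcongr)
    _ = _ := by ring

theorem IsCalculus.contourIntegrable (hA : ResolventBoundOn A (outside ν) M)
    (h0 : 0 < ν) (hν : ν < Real.pi) {g : ℂ → ℂ} {G : X →L[ℂ] X} (h : IsCalculus A ν g G) (x : X) :
    ContourIntegrable ν (fun z => g z • res A z x) := by
  obtain ⟨C, hC⟩ := h.bound
  exact contourIntegrable_smul_res hA h0 hν
    (h.diff.continuousOn.mono (contour_subset_closedSector ν))
    ⟨C, fun z hz => hC z (contour_subset_closedSector ν hz)⟩ x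

theorem IsCalculus.congr {g g' : ℂ → ℂ} {G G' : X →L[ℂ] X} (h : IsCalculus A ν g G)
    (h0 : 0 ≤ ν) (hν : ν < Real.pi)
    (hg : ∀ z ∈ closedSector ν, g' z = g z) (hG : G' = G) : IsCalculus A ν g' G' := by
  refine ⟨h.diff.congr hg, ?_, fun x => ?_⟩
  · obtain ⟨C, hC⟩ := h.bound
    exact ⟨C, fun z hz => by rw [hg z hz]; exact hC z hz⟩
  · rw [hG, ← h.eq x]
    exact contourIntegral_congr h0 hν fun z hz => by
      rw [hg z (contour_subset_closedSector ν hz)]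

theorem IsCalculus.add (hA : ResolventBoundOn A (outside ν) M)
    (h0 : 0 < ν) (hν : ν < Real.pi) {g g' : ℂ → ℂ} {G G' : X →L[ℂ] X} (h : IsCalculus A ν g G)
    (h' : IsCalculus A ν g' G') : IsCalculus A ν (fun z => g z + g' z) (G + G') := by
  refine ⟨h.diff.add h'.diff, ?_, fun x => ?_⟩
  · obtain ⟨C, hC⟩ := h.bound
    obtain ⟨D, hD⟩ := h'.bound
    refine ⟨C + D, fun z hz => (norm_add_le _ _).trans ?_⟩
    rw [add_mul]
    exact add_le_add (hC z hz) (hD z hz)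
  · simp only [add_smul]
    rw [contourIntegral_add (h.contourIntegrable hA h0 hν x) (h'.contourIntegrable hA h0 hν x),
      h.eq, h'.eq]
    rfl

theorem IsCalculus.const_mul {g : ℂ → ℂ} {G : X →L[ℂ] X} (h : IsCalculus A ν g G) (c : ℂ) :
    IsCalculus A ν (fun z => c * g z) (c • G) := by
  refine ⟨(differentiableOn_const c).mul h.diff, ?_, fun x => ?_⟩
  · obtain ⟨C, hC⟩ := h.bound
    refine ⟨‖c‖ * C, fun z hz => ?_⟩
    rw [norm_mul, mul_assoc]
    exact mul_le_mul_of_nonneg_left (hC z hz) (norm_nonneg _)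
  · simp only [mul_smul]
    rw [smul_apply, ← h.eq x]
    simp only [contourIntegral, rayIntegral, smul_comm _ c, integral_smul, ← smul_sub]

theorem isCalculus_zero : IsCalculus A ν (fun _ => 0) 0 :=
  ⟨differentiableOn_const 0, ⟨0, by simp⟩, fun x => by simp [contourIntegral, rayIntegral]⟩

theorem IsCalculus.sum (hA : ResolventBoundOn A (outside ν) M)
    (h0 : 0 < ν) (hν : ν < Real.pi) {ι : Type*} (s : Finset ι) {g : ι → ℂ → ℂ}
    {G : ι → X →L[ℂ] X} (h : ∀ i ∈ s, IsCalculus A ν (g i) (G i)) :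
    IsCalculus A ν (fun z => ∑ i ∈ s, g i z) (∑ i ∈ s, G i) := by
  classical
  induction s using Finset.induction_on with
  | empty => simpa using isCalculus_zero
  | insert a s ha ih =>
    simp only [Finset.sum_insert ha]
    exact (h a (Finset.mem_insert_self _ _)).add hA h0 hν
      (ih fun i hi => h i (Finset.mem_insert_of_mem hi))

/-- By the resolvent identity R(z,A)/(a - z) = R(a,A)R(z,A) + R(a,A)/(a - z). The last term,
multiplied by g, is holomorphic inside the sector and integrates to 0. Multiplicativity for such
factors thus needs no double integral. -/
theorem IsCalculus.mul_inv_sub [CompleteSpace X] (hA : ResolventBoundOn A (outside ν) M)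
    (h0 : 0 < ν) (hν : ν < Real.pi) {g : ℂ → ℂ} {G : X →L[ℂ] X} (h : IsCalculus A ν g G) {a : ℂ}
    (ha : ν < |a.arg|) : IsCalculus A ν (fun z => (a - z)⁻¹ * g z) (res A a * G) := by
  obtain ⟨c, hc, hs⟩ := sector_sep h0.le ha (Complex.abs_arg_le_pi a)
  obtain ⟨C, hC⟩ := h.bound
  have ha0 : 0 < ‖a‖ := by
    rw [norm_pos_iff]; rintro rfl; simp at ha; linarith
  have hne : ∀ z ∈ closedSector ν, a - z ≠ 0 := by
    intro z hz
    rw [← norm_pos_iff, norm_sub_rev]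
    exact lt_of_lt_of_le (by positivity) (hs z a hz.2 le_rfl)
  have hd : DifferentiableOn ℂ (fun z => (a - z)⁻¹ * g z) (closedSector ν) :=
    DifferentiableOn.mul (fun z hz => (DifferentiableAt.inv (by fun_prop)
      (hne z hz)).differentiableWithinAt) h.diff
  have hinv : ∀ z ∈ closedSector ν, ‖z‖ * ‖(a - z)⁻¹‖ ≤ c⁻¹ := by
    intro z hz
    rw [norm_inv, ← div_eq_mul_inv, div_le_iff₀ (norm_pos_iff.2 (hne z hz)), inv_mul_eq_div,
      le_div_iff₀ hc, norm_sub_rev]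
    nlinarith [hs z a hz.2 le_rfl]
  have hinv' : ∀ z ∈ closedSector ν, ‖(a - z)⁻¹‖ ≤ (c * ‖a‖)⁻¹ := by
    intro z hz
    rw [norm_inv, norm_sub_rev]
    refine inv_anti₀ (by positivity) ?_
    nlinarith [hs z a hz.2 le_rfl, norm_nonneg z]
  have hbd : ∀ z ∈ closedSector ν, ‖(a - z)⁻¹ * g z‖ ≤ (c * ‖a‖)⁻¹ * C * min ‖z‖ ‖z‖⁻¹ := by
    intro z hz
    rw [norm_mul, mul_assoc]
    exact mul_le_mul (hinv' z hz) (hC z hz) (norm_nonneg _) (by positivity)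
  refine ⟨hd, ⟨_, hbd⟩, fun x => ?_⟩
  have e : ∀ z ∈ contour ν, ((a - z)⁻¹ * g z) • res A z x =
      res A a (g z • res A z x) + ((a - z)⁻¹ * g z) • res A a x := by
    intro z hz
    have hz' := hA z (contour_subset_outside ν hz)
    have h1 := res_sub_res hz'.1 (hA a ha.le).1
    rw [(res_commute hz'.1 (hA a ha.le).1).eq] at h1
    have h2 := DFunLike.congr_fun h1 x
    simp only [sub_apply, smul_apply,
      mul_apply_eq_comp] at h2
    have hn := hne z (contour_subset_closedSector ν hz)
    have h3 : res A a (res A z x) = (a - z)⁻¹ • (res A z x - res A a x) := by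
      rw [h2, smul_smul, inv_mul_cancel₀ hn, one_smul]
    rw [map_smul, h3, smul_smul, mul_comm (g z), smul_sub]
    abel
  have i1 := h.contourIntegrable hA h0 hν x
  have hdx : DifferentiableOn ℂ (fun z => ((a - z)⁻¹ * g z) • res A a x) (closedSector ν) :=
    hd.smul_const _
  have hdec : DecaysOn (closedSector ν) (fun z => ((a - z)⁻¹ * g z) • res A a x) := by
    refine ⟨c⁻¹ * C * ‖res A a x‖, fun z hz => ?_⟩
    rw [norm_smul, norm_smul, norm_mul]
    calc ‖z‖ * (‖(a - z)⁻¹‖ * ‖g z‖ * ‖res A a x‖) =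
        (‖z‖ * ‖(a - z)⁻¹‖) * ‖g z‖ * ‖res A a x‖ := by ring
      _ ≤ c⁻¹ * (C * min ‖z‖ ‖z‖⁻¹) * ‖res A a x‖ := by
        gcongr
        · exact hinv z hz
        · exact hC z hz
      _ = _ := by ring
  rw [contourIntegral_congr h0.le hν e, contourIntegral_add (i1.clm (res A a))
    (contourIntegrable_of_decaysOn h0.le hν (hdx.continuousOn.mono (contour_subset_closedSector ν))
      (hdec.mono (contour_subset_closedSector ν))),
    contourIntegral_clm _ i1, h.eq, contourIntegral_inside h0.le hν hdx hdec, add_zero]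
  rfl

end

end SectorialSum

namespace SectorialSum

open MeasureTheory Set Filter Topology

noncomputable section

variable {X : Type*} [NormedAddCommGroup X] [NormedSpace ℂ X]

variable {A : X →ₗ.[ℂ] X} {ν M : ℝ}

/-! ### Elementary functions of `A`: bands, bumps and regularizers -/

theorem contourIntegral_smul_const {E : Type*} [NormedAddCommGroup E] [NormedSpace ℂ E]
    [CompleteSpace E] {f : ℂ → ℂ} (hf : ContourIntegrable ν f) (v : E) :
    ContourIntegrable ν (fun z => f z • v) ∧
      contourIntegral ν (fun z => f z • v) = contourIntegral ν f • v := by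
  have := contourIntegral_clm (ContinuousLinearMap.toSpanSingleton ℂ v) hf
  have h2 := hf.clm (ContinuousLinearMap.toSpanSingleton ℂ v)
  simp only [ContinuousLinearMap.toSpanSingleton_apply] at this h2
  exact ⟨h2, this⟩

theorem shiftInv_mul_res {A : X →ₗ.[ℂ] X} {z : ℂ} {a : ℝ} (hz : z ∈ resolventSet A)
    (ha : -(a : ℂ) ∈ resolventSet A) :
    res A z + shiftInv A a = ((a : ℂ) + z) • (shiftInv A a * res A z) := by
  have := res_sub_res hz ha
  rw [(res_commute hz ha).eq] at this
  rw [shiftInv, neg_mul, smul_neg, ← sub_eq_add_neg, this, ← neg_smul]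
  congr 1
  ring

theorem shiftInv_mul_shiftInv {A : X →ₗ.[ℂ] X} {a b : ℝ} (ha : -(a : ℂ) ∈ resolventSet A)
    (hb : -(b : ℂ) ∈ resolventSet A) :
    shiftInv A b - shiftInv A a = ((a : ℂ) - b) • (shiftInv A a * shiftInv A b) := by
  have := shiftInv_mul_res hb ha
  have e : res A (-(b : ℂ)) = -shiftInv A b := by rw [shiftInv, neg_neg]
  rw [e, mul_neg, smul_neg] at this
  rw [← neg_inj, ← sub_eq_add_neg] at *
  simp only [neg_neg] at this
  rw [← this]
  abel

theorem shiftInv_commute_res {A : X →ₗ.[ℂ] X} {a : ℝ} {z : ℂ} (ha : -(a : ℂ) ∈ resolventSet A)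
    (hz : z ∈ resolventSet A) : Commute (shiftInv A a) (res A z) :=
  (res_commute ha hz).neg_left

/-- With L = (b + A)⁻¹ - (a + A)⁻¹ and G the band operator, G = AL and K = AG. Hence G R(z,A) =
L(zR(z,A) - 1) is bounded near 0, and G(zR(z,A) - 1) = K R(z,A) is O(1/|z|) at infinity. Subtracting
x/(z - 1) removes the leading term x/z at infinity, at the price of a pole at 1, which lies off this
region. -/
theorem bandOp_decays (hA : ResolventBoundOn A (outside ν) M) (h0 : 0 < ν) (hν : ν < Real.pi)
    {a b : ℝ} (ha : 0 < a) (hb : 0 < b) (x : X) :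
    DecaysOn (outside ν) (fun z => ((a : ℂ) • shiftInv A a - (b : ℂ) • shiftInv A b)
      (res A z x - (z - 1)⁻¹ • x)) := by
  obtain ⟨c, hc, hs⟩ := sector_sep (s := 0) le_rfl h0 hν.le
  have hM : 0 ≤ M := (norm_nonneg _).trans (hA _ (neg_ofReal_mem_outside hν one_pos)).2
  have ra := (hA _ (neg_ofReal_mem_outside hν ha)).1
  have rb := (hA _ (neg_ofReal_mem_outside hν hb)).1
  set G := (a : ℂ) • shiftInv A a - (b : ℂ) • shiftInv A b with hG
  set K := (a : ℂ) • (1 - (a : ℂ) • shiftInv A a) - (b : ℂ) • (1 - (b : ℂ) • shiftInv A b) with hK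
  set L := shiftInv A b - shiftInv A a with hL
  have hGL : ∀ z ∈ outside ν, G * res A z = L * (z • res A z - 1) := by
    intro z hz
    have hz' := (hA z hz).1
    have h1 := shiftInv_mul_res hz' ra
    have h2 := shiftInv_mul_res hz' rb
    simp only [hG, hL, sub_mul, mul_sub, mul_one, smul_mul_assoc, mul_smul_comm]
    rw [add_smul] at h1 h2
    linear_combination (norm := module) h2 - h1
  have hGK : ∀ z ∈ outside ν, G * (z • res A z - 1) = K * res A z := by
    intro z hz
    have hz' := (hA z hz).1
    have h1 := shiftInv_mul_res hz' ra
    have h2 := shiftInv_mul_res hz' rb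
    simp only [hG, hK, sub_mul, mul_sub, mul_one, one_mul, smul_mul_assoc, mul_smul_comm]
    rw [add_smul] at h1 h2
    linear_combination (norm := module) (b : ℂ) • h2 - (a : ℂ) • h1
  have hone : ∀ z ∈ outside ν, c * (1 + ‖z‖) ≤ ‖z - 1‖ := by
    intro z hz
    have := hs 1 z (by simp) hz
    rw [norm_sub_rev]
    simpa using this
  have hz0 : ∀ z ∈ outside ν, 0 < ‖z‖ := fun z hz => by
    rw [norm_pos_iff]; rintro rfl; exact zero_notMem_outside h0 hz
  refine ⟨max (‖L‖ * (M + 1) * ‖x‖ + ‖G‖ * c⁻¹ * ‖x‖) (c⁻¹ * ((‖K‖ + ‖G‖) * M * ‖x‖)),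
    fun z hz => ?_⟩
  have hzp := hz0 z hz
  have hn1 : 0 < ‖z - 1‖ := lt_of_lt_of_le (by positivity) (hone z hz)
  have hx : ‖z • res A z x‖ ≤ M * ‖x‖ := by
    rw [← smul_apply]
    exact (ContinuousLinearMap.le_opNorm _ _).trans (by gcongr; exact (hA z hz).2)
  rw [mul_min_of_nonneg _ _ (le_max_of_le_right (by positivity))]
  refine le_min ?_ ?_
  · have e : G (res A z x - (z - 1)⁻¹ • x) = L (z • res A z x - x) - (z - 1)⁻¹ • G x := by
      have := DFunLike.congr_fun (hGL z hz) x
      simp only [mul_apply_eq_comp, sub_apply, smul_apply, one_apply_eq_self] at this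
      rw [map_sub, this, map_smul]
    simp only [e]
    rw [norm_smul, mul_comm]
    gcongr
    refine le_trans ?_ (le_max_left _ _)
    refine (norm_sub_le _ _).trans (add_le_add ?_ ?_)
    · rw [mul_assoc]
      refine (ContinuousLinearMap.le_opNorm _ _).trans ?_
      gcongr
      refine (norm_sub_le _ _).trans ?_
      linarith
    · rw [norm_smul, norm_inv]
      have : ‖z - 1‖⁻¹ ≤ c⁻¹ := inv_anti₀ hc (le_trans (by nlinarith) (hone z hz))
      calc ‖z - 1‖⁻¹ * ‖G x‖ ≤ c⁻¹ * (‖G‖ * ‖x‖) := by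
            gcongr
            exact ContinuousLinearMap.le_opNorm _ _
        _ = _ := by ring
  · have hne : z - 1 ≠ 0 := norm_pos_iff.1 hn1
    have e : G (res A z x - (z - 1)⁻¹ • x) = (z - 1)⁻¹ • (K (res A z x) - G (res A z x)) := by
      have := DFunLike.congr_fun (hGK z hz) x
      simp only [mul_apply_eq_comp, sub_apply, smul_apply, one_apply_eq_self] at this
      rw [← this, ← map_sub, ← map_smul]
      congr 1
      have e1 : z • res A z x - x - res A z x = (z - 1) • res A z x - x := by module
      rw [e1, smul_sub, smul_smul, inv_mul_cancel₀ hne, one_smul]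
    simp only [e]
    have e2 : z • (z - 1)⁻¹ • (K (res A z x) - G (res A z x)) =
      (z - 1)⁻¹ • (K (z • res A z x) - G (z • res A z x)) := by
      rw [smul_comm, smul_sub, map_smul, map_smul]
    rw [e2, norm_smul, norm_inv]
    have h1 : ‖z - 1‖⁻¹ ≤ c⁻¹ * ‖z‖⁻¹ := by
      rw [← mul_inv]
      exact inv_anti₀ (by positivity) (le_trans (by nlinarith) (hone z hz))
    have h2 : ‖K (z • res A z x) - G (z • res A z x)‖ ≤ (‖K‖ + ‖G‖) * M * ‖x‖ := by
      refine (norm_sub_le _ _).trans ?_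
      have a1 := (K.le_opNorm (z • res A z x)).trans
        (mul_le_mul_of_nonneg_left hx (norm_nonneg K))
      have a2 := (G.le_opNorm (z • res A z x)).trans
        (mul_le_mul_of_nonneg_left hx (norm_nonneg G))
      linarith
    calc _ ≤ (c⁻¹ * ‖z‖⁻¹) * ((‖K‖ + ‖G‖) * M * ‖x‖) := by gcongr
      _ = (c⁻¹ * ((‖K‖ + ‖G‖) * M * ‖x‖)) * ‖z‖⁻¹ := by ring
      _ ≤ _ := by gcongr; exact le_max_right _ _

/-- The function `a/(a+z) - b/(b+z)` and the corresponding operator. -/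
theorem isCalculus_band [CompleteSpace X] (hA : ResolventBoundOn A (outside ν) M) (h0 : 0 < ν)
    (hν : ν < Real.pi) {a b : ℝ} (ha : 0 < a) (hb : 0 < b) :
    IsCalculus A ν (fun z => a * ((a : ℂ) + z)⁻¹ - b * ((b : ℂ) + z)⁻¹)
      ((a : ℂ) • shiftInv A a - (b : ℂ) • shiftInv A b) := by
  have ra := (hA _ (neg_ofReal_mem_outside hν ha)).1
  have rb := (hA _ (neg_ofReal_mem_outside hν hb)).1
  have da := differentiableOn_inv_add h0.le hν ha
  have db := differentiableOn_inv_add h0.le hν hb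
  refine ⟨((differentiableOn_const _).mul da).sub ((differentiableOn_const _).mul db), ?_, ?_⟩
  · obtain ⟨C, hC⟩ := inv_add_sub_inv_add_decays h0.le hν hb ha
    refine ⟨C, fun z hz => ?_⟩
    refine le_of_eq_of_le ?_ (hC z hz)
    have := add_ne_zero_of_mem_closedSector h0.le hν ha hz
    have := add_ne_zero_of_mem_closedSector h0.le hν hb hz
    congr 1
    simp only [smul_eq_mul]
    field_simp
    ring
  · intro x
    set G := (a : ℂ) • shiftInv A a - (b : ℂ) • shiftInv A b with hG
    have hdec := bandOp_decays hA h0 hν ha hb x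
    have hdiff : DifferentiableOn ℂ (fun z => G (res A z x - (z - 1)⁻¹ • x)) (outside ν) := by
      refine (differentiableOn_const G).clm_apply
        ((differentiableOn_res_apply hA (zero_notMem_outside h0) x).sub
          (DifferentiableOn.smul_const (fun z hz => ?_) x))
      refine (DifferentiableAt.inv (by fun_prop) ?_).differentiableWithinAt
      intro h
      rw [sub_eq_zero] at h
      subst h
      simp [outside] at hz
      linarith
    obtain ⟨ia, ea⟩ := inv_sub_one_sub_inv_add_contourIntegrable h0 hν ha
    obtain ⟨ib, eb⟩ := inv_sub_one_sub_inv_add_contourIntegrable h0 hν hb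
    -- The first summand is holomorphic outside the sector and decays, so it integrates to 0. The
    -- other two are scalar functions of integral 1 times fixed vectors, and these vectors add up to
    -- the claimed value.
    have e : ∀ z ∈ contour ν, (a * ((a : ℂ) + z)⁻¹ - b * ((b : ℂ) + z)⁻¹) • res A z x =
        G (res A z x - (z - 1)⁻¹ • x) +
        (((z - 1)⁻¹ - ((a : ℂ) + z)⁻¹) • ((a : ℂ) • shiftInv A a x) +
          ((z - 1)⁻¹ - ((b : ℂ) + z)⁻¹) • (-(b : ℂ) • shiftInv A b x)) := by
      intro z hz
      have hz' := (hA z (contour_subset_outside ν hz)).1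
      have key : ∀ c : ℝ, 0 < c → -(c : ℂ) ∈ resolventSet A → ((c : ℂ) + z)⁻¹ • res A z x =
          shiftInv A c (res A z x) - ((c : ℂ) + z)⁻¹ • shiftInv A c x := by
        intro c hc hcr
        have hne := add_ne_zero_of_mem_closedSector h0.le hν hc (contour_subset_closedSector ν hz)
        have := DFunLike.congr_fun (shiftInv_mul_res hz' hcr) x
        simp only [add_apply, smul_apply, mul_apply_eq_comp] at this
        rw [eq_sub_iff_add_eq, ← smul_add, this, smul_smul, inv_mul_cancel₀ hne, one_smul]
      rw [sub_smul, mul_smul, mul_smul, key a ha ra, key b hb rb]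
      simp only [hG, sub_apply, smul_apply, map_sub, map_smul]
      module
    rw [contourIntegral_congr h0.le hν e, contourIntegral_add, contourIntegral_add,
      contourIntegral_outside h0 hν hdiff hdec, (contourIntegral_smul_const ia _).2,
      (contourIntegral_smul_const ib _).2, ea, eb, hG]
    · simp only [sub_apply, smul_apply]
      module
    · exact (contourIntegral_smul_const ia _).1
    · exact (contourIntegral_smul_const ib _).1
    · exact contourIntegrable_of_decaysOn h0.le hν
        (hdiff.continuousOn.mono (contour_subset_outside ν)) (hdec.mono (contour_subset_outside ν))
    · exact (contourIntegral_smul_const ia _).1.add (contourIntegral_smul_const ib _).1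

/-- The function `s z / (s + z)²`. -/
def bump (s : ℝ) (z : ℂ) : ℂ := s * z / (s + z) ^ 2

/-- The operator `s A (s + A)⁻²`. -/
def bumpOp (A : X →ₗ.[ℂ] X) (s : ℝ) : X →L[ℂ] X :=
  (s : ℂ) • shiftInv A s - ((s : ℂ) • shiftInv A s) * ((s : ℂ) • shiftInv A s)

/-- The double pole is reached from the band between 2s and s, which equals sz/((2s + z)(s + z)),
through the factor (2s + z)/(s + z) = 1 + s/(s + z). -/
theorem isCalculus_bump [CompleteSpace X] (hA : ResolventBoundOn A (outside ν) M) (h0 : 0 < ν)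
    (hν : ν < Real.pi) {s : ℝ} (hs : 0 < s) : IsCalculus A ν (bump s) (bumpOp A s) := by
  have h1 := isCalculus_band hA h0 hν (a := 2 * s) (b := s) (by positivity) hs
  have ra := (hA _ (neg_ofReal_mem_outside hν (by positivity : 0 < 2 * s))).1
  have rb := (hA _ (neg_ofReal_mem_outside hν hs)).1
  have h2 := h1.mul_inv_sub hA h0 hν (a := -(s : ℂ))
    (by rw [arg_neg_ofReal hs, abs_of_pos Real.pi_pos]; exact hν)
  refine (h1.add hA h0 hν (h2.const_mul (-(s : ℂ)))).congr h0.le hν (fun z hz => ?_) ?_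
  · have n1 := add_ne_zero_of_mem_closedSector h0.le hν (by positivity : 0 < 2 * s) hz
    have n2 := add_ne_zero_of_mem_closedSector h0.le hν hs hz
    have n3 : -(s : ℂ) - z ≠ 0 := by
      rw [← neg_ne_zero, neg_sub, sub_neg_eq_add, add_comm]; exact n2
    have e3 : (-(s : ℂ) - z)⁻¹ = -((s : ℂ) + z)⁻¹ := by rw [← inv_neg]; ring_nf
    rw [bump, e3]
    push_cast at n1 ⊢
    rw [mul_comm] at n1
    field_simp
    ring
  · have e : res A (-(s : ℂ)) = -shiftInv A s := by rw [shiftInv, neg_neg]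
    have k := shiftInv_mul_shiftInv rb ra
    rw [e, bumpOp]
    simp only [mul_sub, mul_smul_comm, smul_mul_assoc, neg_mul]
    push_cast at k ⊢
    linear_combination (norm := module) (-(2 * (s : ℂ))) • k

theorem regFun_eq {n : ℕ} (hn : 1 ≤ n) (z : ℂ) : regFun n z =
    ((n : ℝ) : ℂ) * (((n : ℝ) : ℂ) + z)⁻¹ -
      (((n : ℝ)⁻¹ : ℝ) : ℂ) * ((((n : ℝ)⁻¹ : ℝ) : ℂ) + z)⁻¹ := by
  have hn0 : (n : ℂ) ≠ 0 := by exact_mod_cast (by omega : n ≠ 0)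
  rw [regFun]
  push_cast
  congr 1
  rw [one_div, ← mul_inv]
  congr 1
  field_simp

theorem regOp_eq (A : X →ₗ.[ℂ] X) (n : ℕ) : regOp A n =
    ((n : ℝ) : ℂ) • shiftInv A n - (((n : ℝ)⁻¹ : ℝ) : ℂ) • shiftInv A (n : ℝ)⁻¹ := by
  rw [regOp, shiftInv, shiftInv]
  push_cast
  module

theorem isCalculus_reg [CompleteSpace X] (hA : ResolventBoundOn A (outside ν) M) (h0 : 0 < ν)
    (hν : ν < Real.pi) {n : ℕ} (hn : 1 ≤ n) : IsCalculus A ν (regFun n) (regOp A n) := by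
  have hn0 : (0 : ℝ) < n := by exact_mod_cast hn
  exact (isCalculus_band hA h0 hν hn0 (inv_pos.2 hn0)).congr h0.le hν (fun z _ => regFun_eq hn z)
    (regOp_eq A n)

/-! ### Dense ranges -/

theorem denseRange_shiftInv {a : ℝ} (ha : -(a : ℂ) ∈ resolventSet A)
    (hd : Dense (A.domain : Set X)) : DenseRange (shiftInv A a) := by
  refine hd.mono fun x hx => ?_
  refine ⟨(a : ℂ) • x + A ⟨x, hx⟩, ?_⟩
  rw [shiftInv, neg_apply, map_add, map_smul, res_map ha]
  module

theorem one_sub_smul_shiftInv_apply {a : ℝ} (ha : -(a : ℂ) ∈ resolventSet A) (x : A.domain) :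
    (1 - (a : ℂ) • shiftInv A a) ((a : ℂ) • (x : X) + A x) = A x := by
  rw [sub_apply, one_apply_eq_self, smul_apply, shiftInv, neg_apply, map_add, map_smul, res_map ha]
  module

theorem denseRange_one_sub {a : ℝ} (ha : -(a : ℂ) ∈ resolventSet A)
    (hd : DenseRange A) : DenseRange (1 - (a : ℂ) • shiftInv A a : X →L[ℂ] X) := by
  refine hd.mono ?_
  rintro _ ⟨x, rfl⟩
  exact ⟨_, one_sub_smul_shiftInv_apply ha x⟩

theorem denseRange_mul {S T : X →L[ℂ] X} (hS : DenseRange S) (hT : DenseRange T) :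
    DenseRange (S * T) := by
  have := hS.comp hT S.continuous
  exact this

theorem denseRange_smul {T : X →L[ℂ] X} (hT : DenseRange T) {c : ℂ} (hc : c ≠ 0) :
    DenseRange (c • T) := by
  have h : DenseRange (c • (1 : X →L[ℂ] X)) := by
    refine Function.Surjective.denseRange fun x => ⟨c⁻¹ • x, ?_⟩
    rw [smul_apply, one_apply_eq_self, smul_smul, mul_inv_cancel₀ hc, one_smul]
  have := denseRange_mul h hT
  rwa [smul_mul_assoc, one_mul] at this

theorem denseRange_bumpOp {s : ℝ} (hs : 0 < s) (hr : -(s : ℂ) ∈ resolventSet A)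
    (hd : Dense (A.domain : Set X)) (hd' : DenseRange A) : DenseRange (bumpOp A s) := by
  have : bumpOp A s = (s : ℂ) • (shiftInv A s * (1 - (s : ℂ) • shiftInv A s)) := by
    rw [bumpOp, mul_sub, mul_one, smul_sub, smul_mul_assoc]
  rw [this]
  exact denseRange_smul (denseRange_mul (denseRange_shiftInv hr hd) (denseRange_one_sub hr hd'))
    (by exact_mod_cast hs.ne')

/-- The operator is (n - 1/n)(n + A)⁻¹ A (1/n + A)⁻¹. For n = 1 it vanishes, so n = 2 is the first
useful regularizer and the one used below. -/
theorem denseRange_regOp {n : ℕ} (hn : 1 < n) (hr : -((n : ℝ) : ℂ) ∈ resolventSet A)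
    (hr' : -(((n : ℝ)⁻¹ : ℝ) : ℂ) ∈ resolventSet A)
    (hd : Dense (A.domain : Set X)) (hd' : DenseRange A) : DenseRange (regOp A n) := by
  have k := shiftInv_mul_shiftInv hr hr'
  have : regOp A n = (((n : ℝ) : ℂ) - ((n : ℝ)⁻¹ : ℝ)) •
      (shiftInv A n * (1 - (((n : ℝ)⁻¹ : ℝ) : ℂ) • shiftInv A (n : ℝ)⁻¹)) := by
    rw [regOp_eq, mul_sub, mul_one, mul_smul_comm]
    linear_combination (norm := module) -(((n : ℝ)⁻¹ : ℝ) : ℂ) • k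
  rw [this]
  refine denseRange_smul (denseRange_mul (denseRange_shiftInv hr hd) (denseRange_one_sub hr' hd')) ?_
  have h1 : (1 : ℝ) < n := by exact_mod_cast hn
  have : (n : ℝ) - (n : ℝ)⁻¹ ≠ 0 := by
    have := inv_lt_one_of_one_lt₀ h1
    linarith
  exact_mod_cast this

end

end SectorialSum

namespace SectorialSum

open MeasureTheory Set Filter Topology

noncomputable section

variable {X : Type*} [NormedAddCommGroup X] [NormedSpace ℂ X]

variable {A : X →ₗ.[ℂ] X} {ν σ M : ℝ}

/-! ### Boundedness of the `H^∞` calculus -/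

theorem integral_Ioi_eq_integral_exp {E : Type*} [NormedAddCommGroup E] [NormedSpace ℝ E]
    (F : ℝ → E) : ∫ t in Ioi (0 : ℝ), F t = ∫ r : ℝ, Real.exp r • F (Real.exp r) := by
  rw [← Real.range_exp, ← image_univ, integral_image_eq_integral_abs_deriv_smul MeasurableSet.univ
    (fun x _ => (Real.hasDerivAt_exp x).hasDerivWithinAt) Real.exp_injective.injOn,
    Measure.restrict_univ]
  simp only [Real.abs_exp]

theorem polar_eq (θ r : ℝ) : polar θ r = Real.exp r * Complex.exp (θ * Complex.I) := by
  rw [polar, Complex.exp_add, Complex.ofReal_exp]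

theorem cauchyIntegral_eq {f : ℂ → ℂ} {x : X}
    (h : ContourIntegrable ν (fun z => f z • res A z x)) :
    cauchyIntegral A ν f x = contourIntegral ν (fun z => f z • res A z x) := by
  rw [cauchyIntegral, contourIntegral, integral_Ioi_eq_integral_exp, rayIntegral, rayIntegral,
    ← integral_sub h.1 h.2]
  congr 2
  ext r
  simp only [polar_eq, Complex.ofReal_neg, smul_sub, mul_smul]
  rw [Complex.coe_smul, Complex.coe_smul]

/-- The total mass of `e^{-|r|}`. -/
def expMass : ℝ := ∫ r : ℝ, Real.exp (-|r|)

theorem expMass_nonneg : 0 ≤ expMass := integral_nonneg fun _ => (Real.exp_pos _).le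

theorem norm_contourIntegral_le {E : Type*} [NormedAddCommGroup E] [NormedSpace ℂ E]
    (h0 : 0 ≤ ν) (hν : ν < Real.pi) {G : ℂ → E} {C : ℝ} (hC : 0 ≤ C)
    (hG : ∀ z ∈ contour ν, ‖z • G z‖ ≤ C * min ‖z‖ ‖z‖⁻¹) :
    ‖contourIntegral ν G‖ ≤ C * expMass := by
  have key : ∀ θ : ℝ, (∀ r : ℝ, polar θ r ∈ contour ν) → ‖rayIntegral θ G‖ ≤ C * expMass := by
    intro θ hθ
    rw [expMass, ← integral_const_mul]
    refine norm_integral_le_of_norm_le (integrable_exp_neg_abs.const_mul C) (ae_of_all _ fun r => ?_)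
    have := hG _ (hθ r)
    rwa [norm_polar, min_exp] at this
  have h1 := key ν (polar_mem_contour h0 hν)
  have h2 := key (-ν) (polar_neg_mem_contour h0 hν)
  have hp : ‖(-1 / (2 * Real.pi * Complex.I) : ℂ)‖ ≤ 1 / 2 := by
    rw [norm_div, norm_neg, norm_one, norm_mul, norm_mul, Complex.norm_I, Complex.norm_real,
      Real.norm_of_nonneg Real.pi_pos.le, Complex.norm_ofNat]
    have := Real.two_le_pi
    rw [mul_one]
    exact one_div_le_one_div_of_le (by norm_num) (by linarith)
  rw [contourIntegral, norm_smul]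
  have h3 : ‖rayIntegral ν G - rayIntegral (-ν) G‖ ≤ 2 * (C * expMass) := by
    refine (norm_sub_le _ _).trans ?_
    linarith
  have : 0 ≤ C * expMass := mul_nonneg hC expMass_nonneg
  calc _ ≤ 1 / 2 * (2 * (C * expMass)) := by gcongr
    _ = _ := by ring

theorem isOpen_sector (hσ : σ < Real.pi) : IsOpen (sector σ) := by
  have : sector σ = Complex.slitPlane ∩ (fun z : ℂ => |z.arg|) ⁻¹' (Iio σ) := by
    ext z
    simp only [sector, mem_ofPred_eq, mem_inter_iff, mem_preimage, mem_Iio]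
    constructor
    · rintro ⟨h0, h1⟩
      refine ⟨Complex.mem_slitPlane_iff_arg.2 ⟨fun h => ?_, h0⟩, h1⟩
      rw [h, abs_of_pos Real.pi_pos] at h1
      linarith
    · rintro ⟨h0, h1⟩
      exact ⟨Complex.slitPlane_ne_zero h0, h1⟩
  rw [this]
  refine ContinuousOn.isOpen_inter_preimage ?_ Complex.isOpen_slitPlane isOpen_Iio
  intro z hz
  exact (Complex.continuousAt_arg hz).abs.continuousWithinAt

theorem contour_subset_sector (h : ν < σ) : contour ν ⊆ sector σ :=
  fun _ hz => ⟨hz.1, hz.2.trans_lt h⟩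

open Classical in
/-- Extension by zero of a function on a sector. -/
def extendZero (f : BoundedContinuousFunction (sector σ) ℂ) (z : ℂ) : ℂ :=
  if h : z ∈ sector σ then f ⟨z, h⟩ else 0

theorem extendZero_of_mem (f : BoundedContinuousFunction (sector σ) ℂ) {z : ℂ}
    (h : z ∈ sector σ) : extendZero f z = f ⟨z, h⟩ := by rw [extendZero, dif_pos h]

/-- The Banach space of bounded holomorphic functions on a sector. -/
def hInfty (σ : ℝ) : Submodule ℂ (BoundedContinuousFunction (sector σ) ℂ) where
  carrier := {f | DifferentiableOn ℂ (extendZero f) (sector σ)}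
  add_mem' {f g} hf hg := by
    refine (hf.add hg).congr fun z hz => ?_
    simp [extendZero_of_mem _ hz]
  zero_mem' := by
    refine (differentiableOn_const (0 : ℂ)).congr fun z hz => ?_
    simp [extendZero_of_mem _ hz]
  smul_mem' c f hf := by
    refine ((differentiableOn_const c).mul hf).congr fun z hz => ?_
    simp [extendZero_of_mem _ hz]

/-- Uniform limits of holomorphic functions are holomorphic. The resulting completeness is needed
for the closed graph theorem. -/
theorem isClosed_hInfty (hσ : σ < Real.pi) :
    IsClosed (hInfty σ : Set (BoundedContinuousFunction (sector σ) ℂ)) := by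
  refine IsSeqClosed.isClosed fun u f hu hf => ?_
  have h1 : TendstoUniformlyOn (fun n => extendZero (u n)) (extendZero f) atTop (sector σ) := by
    rw [Metric.tendstoUniformlyOn_iff]
    intro ε hε
    rw [Metric.tendsto_nhds] at hf
    filter_upwards [hf ε hε] with n hn z hz
    rw [extendZero_of_mem _ hz, extendZero_of_mem _ hz, dist_comm]
    exact (BoundedContinuousFunction.dist_coe_le_dist _).trans_lt hn
  exact h1.tendstoLocallyUniformlyOn.differentiableOn (Eventually.of_forall hu) (isOpen_sector hσ)

theorem norm_extendZero_le (f : BoundedContinuousFunction (sector σ) ℂ) (z : ℂ) :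
    ‖extendZero f z‖ ≤ ‖f‖ := by
  by_cases h : z ∈ sector σ
  · rw [extendZero_of_mem _ h]; exact f.norm_coe_le_norm _
  · rw [extendZero, dif_neg h, norm_zero]; exact norm_nonneg _

theorem differentiableOn_regFun (h0 : 0 < ν) (hν : ν < Real.pi) {n : ℕ} (hn : 1 ≤ n) :
    DifferentiableOn ℂ (regFun n) (closedSector ν) := by
  have hn0 : (0 : ℝ) < n := by exact_mod_cast hn
  refine DifferentiableOn.congr (((differentiableOn_const _).mul
    (differentiableOn_inv_add h0.le hν hn0)).sub ((differentiableOn_const _).mul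
    (differentiableOn_inv_add h0.le hν (inv_pos.2 hn0)))) fun z _ => regFun_eq hn z

/-- The Cauchy integral of `φ_n f` as a linear map in `f`, bounded by `‖f‖`. -/
theorem regularized_integral (hA : ResolventBoundOn A (outside ν) M)
    (h0 : 0 < ν) (hν : ν < Real.pi) (hνσ : ν < σ) [CompleteSpace X] {n : ℕ} (hn : 1 ≤ n) :
    ∃ C : ℝ, 0 ≤ C ∧ ∀ f : ℂ → ℂ, DifferentiableOn ℂ f (sector σ) →
      ∀ B : ℝ, 0 ≤ B → (∀ z ∈ sector σ, ‖f z‖ ≤ B) → ∀ x : X,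
      ContourIntegrable ν (fun z => (regFun n z * f z) • res A z x) ∧
      ‖contourIntegral ν (fun z => (regFun n z * f z) • res A z x)‖ ≤ C * B * ‖x‖ := by
  obtain ⟨D, hD⟩ := (isCalculus_reg hA h0 hν hn).bound
  have hD0 : 0 ≤ D := by
    have h1 : (1 : ℂ) ∈ closedSector ν := ⟨one_ne_zero, by simpa using h0.le⟩
    have := (norm_nonneg _).trans (hD 1 h1)
    simpa using this
  have hM : 0 ≤ M := (norm_nonneg _).trans (hA _ (neg_ofReal_mem_outside hν one_pos)).2
  refine ⟨D * M * expMass, mul_nonneg (mul_nonneg hD0 hM) expMass_nonneg,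
    fun f hf B hB0 hB x => ?_⟩
  have hb : ∀ z ∈ contour ν, ‖regFun n z * f z‖ ≤ (D * B) * min ‖z‖ ‖z‖⁻¹ := by
    intro z hz
    rw [norm_mul]
    have h1 := hD z (contour_subset_closedSector ν hz)
    calc _ ≤ (D * min ‖z‖ ‖z‖⁻¹) * B := by
          gcongr
          exact hB z (contour_subset_sector hνσ hz)
      _ = _ := by ring
  have hc : ContinuousOn (fun z => regFun n z * f z) (contour ν) :=
    ((differentiableOn_regFun h0 hν hn).continuousOn.mono (contour_subset_closedSector ν)).mul
      (hf.continuousOn.mono (contour_subset_sector hνσ))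
  refine ⟨contourIntegrable_smul_res hA h0 hν hc ⟨_, hb⟩ x, ?_⟩
  refine (norm_contourIntegral_le (C := (D * B) * (M * ‖x‖)) h0.le hν (by positivity)
    fun z hz => ?_).trans (le_of_eq (by ring))
  calc ‖z • (regFun n z * f z) • res A z x‖ = ‖regFun n z * f z‖ * ‖(z • res A z) x‖ := by
        rw [smul_comm, norm_smul, smul_apply]
    _ ≤ ((D * B) * min ‖z‖ ‖z‖⁻¹) * (M * ‖x‖) := by
        gcongr
        · exact hb z hz
        · exact (ContinuousLinearMap.le_opNorm _ _).trans
            (by gcongr; exact (hA z (contour_subset_outside ν hz)).2)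
    _ = _ := by ring

theorem clm_ext_denseRange {S T P : X →L[ℂ] X} (hP : DenseRange P)
    (h : ∀ x, S (P x) = T (P x)) : S = T := by
  ext y
  exact congr_fun (hP.equalizer S.continuous T.continuous (funext h)) y

/-- Closed graph theorem: `T f` is determined by its values on the dense range of `P`. There it is
given by `J`, which is linear and bounded in f, so `T` is linear with closed graph. -/
theorem exists_bound_of_denseRange [CompleteSpace X] {H : Type*} [NormedAddCommGroup H]
    [NormedSpace ℂ H] [CompleteSpace H] {P : X →L[ℂ] X} (hP : DenseRange P)
    (T : H → X →L[ℂ] X) (J : H → X → X) (hT : ∀ f x, T f (P x) = J f x)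
    (hadd : ∀ f g x, J (f + g) x = J f x + J g x) (hsmul : ∀ (c : ℂ) f x, J (c • f) x = c • J f x)
    {K : ℝ} (hJ : ∀ f x, ‖J f x‖ ≤ K * ‖f‖ * ‖x‖) : ∃ C : ℝ, 0 ≤ C ∧ ∀ f, ‖T f‖ ≤ C * ‖f‖ := by
  let L : H →ₗ[ℂ] (X →L[ℂ] X) :=
    { toFun := T
      map_add' := fun f g => clm_ext_denseRange hP fun x => by
        rw [add_apply, hT, hT, hT, hadd]
      map_smul' := fun c f => clm_ext_denseRange hP fun x => by
        rw [smul_apply, hT, RingHom.id_apply, hT, hsmul] }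
  have hcont : Continuous L := by
    refine L.continuous_of_seq_closed_graph fun u f S hu hS => ?_
    refine clm_ext_denseRange hP fun x => ?_
    have l1 : Tendsto (fun n => T (u n) (P x)) atTop (𝓝 (S (P x))) :=
      ((ContinuousLinearMap.apply ℂ X (P x)).continuous.tendsto S).comp hS
    have l2 : Tendsto (fun n => T (u n) (P x)) atTop (𝓝 (T f (P x))) := by
      rw [tendsto_iff_norm_sub_tendsto_zero]
      have l3 : Tendsto (fun n => K * ‖u n - f‖ * ‖x‖) atTop (𝓝 0) := by
        have := ((tendsto_iff_norm_sub_tendsto_zero.1 hu).const_mul K).mul_const ‖x‖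
        rw [mul_zero, zero_mul] at this
        exact this
      refine squeeze_zero (fun n => norm_nonneg _) (fun n => ?_) l3
      have e : T (u n) (P x) - T f (P x) = T (u n - f) (P x) := by
        change L (u n) (P x) - L f (P x) = L (u n - f) (P x)
        rw [map_sub]; rfl
      rw [e, hT]
      exact hJ _ x
    exact tendsto_nhds_unique l1 l2
  exact ⟨‖(⟨L, hcont⟩ : H →L[ℂ] (X →L[ℂ] X))‖, ContinuousLinearMap.opNorm_nonneg _,
    fun f => (⟨L, hcont⟩ : H →L[ℂ] (X →L[ℂ] X)).le_opNorm f⟩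

theorem exists_ofNormedAddCommGroup {α : Type*} [TopologicalSpace α] {f : α → ℂ}
    (hf : Continuous f) {B : ℝ} (hB0 : 0 ≤ B) (hB : ∀ z, ‖f z‖ ≤ B) :
    ∃ g : BoundedContinuousFunction α ℂ, ‖g‖ ≤ B ∧ ∀ z, g z = f z :=
  ⟨BoundedContinuousFunction.ofNormedAddCommGroup f hf B hB,
    BoundedContinuousFunction.norm_ofNormedAddCommGroup_le _ hB0 hB, fun _ => rfl⟩

theorem exists_boundedContinuousFunction {f : ℂ → ℂ} (hf : DifferentiableOn ℂ f (sector σ)) {B : ℝ}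
    (hB0 : 0 ≤ B) (hB : ∀ z ∈ sector σ, ‖f z‖ ≤ B) :
    ∃ g : BoundedContinuousFunction (sector σ) ℂ,
      ‖g‖ ≤ B ∧ ∀ z ∈ sector σ, extendZero g z = f z := by
  obtain ⟨g, h1, h2⟩ := exists_ofNormedAddCommGroup hf.continuousOn.domRestrict hB0
    (fun z => hB z.1 z.2)
  refine ⟨g, h1, fun z hz => ?_⟩
  rw [extendZero_of_mem _ hz, h2]
  rfl

/-- The hypothesis gives a bounded f(A) for each f separately; the closed graph theorem turns this
into a bound by the supremum of f. One regularizer and one contour are enough, as `regOp A 2` has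
dense range. -/
theorem hInfty_bound [CompleteSpace X] (hA : ResolventBoundOn A (outside ν) M)
    (h0 : 0 < ν) (hσ : σ < Real.pi) (hνσ : ν < σ) (hd : Dense (A.domain : Set X))
    (hd' : DenseRange A)
    (hH : ∀ f : ℂ → ℂ, MemHInfty σ f → ∃ T : X →L[ℂ] X, ∀ x,
      T (regOp A 2 x) = contourIntegral ν (fun z => (regFun 2 z * f z) • res A z x)) :
    ∃ C : ℝ, 0 ≤ C ∧ ∀ f : ℂ → ℂ, DifferentiableOn ℂ f (sector σ) →
      ∀ B : ℝ, 0 ≤ B → (∀ z ∈ sector σ, ‖f z‖ ≤ B) → ∀ T : X →L[ℂ] X,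
      (∀ x, T (regOp A 2 x) = contourIntegral ν (fun z => (regFun 2 z * f z) • res A z x)) →
      ‖T‖ ≤ C * B := by
  have hν := hνσ.trans hσ
  obtain ⟨K, hK0, hK⟩ := regularized_integral hA h0 hν hνσ (n := 2) (by norm_num)
  have hdense : DenseRange (regOp A 2) := by
    refine denseRange_regOp (by norm_num) (hA _ ?_).1 (hA _ ?_).1 hd hd'
    · exact neg_ofReal_mem_outside hν (by norm_num)
    · exact neg_ofReal_mem_outside hν (by norm_num)
  have hmem : ∀ f : hInfty σ, ∃ T : X →L[ℂ] X, ∀ x, T (regOp A 2 x) =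
      contourIntegral ν (fun z => (regFun 2 z * extendZero f.1 z) • res A z x) := fun f =>
    hH _ ⟨f.2, ‖f.1‖, fun z _ => norm_extendZero_le _ _⟩
  choose T hT using hmem
  have hint : ∀ (f : hInfty σ) (x : X),
      ContourIntegrable ν (fun z => (regFun 2 z * extendZero f.1 z) • res A z x) := fun f x =>
    (hK _ f.2 ‖f.1‖ (norm_nonneg _) (fun z _ => norm_extendZero_le _ _) x).1
  have hcon : ∀ z ∈ contour ν, z ∈ sector σ := contour_subset_sector hνσ
  have : CompleteSpace (hInfty σ) := (isClosed_hInfty hσ).completeSpace_coe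
  obtain ⟨C, hC0, hC⟩ := exists_bound_of_denseRange hdense T
    (fun f x => contourIntegral ν (fun z => (regFun 2 z * extendZero f.1 z) • res A z x)) hT
    (fun f g x => by
      rw [← contourIntegral_add (hint f x) (hint g x)]
      refine contourIntegral_congr h0.le hν fun z hz => ?_
      rw [extendZero_of_mem _ (hcon z hz), extendZero_of_mem _ (hcon z hz),
        extendZero_of_mem _ (hcon z hz), ← add_smul, ← mul_add]
      rfl)
    (fun c f x => by
      have := contourIntegral_clm (c • (1 : X →L[ℂ] X)) (hint f x)
      simp only [smul_apply, one_apply_eq_self] at this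
      rw [← this]
      refine contourIntegral_congr h0.le hν fun z hz => ?_
      rw [extendZero_of_mem _ (hcon z hz), extendZero_of_mem _ (hcon z hz), smul_smul]
      congr 1
      have : (c • f).1 ⟨z, hcon z hz⟩ = c * f.1 ⟨z, hcon z hz⟩ := rfl
      rw [this]
      ring)
    (fun f x => (hK _ f.2 ‖f‖ (norm_nonneg _) (fun z _ => norm_extendZero_le _ _) x).2)
  refine ⟨C, hC0, fun f hf B hB0 hB S hS => ?_⟩
  obtain ⟨g, hgB, hg⟩ := exists_boundedContinuousFunction hf hB0 hB
  have hg' : g ∈ hInfty σ := hf.congr hg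
  have e : S = T ⟨g, hg'⟩ := by
    refine clm_ext_denseRange hdense fun x => ?_
    rw [hS, hT]
    refine contourIntegral_congr h0.le hν fun z hz => ?_
    rw [hg z (hcon z hz)]
  rw [e]
  refine (hC _).trans (mul_le_mul_of_nonneg_left ?_ hC0)
  exact hgB

end

end SectorialSum

namespace SectorialSum

open MeasureTheory Set Filter Topology

noncomputable section

variable {X : Type*} [NormedAddCommGroup X] [NormedSpace ℂ X]

variable {A : X →ₗ.[ℂ] X} {ν σ M : ℝ}

/-! ### Unconditional sums of pieces of `A` -/

/-- Moving the centre by at most 1 costs a factor e, so each term is at most e times the integral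
over [k, k + 1]. The bound depends neither on N nor on u. -/
theorem sum_exp_neg_abs_le (N : ℕ) (u : ℝ) :
    ∑ k : Fin N, Real.exp (-|u - (k : ℕ)|) ≤ Real.exp 1 * expMass := by
  have hi : Integrable (fun x : ℝ => Real.exp (-|u - x|)) :=
    integrable_exp_neg_abs.comp_sub_left u
  have h1 : ∀ k : ℕ, Real.exp (-|u - k|) ≤
      Real.exp 1 * ∫ x in (k : ℝ)..((k + 1 : ℕ) : ℝ), Real.exp (-|u - x|) := by
    intro k
    rw [← intervalIntegral.integral_const_mul]
    have : Real.exp (-|u - k|) = ∫ x in (k : ℝ)..((k + 1 : ℕ) : ℝ), Real.exp (-|u - k|) := by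
      simp
    rw [this]
    refine intervalIntegral.integral_mono_on (by simp) (by simp)
      (hi.const_mul _).intervalIntegrable fun x hx => ?_
    rw [← Real.exp_add]
    refine Real.exp_le_exp.2 ?_
    have h2 : |u - x| ≤ |u - k| + |(k : ℝ) - x| := abs_sub_le _ _ _
    have h3 : |(k : ℝ) - x| ≤ 1 := by
      rw [abs_le]
      have := hx.2
      push_cast at this
      constructor <;> linarith [hx.1]
    linarith
  rw [Fin.sum_univ_eq_sum_range (fun k : ℕ => Real.exp (-|u - (k : ℝ)|))]
  refine (Finset.sum_le_sum fun k _ => h1 k).trans ?_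
  rw [← Finset.mul_sum, intervalIntegral.sum_integral_adjacent_intervals
    (a := fun k : ℕ => (k : ℝ)) (fun k _ => hi.intervalIntegrable)]
  gcongr
  rw [intervalIntegral.integral_of_le (by simp)]
  refine (setIntegral_le_integral hi (ae_of_all _ fun x => (Real.exp_pos _).le)).trans ?_
  rw [expMass, integral_sub_left_eq_self (fun x : ℝ => Real.exp (-|x|)) volume u]

theorem exp_neg_abs_log_sub {x s : ℝ} (hx : 0 < x) :
    Real.exp (-|Real.log x - s|) = min (x / Real.exp s) (x / Real.exp s)⁻¹ := by
  rw [← min_exp, Real.exp_sub, Real.exp_log hx]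

/-- In the variable log ‖z‖ the bump is concentrated exponentially at s, so its integer translates
sum to a bounded function. -/
theorem norm_bump_le (h0 : 0 ≤ σ) (hσ : σ < Real.pi) :
    ∃ c : ℝ, 0 ≤ c ∧ ∀ (s : ℝ) (z : ℂ), z ∈ closedSector σ →
      ‖bump (Real.exp s) z‖ ≤ c * Real.exp (-|Real.log ‖z‖ - s|) := by
  obtain ⟨c, hc, h⟩ := sector_sep h0 hσ le_rfl
  refine ⟨(c ^ 2)⁻¹, by positivity, fun s z hz => ?_⟩
  have hz0 : 0 < ‖z‖ := norm_pos_iff.2 hz.1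
  have hs : 0 < Real.exp s := Real.exp_pos s
  have hadd := h z (-(Real.exp s : ℂ)) hz.2 (by rw [arg_neg_ofReal hs]; exact le_abs_self _)
  rw [sub_neg_eq_add, add_comm z, norm_neg, Complex.norm_real, Real.norm_of_nonneg hs.le] at hadd
  rw [exp_neg_abs_log_sub hz0]
  have e : ‖bump (Real.exp s) z‖ = Real.exp s * ‖z‖ / ‖(Real.exp s : ℂ) + z‖ ^ 2 := by
    rw [bump, norm_div, norm_mul, norm_pow, Complex.norm_real, Real.norm_of_nonneg hs.le]
  rw [e]
  calc _ ≤ Real.exp s * ‖z‖ / (c * (‖z‖ + Real.exp s)) ^ 2 := by gcongr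
    _ = (c ^ 2)⁻¹ * ((‖z‖ / Real.exp s) / (1 + ‖z‖ / Real.exp s) ^ 2) := by
      field_simp
      ring
    _ ≤ _ := by gcongr; exact div_sq_le_min (by positivity)

theorem differentiableOn_bump (h0 : 0 ≤ σ) (hσ : σ < Real.pi) {s : ℝ} (hs : 0 < s) :
    DifferentiableOn ℂ (bump s) (closedSector σ) := by
  intro z hz
  refine DifferentiableAt.differentiableWithinAt ?_
  unfold bump
  exact DifferentiableAt.div (by fun_prop) (by fun_prop)
    (pow_ne_zero 2 (add_ne_zero_of_mem_closedSector h0 hσ hs hz))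

theorem sector_subset_closedSector (σ : ℝ) : sector σ ⊆ closedSector σ :=
  fun _ hz => ⟨hz.1, hz.2.le⟩

theorem IsCalculus.bump_mul [CompleteSpace X] (hA : ResolventBoundOn A (outside ν) M) (h0 : 0 < ν)
    (hν : ν < Real.pi) {s : ℝ} (hs : 0 < s) {g : ℂ → ℂ} {G : X →L[ℂ] X} (h : IsCalculus A ν g G) :
    IsCalculus A ν (fun z => bump s z * g z) (bumpOp A s * G) := by
  have harg : ν < |(-(s : ℂ)).arg| := by
    rw [arg_neg_ofReal hs, abs_of_pos Real.pi_pos]; exact hν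
  have h1 := h.mul_inv_sub hA h0 hν harg
  have h2 := h1.mul_inv_sub hA h0 hν harg
  -- Partial fractions: sz/(s + z)² = s/(s + z) - s²/(s + z)².
  refine ((h1.const_mul (-(s : ℂ))).add hA h0 hν (h2.const_mul (-(s : ℂ) ^ 2))).congr h0.le hν
    (fun z hz => ?_) ?_
  · have n2 := add_ne_zero_of_mem_closedSector h0.le hν hs hz
    have e3 : (-(s : ℂ) - z)⁻¹ = -((s : ℂ) + z)⁻¹ := by rw [← inv_neg]; ring_nf
    rw [e3, bump]
    field_simp
    ring
  · have e : res A (-(s : ℂ)) = -shiftInv A s := by rw [shiftInv, neg_neg]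
    rw [e, bumpOp]
    simp only [sub_mul, mul_smul_comm, smul_mul_assoc, neg_mul, mul_neg, mul_assoc, smul_smul]
    module

theorem isCalculus_bump_reg [CompleteSpace X] (hA : ResolventBoundOn A (outside ν) M) (h0 : 0 < ν)
    (hν : ν < Real.pi) {s : ℝ} (hs : 0 < s) :
    IsCalculus A ν (fun z => bump s z * regFun 2 z) (bumpOp A s * regOp A 2) :=
  (isCalculus_reg hA h0 hν (n := 2) (by norm_num)).bump_mul hA h0 hν hs

/-- Uniform boundedness of all finite signed sums of the pieces `ψ(e^{-k-t} A)`, where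
`ψ` is one of the two functions needed for the sum theorem. -/
structure UnconditionalBound (A : X →ₗ.[ℂ] X) (ν K : ℝ) : Prop where
  nonneg : 0 ≤ K
  bump : ∀ (N : ℕ) (η : Fin N → ℤˣ) (t : ℝ),
    ‖∑ k : Fin N, ((η k : ℤ) : ℂ) • bumpOp A (Real.exp ((k : ℕ) + t))‖ ≤ K
  res_bump : ∀ (N : ℕ) (η : Fin N → ℤˣ) (t r θ : ℝ), |θ| = ν →
    ‖∑ k : Fin N, ((η k : ℤ) : ℂ) • (polar θ (r + ((k : ℕ) + t)) •
      (res A (polar θ (r + ((k : ℕ) + t))) * bumpOp A (Real.exp ((k : ℕ) + t))))‖ ≤ K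

theorem norm_intUnit (u : ℤˣ) : ‖((u : ℤ) : ℂ)‖ = 1 := by
  rcases Int.units_eq_one_or u with h | h <;> simp [h]

/-- This is where the H^∞ calculus enters: the signed sums of the pieces are bounded functions on
Σ_σ, uniformly in N, the signs and t, so their operators are uniformly bounded. The three angles
have separate roles: ν₀ carries the Cauchy integrals, σ is the angle of the calculus, and ν > σ
carries the points p for which p/(p - z) must stay bounded on Σ_σ. -/
theorem exists_unconditionalBound [CompleteSpace X] {ν₀ : ℝ}
    (hA : ResolventBoundOn A (outside ν₀) M)
    (h0 : 0 < ν₀) (hνσ : ν₀ < σ) (hσν : σ < ν) (hν : ν < Real.pi)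
    (hd : Dense (A.domain : Set X)) (hd' : DenseRange A)
    (hH : ∀ f : ℂ → ℂ, MemHInfty σ f → ∃ T : X →L[ℂ] X, ∀ x,
      T (regOp A 2 x) = contourIntegral ν₀ (fun z => (regFun 2 z * f z) • res A z x)) :
    ∃ K : ℝ, UnconditionalBound A ν K := by
  have hσ := hσν.trans hν
  have hσ0 := (h0.trans hνσ)
  have hν₀ := hνσ.trans hσ
  obtain ⟨C, hC0, hC⟩ := hInfty_bound hA h0 hσ hνσ hd hd' hH
  have key : ∀ (D : ℝ) (N : ℕ) (η : Fin N → ℤˣ) (t : ℝ) (g : Fin N → ℂ → ℂ)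
      (G : Fin N → X →L[ℂ] X),
      0 ≤ D → (∀ k, DifferentiableOn ℂ (g k) (sector σ)) →
      (∀ k, ∀ z ∈ sector σ, ‖g k z‖ ≤ D * Real.exp (-|Real.log ‖z‖ - ((k : ℕ) + t)|)) →
      (∀ k, IsCalculus A ν₀ (fun z => g k z * regFun 2 z) (G k * regOp A 2)) →
      ‖∑ k : Fin N, ((η k : ℤ) : ℂ) • G k‖ ≤ C * (D * (Real.exp 1 * expMass)) := by
    intro D N η t g G hD0 hg hgb hG
    refine hC (fun z => ∑ k, ((η k : ℤ) : ℂ) * g k z)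
      (DifferentiableOn.fun_sum fun k _ => (differentiableOn_const _).mul (hg k)) _
      (mul_nonneg hD0 (mul_nonneg (Real.exp_pos _).le expMass_nonneg)) (fun z hz => ?_) _
      (fun x => ?_)
    · refine (norm_sum_le _ _).trans ?_
      refine le_trans ?_ (mul_le_mul_of_nonneg_left (sum_exp_neg_abs_le N (Real.log ‖z‖ - t)) hD0)
      rw [Finset.mul_sum]
      refine Finset.sum_le_sum fun k _ => ?_
      rw [norm_mul, norm_intUnit, one_mul]
      refine (hgb k z hz).trans (le_of_eq ?_)
      ring_nf
    -- The operator sum is recognized as the value of the scalar sum after multiplication by `regOp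
    -- A 2`.
    · have hs := IsCalculus.sum hA h0 hν₀ Finset.univ
        (fun k _ => (hG k).const_mul ((η k : ℤ) : ℂ))
      have e := hs.eq x
      have e1 : (∑ k, ((η k : ℤ) : ℂ) • G k) (regOp A 2 x) =
          (∑ k, ((η k : ℤ) : ℂ) • (G k * regOp A 2)) x := by
        simp only [sum_apply, smul_apply, mul_apply_eq_comp]
      rw [e1, ← e]
      refine contourIntegral_congr h0.le hν₀ fun z _ => ?_
      congr 1
      rw [Finset.mul_sum]
      exact Finset.sum_congr rfl fun k _ => by ring
  obtain ⟨c, hc0, hc⟩ := norm_bump_le hσ0.le hσ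
  obtain ⟨d, hd0, hds⟩ := sector_sep hσ0.le hσν hν.le
  have hsub := sector_subset_closedSector σ
  refine ⟨max (C * (c * (Real.exp 1 * expMass))) (C * (d⁻¹ * c * (Real.exp 1 * expMass))),
    le_max_of_le_left ?_, fun N η t => (key c N η t
      (fun k => bump (Real.exp ((k : ℕ) + t))) _ hc0 (fun k => ?_) (fun k z hz => ?_)
      (fun k => ?_)).trans (le_max_left _ _), fun N η t r θ hθ => ?_⟩
  · exact mul_nonneg hC0 (mul_nonneg hc0 (mul_nonneg (Real.exp_pos _).le expMass_nonneg))
  · exact (differentiableOn_bump hσ0.le hσ (Real.exp_pos _)).mono hsub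
  · exact hc _ z (hsub hz)
  · exact isCalculus_bump_reg hA h0 hν₀ (Real.exp_pos _)
  · have harg : ∀ r : ℝ, |(polar θ r).arg| = ν := fun r => by
      rw [abs_arg_polar (by rw [hθ]; exact hν), hθ]
    have hne : ∀ (r : ℝ) (z : ℂ), z ∈ sector σ → d * (‖z‖ + ‖polar θ r‖) ≤ ‖polar θ r - z‖ := by
      intro r z hz
      rw [norm_sub_rev]
      exact hds z _ hz.2.le (harg r).ge
    have hpos : ∀ (r : ℝ) (z : ℂ), z ∈ sector σ → 0 < ‖polar θ r - z‖ := by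
      intro r z hz
      refine lt_of_lt_of_le ?_ (hne r z hz)
      have := norm_pos_iff.2 hz.1
      positivity
    refine (key (d⁻¹ * c) N η t
      (fun k z => polar θ (r + ((k : ℕ) + t)) * ((polar θ (r + ((k : ℕ) + t)) - z)⁻¹ *
        bump (Real.exp ((k : ℕ) + t)) z)) _ (by positivity) (fun k => ?_) (fun k z hz => ?_)
        (fun k => ?_)).trans (le_max_right _ _)
    · refine (differentiableOn_const _).mul (DifferentiableOn.mul (fun z hz => ?_)
        ((differentiableOn_bump hσ0.le hσ (Real.exp_pos _)).mono hsub))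
      exact (DifferentiableAt.inv (by fun_prop)
        (norm_pos_iff.1 (hpos _ z hz))).differentiableWithinAt
    · rw [norm_mul, norm_mul, ← mul_assoc, mul_assoc d⁻¹]
      refine mul_le_mul ?_ (hc _ z (hsub hz)) (norm_nonneg _) (by positivity)
      rw [norm_inv, ← div_eq_mul_inv, div_le_iff₀ (hpos _ z hz), inv_mul_eq_div, le_div_iff₀ hd0]
      nlinarith [hne (r + ((k : ℕ) + t)) z hz, norm_nonneg z]
    · have h1 := (isCalculus_bump_reg hA h0 hν₀ (Real.exp_pos ((k : ℕ) + t))).mul_inv_sub hA h0 hν₀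
        (a := polar θ (r + ((k : ℕ) + t))) (by rw [harg]; linarith)
      refine (h1.const_mul (polar θ (r + ((k : ℕ) + t)))).congr h0.le hν₀ (fun z _ => by ring) ?_
      rw [smul_mul_assoc, mul_assoc]

end

end SectorialSum

namespace SectorialSum

open MeasureTheory Set Filter Topology

noncomputable section

variable {X : Type*} [NormedAddCommGroup X] [NormedSpace ℂ X]

/-! ### Rademacher sums -/

section Rad

variable {ι κ : Type*} [Fintype ι]

/-- The complex number `±1` given by a sign. -/
abbrev sgn (u : ℤˣ) : ℂ := ((u : ℤ) : ℂ)

theorem sgn_mul (u v : ℤˣ) : sgn (u * v) = sgn u * sgn v := by simp [sgn]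

theorem sgn_mul_self (u : ℤˣ) : sgn u * sgn u = 1 := by
  rw [← sgn_mul, Int.units_mul_self]; simp [sgn]

/-- The Rademacher sums as a bounded linear map into the `ℓ²`-sum. -/
def radMap : (ι → X) →L[ℂ] PiLp 2 (fun _ : ι → ℤˣ => X) :=
  (PiLp.continuousLinearEquiv 2 ℂ (fun _ : ι → ℤˣ => X)).symm.toContinuousLinearMap ∘L
    ContinuousLinearMap.pi fun ε => ∑ k, sgn (ε k) • ContinuousLinearMap.proj k

theorem radMap_apply (x : ι → X) (ε : ι → ℤˣ) : radMap x ε = ∑ k, sgn (ε k) • x k := by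
  simp [radMap]

variable [DecidableEq ι] [Fintype κ] [DecidableEq κ]

/-- The unnormalized second moment of a Rademacher sum. -/
def radSq (x : ι → X) : ℝ := ∑ ε : ι → ℤˣ, ‖∑ k, sgn (ε k) • x k‖ ^ 2

theorem norm_radMap_sq (x : ι → X) : ‖radMap x‖ ^ 2 = radSq x := by
  rw [PiLp.norm_sq_eq_of_L2]
  simp only [radMap_apply, radSq]

/-- The unnormalized second moment of a double Rademacher sum. -/
def radSq₂ (x : ι → κ → X) : ℝ :=
  ∑ ε : ι → ℤˣ, ∑ η : κ → ℤˣ, ‖∑ j, ∑ k, (sgn (ε j) * sgn (η k)) • x j k‖ ^ 2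

theorem radSq_nonneg (x : ι → X) : 0 ≤ radSq x := Finset.sum_nonneg fun _ _ => sq_nonneg _

theorem radSq₂_nonneg (x : ι → κ → X) : 0 ≤ radSq₂ x :=
  Finset.sum_nonneg fun _ _ => Finset.sum_nonneg fun _ _ => sq_nonneg _

/-- Minkowski's inequality: Rademacher sums are a bounded linear map into an ℓ² space, hence commute
with integrals. -/
theorem radMap_integral_le {μ : Measure ℝ} [CompleteSpace X] {f : ι → ℝ → X} {g : ℝ → ℝ}
    (hf : ∀ j, Integrable (f j) μ) (hg : Integrable g μ)
    (h : ∀ t, ‖radMap (fun j => f j t)‖ ≤ g t) :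
    ‖radMap (fun j => ∫ t, f j t ∂μ)‖ ≤ ∫ t, g t ∂μ := by
  have hi : Integrable (fun t => fun j => f j t) μ := Integrable.of_eval hf
  have e : (fun j => ∫ t, f j t ∂μ) = ∫ t, (fun j => f j t) ∂μ := by
    ext j
    exact (eval_integral hf j).symm
  rw [e, ← radMap.integral_comp_comm hi]
  exact norm_integral_le_of_norm_le hg (ae_of_all _ h)

theorem sum_sgn_mul_sgn (k l : κ) :
    ∑ η : κ → ℤˣ, sgn (η k) * sgn (η l) = if k = l then (2 : ℂ) ^ Fintype.card κ else 0 := by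
  split_ifs with h
  · subst h
    simp [sgn_mul_self]
  -- Flipping the sign at k alone changes the sign of every term.
  · have e : ∑ η : κ → ℤˣ, sgn (η k) * sgn (η l) = ∑ η : κ → ℤˣ, -(sgn (η k) * sgn (η l)) := by
      refine Fintype.sum_equiv (Equiv.mulLeft (Function.update (1 : κ → ℤˣ) k (-1))) _ _ fun η => ?_
      simp [sgn, Function.update_of_ne (Ne.symm h)]
    rw [Finset.sum_neg_distrib] at e
    exact self_eq_neg.1 e

/-- Orthogonality of signs writes a diagonal sum as an average of products of two full sums with the
same signs. The first factor can then be estimated by an unconditional bound. -/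
theorem sum_sgn_clm (Ψ : κ → X →L[ℂ] X) (z : κ → X) :
    ∑ η : κ → ℤˣ, (∑ l, sgn (η l) • Ψ l) (∑ k, sgn (η k) • z k) =
      (2 : ℂ) ^ Fintype.card κ • ∑ k, Ψ k (z k) := by
  have h : ∀ η : κ → ℤˣ, (∑ l, sgn (η l) • Ψ l) (∑ k, sgn (η k) • z k) =
      ∑ l, ∑ k, (sgn (η l) * sgn (η k)) • Ψ l (z k) := by
    intro η
    simp only [sum_apply, smul_apply, map_sum, map_smul, Finset.smul_sum, smul_smul]
    rw [Finset.sum_comm]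
    simp only [mul_comm]
  simp only [h]
  rw [Finset.sum_comm, Finset.smul_sum]
  refine Finset.sum_congr rfl fun l _ => ?_
  rw [Finset.sum_comm]
  simp only [← Finset.sum_smul, sum_sgn_mul_sgn, ite_smul, zero_smul]
  simp

/-- The family `T` of operators is R-bounded for double Rademacher sums. -/
def RBound₂ (T : ι → κ → X →L[ℂ] X) (R : ℝ) : Prop :=
  ∀ x : ι → κ → X, radSq₂ (fun j k => T j k (x j k)) ≤ R ^ 2 * radSq₂ x

theorem card_signs : ((Fintype.card (κ → ℤˣ) : ℕ) : ℝ) = 2 ^ Fintype.card κ := by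
  simp

/-- The central estimate. The diagonal sum is the average over η of ∑ η_l Ψ_l applied to ∑ η_k T_jk
Χ_k y_j. The first factor costs K, and Cauchy–Schwarz in η passes to second moments. R-boundedness
for double sums then removes the T_jk, and the sum ∑ η_k Χ_k that is left costs the second K. -/
theorem radMap_sum_le {Ψ Χ : κ → X →L[ℂ] X} {T : ι → κ → X →L[ℂ] X} {K R : ℝ} (_hK : 0 ≤ K)
    (hR : 0 ≤ R) (hΨ : ∀ η : κ → ℤˣ, ‖∑ k, sgn (η k) • Ψ k‖ ≤ K)
    (hΧ : ∀ η : κ → ℤˣ, ‖∑ k, sgn (η k) • Χ k‖ ≤ K) (hT : RBound₂ T R) (y : ι → X) :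
    ‖radMap (fun j => ∑ k, Ψ k (T j k (Χ k (y j))))‖ ≤ K ^ 2 * R * ‖radMap y‖ := by
  refine abs_le_of_sq_le_sq' ?_ (by positivity) |>.2
  rw [mul_pow, norm_radMap_sq, norm_radMap_sq]
  have h2 : (0 : ℝ) < 2 ^ Fintype.card κ := by positivity
  have step1 : ∀ ε : ι → ℤˣ,
      (2 : ℝ) ^ Fintype.card κ * ‖∑ j, sgn (ε j) • ∑ k, Ψ k (T j k (Χ k (y j)))‖ ^ 2 ≤
      K ^ 2 * ∑ η : κ → ℤˣ, ‖∑ j, ∑ k, (sgn (ε j) * sgn (η k)) • T j k (Χ k (y j))‖ ^ 2 := by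
    intro ε
    set v := ∑ j, sgn (ε j) • ∑ k, Ψ k (T j k (Χ k (y j))) with hv
    have e1 : v = ∑ k, Ψ k (∑ j, sgn (ε j) • T j k (Χ k (y j))) := by
      simp only [hv, map_sum, map_smul, Finset.smul_sum]
      exact Finset.sum_comm
    have e2 := sum_sgn_clm Ψ (fun k => ∑ j, sgn (ε j) • T j k (Χ k (y j)))
    rw [← e1] at e2
    have e3 : ∀ η : κ → ℤˣ, ∑ k, sgn (η k) • ∑ j, sgn (ε j) • T j k (Χ k (y j)) =
        ∑ j, ∑ k, (sgn (ε j) * sgn (η k)) • T j k (Χ k (y j)) := by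
      intro η
      simp only [Finset.smul_sum, smul_smul]
      rw [Finset.sum_comm]
      simp only [mul_comm]
    simp only [e3] at e2
    have n1 : (2 : ℝ) ^ Fintype.card κ * ‖v‖ ≤
        K * ∑ η : κ → ℤˣ, ‖∑ j, ∑ k, (sgn (ε j) * sgn (η k)) • T j k (Χ k (y j))‖ := by
      have : ‖(2 : ℂ) ^ Fintype.card κ • v‖ = (2 : ℝ) ^ Fintype.card κ * ‖v‖ := by
        rw [norm_smul, norm_pow, Complex.norm_ofNat]
      rw [← this, ← e2, Finset.mul_sum]
      refine (norm_sum_le _ _).trans (Finset.sum_le_sum fun η _ => ?_)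
      exact (ContinuousLinearMap.le_opNorm _ _).trans (by gcongr; exact hΨ η)
    have n2 := sq_sum_le_card_mul_sum_sq (s := (Finset.univ : Finset (κ → ℤˣ)))
      (f := fun η => ‖∑ j, ∑ k, (sgn (ε j) * sgn (η k)) • T j k (Χ k (y j))‖)
    rw [Finset.card_univ, card_signs] at n2
    have n3 := pow_le_pow_left₀ (by positivity) n1 2
    rw [mul_pow, mul_pow] at n3
    have n4 := n3.trans (mul_le_mul_of_nonneg_left n2 (sq_nonneg K))
    refine le_of_mul_le_mul_left ?_ h2
    calc _ = (2 ^ Fintype.card κ) ^ 2 * ‖v‖ ^ 2 := by ring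
      _ ≤ _ := n4
      _ = _ := by ring
  have step2 : (2 : ℝ) ^ Fintype.card κ * radSq (fun j => ∑ k, Ψ k (T j k (Χ k (y j)))) ≤
      K ^ 2 * radSq₂ (fun j k => T j k (Χ k (y j))) := by
    rw [radSq, radSq₂, Finset.mul_sum, Finset.mul_sum]
    exact Finset.sum_le_sum fun ε _ => step1 ε
  have step3 : radSq₂ (fun (j : ι) (k : κ) => Χ k (y j)) ≤
      2 ^ Fintype.card κ * (K ^ 2 * radSq y) := by
    rw [radSq₂, radSq, ← mul_assoc, Finset.mul_sum]
    refine Finset.sum_le_sum fun ε _ => ?_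
    rw [← card_signs, ← Finset.card_univ, mul_assoc, ← nsmul_eq_mul]
    refine Finset.sum_le_card_nsmul _ _ _ fun η _ => ?_
    have e : ∑ j, ∑ k, (sgn (ε j) * sgn (η k)) • Χ k (y j) =
        (∑ k, sgn (η k) • Χ k) (∑ j, sgn (ε j) • y j) := by
      simp only [sum_apply, smul_apply, map_sum, map_smul, Finset.smul_sum, smul_smul]
    rw [e, ← mul_pow]
    gcongr
    exact (ContinuousLinearMap.le_opNorm _ _).trans (by gcongr; exact hΧ η)
  refine le_of_mul_le_mul_left ?_ h2
  calc _ ≤ K ^ 2 * (R ^ 2 * (2 ^ Fintype.card κ * (K ^ 2 * radSq y))) := by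
        refine step2.trans (mul_le_mul_of_nonneg_left ((hT _).trans ?_) (sq_nonneg K))
        exact mul_le_mul_of_nonneg_left step3 (sq_nonneg R)
    _ = _ := by ring

/-! ### R-boundedness and property (α) for general finite index sets -/

theorem radSq_equiv (e : ι ≃ κ) (x : κ → X) : radSq (fun i => x (e i)) = radSq x := by
  rw [radSq, radSq]
  refine Fintype.sum_equiv (Equiv.arrowCongr e (Equiv.refl _)) _ _ fun ε => ?_
  congr 2
  refine Fintype.sum_equiv e _ _ fun i => ?_
  simp

theorem radNorm_eq {n : ℕ} (x : Fin n → X) : radNorm x = √(radSq x / 2 ^ n) := rfl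

theorem radNorm₂_eq {n : ℕ} (x : Fin n → Fin n → X) :
    radNorm₂ x = √(radSq₂ x / (2 ^ n * 2 ^ n)) := rfl

theorem le_of_sqrt_div_le {a b C D : ℝ} (hD : 0 < D) (ha : 0 ≤ a) (hb : 0 ≤ b)
    (h : √(a / D) ≤ C * √(b / D)) : a ≤ C ^ 2 * b := by
  have := pow_le_pow_left₀ (Real.sqrt_nonneg _) h 2
  rw [mul_pow, Real.sq_sqrt (by positivity), Real.sq_sqrt (by positivity), mul_div_assoc',
    div_le_div_iff_of_pos_right hD] at this
  exact this

theorem RBounded.exists_radSq_le {F : Set (X →L[ℂ] X)} (hF : RBounded F) :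
    ∃ C : ℝ, 0 ≤ C ∧ ∀ (ι : Type) [Fintype ι] [DecidableEq ι] (T : ι → X →L[ℂ] X) (x : ι → X),
      (∀ k, T k ∈ F) → radSq (fun k => T k (x k)) ≤ C ^ 2 * radSq x := by
  obtain ⟨C, hC⟩ := hF
  refine ⟨|C|, abs_nonneg _, fun ι _ _ T x hT => ?_⟩
  have e := Fintype.equivFin ι
  have := hC _ (fun k => T (e.symm k)) (fun k => x (e.symm k)) fun k => hT _
  rw [radNorm_eq, radNorm_eq] at this
  have := le_of_sqrt_div_le (by positivity) (radSq_nonneg _) (radSq_nonneg _) this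
  rw [radSq_equiv e.symm x, radSq_equiv e.symm (fun k => T k (x k))] at this
  rwa [sq_abs]

/-- Extension of a rectangular array by zeros to a square array. -/
def pad {Y : Type*} [Zero Y] {m n : ℕ} (x : Fin m → Fin n → Y) : Fin (m + n) → Fin (m + n) → Y :=
  Fin.append (fun j => Fin.append (fun _ => 0) (x j)) fun _ _ => 0

/-- Property (α) for rectangular arrays. -/
theorem PropertyAlpha.exists_radSq₂_le (h : PropertyAlpha X) :
    ∃ C : ℝ, 0 ≤ C ∧ ∀ (m n : ℕ) (x : Fin m → Fin n → X) (a : Fin m → Fin n → ℂ) (B : ℝ),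
      0 ≤ B → (∀ j k, ‖a j k‖ ≤ B) →
      radSq₂ (fun j k => a j k • x j k) ≤ (C * B) ^ 2 * radSq₂ x := by
  obtain ⟨C, hC⟩ := h
  refine ⟨|C|, abs_nonneg _, fun m n x a B hB0 hB => ?_⟩
  -- The array occupies the first m rows and the last n columns; the n remaining row signs and m
  -- remaining column signs are idle and give the factor.
  have hpad : ∀ x : Fin m → Fin n → X, radSq₂ (pad x) = 2 ^ m * 2 ^ n * radSq₂ x := by
    intro x
    rw [radSq₂, ← (Fin.appendEquiv m n).sum_comp]
    have h1 : ∀ p : (Fin m → ℤˣ) × (Fin n → ℤˣ), ∑ η : Fin (m + n) → ℤˣ,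
        ‖∑ j, ∑ k, (sgn (Fin.appendEquiv m n p j) * sgn (η k)) • pad x j k‖ ^ 2 =
        2 ^ m * ∑ η : Fin n → ℤˣ, ‖∑ j, ∑ k, (sgn (p.1 j) * sgn (η k)) • x j k‖ ^ 2 := by
      intro p
      rw [← (Fin.appendEquiv m n).sum_comp, Fintype.sum_prod_type]
      simp [pad, Fin.sum_univ_add, Fin.appendEquiv]
    simp only [h1]
    rw [Fintype.sum_prod_type]
    simp only [Finset.sum_const, Finset.card_univ, ← Finset.mul_sum, nsmul_eq_mul, card_signs,
      Fintype.card_fin, radSq₂]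
    ring
  have := hC (m + n) (pad x) (pad a) B fun j k => by
    refine Fin.addCases (fun j => ?_) (fun j => ?_) j
    · refine Fin.addCases (fun k => ?_) (fun k => ?_) k
      · simpa [pad] using hB0
      · simpa [pad] using hB j k
    · simpa [pad] using hB0
  have e : (fun j k => pad a j k • pad x j k) = pad (fun j k => a j k • x j k) := by
    ext j k
    refine Fin.addCases (fun j => ?_) (fun j => ?_) j
    · refine Fin.addCases (fun k => ?_) (fun k => ?_) k <;> simp [pad]
    · simp [pad]
  rw [e, radNorm₂_eq, radNorm₂_eq] at this
  have := le_of_sqrt_div_le (by positivity) (radSq₂_nonneg _) (radSq₂_nonneg _) this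
  rw [hpad, hpad] at this
  rw [mul_pow, sq_abs, ← mul_pow]
  have h2 : (0 : ℝ) < 2 ^ m * 2 ^ n := by positivity
  refine le_of_mul_le_mul_left ?_ h2
  linarith

/-- For fixed ε and η, the substitution δ_jk ↦ ε_j η_k δ_jk absorbs the product signs: averaging
over δ replaces them by independent signs on pairs of indices. -/
theorem sum_radSq₂_sgn (x : ι → κ → X) :
    ∑ δ : ι × κ → ℤˣ, radSq₂ (fun j k => sgn (δ (j, k)) • x j k) =
      2 ^ Fintype.card ι * 2 ^ Fintype.card κ * radSq (fun p : ι × κ => x p.1 p.2) := by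
  simp only [radSq₂]
  rw [Finset.sum_comm]
  have h : ∀ ε : ι → ℤˣ, ∑ δ : ι × κ → ℤˣ, ∑ η : κ → ℤˣ,
      ‖∑ j, ∑ k, (sgn (ε j) * sgn (η k)) • sgn (δ (j, k)) • x j k‖ ^ 2 =
      2 ^ Fintype.card κ * radSq (fun p : ι × κ => x p.1 p.2) := by
    intro ε
    rw [Finset.sum_comm]
    have h' : ∀ η : κ → ℤˣ, ∑ δ : ι × κ → ℤˣ,
        ‖∑ j, ∑ k, (sgn (ε j) * sgn (η k)) • sgn (δ (j, k)) • x j k‖ ^ 2 =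
        radSq (fun p : ι × κ => x p.1 p.2) := by
      intro η
      rw [radSq]
      refine Fintype.sum_equiv (Equiv.mulLeft fun p : ι × κ => ε p.1 * η p.2) _ _ fun δ => ?_
      rw [Fintype.sum_prod_type]
      simp only [Equiv.coe_mulLeft, Pi.mul_apply, sgn_mul, smul_smul]
    simp only [h', Finset.sum_const, Finset.card_univ, nsmul_eq_mul, card_signs]
  simp only [h, Finset.sum_const, Finset.card_univ, nsmul_eq_mul, card_signs]
  ring

/-- Property (α) with coefficients ±1, in both directions, makes double sums comparable to
Rademacher sums over pairs of indices, where R-boundedness applies. A last use of (α) inserts the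
scalars. -/
theorem PropertyAlpha.exists_rBound₂ (h : PropertyAlpha X) {F : Set (X →L[ℂ] X)}
    (hF : RBounded F) (c : ℝ) (hc : 0 ≤ c) :
    ∃ R : ℝ, 0 ≤ R ∧ ∀ (m n : ℕ) (T : Fin m → Fin n → X →L[ℂ] X) (a : Fin m → Fin n → ℂ),
      (∀ j k, T j k ∈ F) → (∀ j k, ‖a j k‖ ≤ c) → RBound₂ (fun j k => a j k • T j k) R := by
  obtain ⟨C, hC0, hC⟩ := h.exists_radSq₂_le
  obtain ⟨D, hD0, hD⟩ := hF.exists_radSq_le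
  -- C·c pays for the scalars, the two further factors C for passing to independent signs and back,
  -- and D for R-boundedness.
  refine ⟨C * c * (C * C * D), by positivity, fun m n T a hT ha x => ?_⟩
  have hs : ∀ (δ : Fin m × Fin n → ℤˣ) (x : Fin m → Fin n → X),
      radSq₂ (fun j k => sgn (δ (j, k)) • x j k) ≤ C ^ 2 * radSq₂ x := fun δ x => by
    have := hC m n x (fun j k => sgn (δ (j, k))) 1 zero_le_one fun j k => (norm_intUnit _).le
    rwa [mul_one] at this
  have hs' : ∀ (δ : Fin m × Fin n → ℤˣ) (x : Fin m → Fin n → X),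
      radSq₂ x ≤ C ^ 2 * radSq₂ (fun j k => sgn (δ (j, k)) • x j k) := fun δ x => by
    have := hs δ (fun j k => sgn (δ (j, k)) • x j k)
    simpa only [smul_smul, sgn_mul_self, one_smul] using this
  set P : ℝ := 2 ^ Fintype.card (Fin m × Fin n) with hP
  set Q : ℝ := 2 ^ Fintype.card (Fin m) * 2 ^ Fintype.card (Fin n) with hQ
  have hP0 : 0 < P := by positivity
  have hQ0 : 0 < Q := by positivity
  have up : ∀ x : Fin m → Fin n → X,
      Q * radSq (fun p : Fin m × Fin n => x p.1 p.2) ≤ P * (C ^ 2 * radSq₂ x) := by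
    intro x
    rw [← sum_radSq₂_sgn, hP, ← card_signs, ← Finset.card_univ, ← nsmul_eq_mul]
    exact Finset.sum_le_card_nsmul _ _ _ fun δ _ => hs δ x
  have low : ∀ x : Fin m → Fin n → X,
      P * radSq₂ x ≤ C ^ 2 * (Q * radSq (fun p : Fin m × Fin n => x p.1 p.2)) := by
    intro x
    rw [← sum_radSq₂_sgn, hP, ← card_signs, ← Finset.card_univ, ← nsmul_eq_mul, Finset.mul_sum]
    exact Finset.card_nsmul_le_sum _ _ _ fun δ _ => hs' δ x
  have key : radSq₂ (fun j k => T j k (x j k)) ≤ (C * C * D) ^ 2 * radSq₂ x := by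
    have h1 := low (fun j k => T j k (x j k))
    have h2 := hD (Fin m × Fin n) (fun p => T p.1 p.2) (fun p => x p.1 p.2) fun p => hT _ _
    have h3 := up x
    refine le_of_mul_le_mul_left ?_ hP0
    calc _ ≤ _ := h1
      _ ≤ C ^ 2 * (Q * (D ^ 2 * radSq (fun p : Fin m × Fin n => x p.1 p.2))) := by gcongr
      _ = C ^ 2 * D ^ 2 * (Q * radSq (fun p : Fin m × Fin n => x p.1 p.2)) := by ring
      _ ≤ C ^ 2 * D ^ 2 * (P * (C ^ 2 * radSq₂ x)) := by gcongr
      _ = _ := by ring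
  have h4 := hC m n (fun j k => T j k (x j k)) a c hc ha
  refine h4.trans ?_
  rw [mul_pow (C * c) (C * C * D), mul_assoc]
  gcongr

theorem radSq₂_fin_one (x : Fin 1 → κ → X) : radSq₂ x = 2 * radSq (x 0) := by
  rw [radSq₂]
  have h : ∀ (ε : Fin 1 → ℤˣ), ∑ η : κ → ℤˣ, ‖∑ j, ∑ k, (sgn (ε j) * sgn (η k)) • x j k‖ ^ 2 =
      radSq (x 0) := by
    intro ε
    rw [radSq]
    refine Finset.sum_congr rfl fun η _ => ?_
    rw [Fin.sum_univ_one]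
    simp only [mul_smul, ← Finset.smul_sum]
    rw [norm_smul, norm_intUnit, one_mul]
  simp only [h, Finset.sum_const, Finset.card_univ, nsmul_eq_mul, card_signs]
  simp

theorem norm_radMap_fin_one (x : Fin 1 → X) : ‖radMap x‖ ^ 2 = 2 * ‖x 0‖ ^ 2 := by
  rw [norm_radMap_sq, radSq]
  simp only [Fin.sum_univ_one, norm_smul, norm_intUnit, one_mul]
  simp

/-- With a single row the outer sign has modulus one and drops out. Hence the parts of the theorem
without R-sectoriality of the sum do not need property (α). -/
theorem RBounded.exists_rBound₂_fin_one {F : Set (X →L[ℂ] X)} (hF : RBounded F) :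
    ∃ R : ℝ, 0 ≤ R ∧ ∀ (n : ℕ) (T : Fin 1 → Fin n → X →L[ℂ] X),
      (∀ j k, T j k ∈ F) → RBound₂ T R := by
  obtain ⟨D, hD0, hD⟩ := hF.exists_radSq_le
  refine ⟨D, hD0, fun n T hT x => ?_⟩
  rw [radSq₂_fin_one, radSq₂_fin_one]
  linarith [hD (Fin n) (T 0) (x 0) (hT 0)]

theorem RBounded.exists_norm_le {F : Set (X →L[ℂ] X)} (hF : RBounded F) :
    ∃ R : ℝ, 0 ≤ R ∧ ∀ T ∈ F, ‖T‖ ≤ R := by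
  obtain ⟨D, hD0, hD⟩ := hF.exists_radSq_le
  refine ⟨D, hD0, fun T hT => T.opNorm_le_bound hD0 fun x => ?_⟩
  have := hD (Fin 1) (fun _ => T) (fun _ => x) fun _ => hT
  rw [← norm_radMap_sq, ← norm_radMap_sq, norm_radMap_fin_one, norm_radMap_fin_one] at this
  refine abs_le_of_sq_le_sq' ?_ (by positivity) |>.2
  rw [mul_pow]
  linarith

end Rad

end

end SectorialSum

namespace SectorialSum

open MeasureTheory Set Filter Topology

noncomputable section

variable {X : Type*} [NormedAddCommGroup X] [NormedSpace ℂ X]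

variable {A B : X →ₗ.[ℂ] X} {ν M : ℝ}

/-! ### An approximate reproducing formula -/

/-- The operator `s (s + A)⁻¹` for `s = e^τ`. -/
def expRes (A : X →ₗ.[ℂ] X) (τ : ℝ) : X →L[ℂ] X :=
  ((Real.exp τ : ℝ) : ℂ) • shiftInv A (Real.exp τ)

theorem bumpOp_exp (A : X →ₗ.[ℂ] X) (τ : ℝ) :
    bumpOp A (Real.exp τ) = expRes A τ - expRes A τ * expRes A τ := rfl

/-- As a function of τ, v = e^τ/(e^τ + z) satisfies the logistic equation v' = v(1 - v). -/
theorem hasDerivAt_expRes (hA : ResolventBoundOn A (outside ν) M) (h0 : 0 < ν) (hν : ν < Real.pi)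
    (τ : ℝ) : HasDerivAt (expRes A) (bumpOp A (Real.exp τ)) τ := by
  have hmem : ∀ τ : ℝ, -((Real.exp τ : ℝ) : ℂ) ∈ outside ν := fun τ =>
    neg_ofReal_mem_outside hν (Real.exp_pos τ)
  have h1 := hasDerivWithinAt_res hA (hmem τ) (fun h => zero_notMem_outside h0 (h ▸ hmem τ))
  have h2 : HasDerivAt (fun τ : ℝ => ((Real.exp τ : ℝ) : ℂ)) ((Real.exp τ : ℝ) : ℂ) τ :=
    (Real.hasDerivAt_exp τ).ofReal_comp
  have h3 := h1.scomp_hasDerivAt τ h2.neg hmem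
  have h4 := h2.smul h3.neg
  have e : bumpOp A (Real.exp τ) = ((Real.exp τ : ℝ) : ℂ) • -(-((Real.exp τ : ℝ) : ℂ) •
      -(res A (-((Real.exp τ : ℝ) : ℂ)) * res A (-((Real.exp τ : ℝ) : ℂ)))) +
      ((Real.exp τ : ℝ) : ℂ) • -(res A (-((Real.exp τ : ℝ) : ℂ))) := by
    rw [bumpOp, shiftInv]
    simp only [smul_mul_assoc, mul_smul_comm, neg_mul, mul_neg]
    module
  rw [e]
  exact h4

/-- A polynomial with derivative `30 v² (1 - v)²`. -/
def smoothStep {R : Type*} [Ring R] (v : R) : R :=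
  10 * (v * v * v) - 15 * (v * v * v * v) + 6 * (v * v * v * v * v)

/-- The derivative is 30v²(1 - v)² · v(1 - v). Three bump factors are wanted because one goes into
the contour integral and one on each side of the resolvent of B. -/
theorem hasDerivAt_smoothStep (hA : ResolventBoundOn A (outside ν) M) (h0 : 0 < ν)
    (hν : ν < Real.pi) (τ : ℝ) : HasDerivAt (fun τ => smoothStep (expRes A τ))
      (30 * (bumpOp A (Real.exp τ) * bumpOp A (Real.exp τ) * bumpOp A (Real.exp τ))) τ := by
  have h1 := hasDerivAt_expRes hA h0 hν τ
  have h2 := h1.mul h1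
  have h3 := h2.mul h1
  have h4 := h3.mul h1
  have h5 := h4.mul h1
  have h6 := ((h3.const_mul 10).sub (h4.const_mul 15)).add (h5.const_mul 6)
  refine h6.congr_deriv ?_
  simp only [bumpOp_exp, Pi.mul_apply]
  noncomm_ring

theorem continuous_expRes (hA : ResolventBoundOn A (outside ν) M) (h0 : 0 < ν)
    (hν : ν < Real.pi) : Continuous (expRes A) :=
  continuous_iff_continuousAt.2 fun τ => (hasDerivAt_expRes hA h0 hν τ).continuousAt

theorem continuous_bumpOp_exp (hA : ResolventBoundOn A (outside ν) M) (h0 : 0 < ν)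
    (hν : ν < Real.pi) : Continuous (fun τ => bumpOp A (Real.exp τ)) := by
  have := continuous_expRes hA h0 hν
  simp only [bumpOp_exp]
  fun_prop

/-- The operator `(s A (s + A)⁻²)³` for `s = e^τ`. -/
def bumpCube (A : X →ₗ.[ℂ] X) (τ : ℝ) : X →L[ℂ] X :=
  bumpOp A (Real.exp τ) * bumpOp A (Real.exp τ) * bumpOp A (Real.exp τ)

theorem continuous_bumpCube (hA : ResolventBoundOn A (outside ν) M) (h0 : 0 < ν)
    (hν : ν < Real.pi) : Continuous (bumpCube A) := by
  have := continuous_bumpOp_exp hA h0 hν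
  unfold bumpCube
  fun_prop

theorem natCast_clm_apply (n : ℕ) (x : X) : (n : X →L[ℂ] X) x = n • x := by
  rw [← nsmul_one, smul_apply, one_apply_eq_self]

theorem integral_bumpCube [CompleteSpace X] (hA : ResolventBoundOn A (outside ν) M) (h0 : 0 < ν)
    (hν : ν < Real.pi) (a b : ℝ) (w : X) :
    (30 : ℝ) • ∫ τ in a..b, bumpCube A τ w =
      smoothStep (expRes A b) w - smoothStep (expRes A a) w := by
  have hc := continuous_bumpCube hA h0 hν
  have h := intervalIntegral.integral_eq_sub_of_hasDerivAt
    (fun τ _ => hasDerivAt_smoothStep hA h0 hν τ)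
    ((continuous_const.mul hc).intervalIntegrable a b)
  have h2 := congr_arg (fun T : X →L[ℂ] X => T w) h
  simp only [sub_apply] at h2
  rw [← h2, ← intervalIntegral.integral_smul]
  have e := (ContinuousLinearMap.apply ℂ X w).intervalIntegral_comp_comm
    ((continuous_const.mul hc).intervalIntegrable (μ := volume) a b (u := fun τ => 30 * bumpCube A τ))
  simp only [ContinuousLinearMap.apply_apply] at e
  unfold bumpCube at e ⊢
  rw [← e]
  refine intervalIntegral.integral_congr fun τ _ => ?_
  simp only [mul_apply_eq_comp]
  have c30 := fun z : X => natCast_clm_apply 30 z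
  rw [Nat.cast_ofNat] at c30
  rw [c30, ← Nat.cast_smul_eq_nsmul ℝ, Nat.cast_ofNat]

theorem tendsto_of_dense {S : ℕ → X →L[ℂ] X} {C : ℝ} (hS : ∀ n, ‖S n‖ ≤ C) {D : Set X}
    (hD : Dense D) (h : ∀ x ∈ D, Tendsto (fun n => S n x) atTop (𝓝 0)) (x : X) :
    Tendsto (fun n => S n x) atTop (𝓝 0) := by
  have hC : 0 ≤ C := (norm_nonneg _).trans (hS 0)
  rw [Metric.tendsto_nhds]
  intro ε hε
  obtain ⟨y, hyD, hy⟩ := hD.exists_dist_lt x (show 0 < ε / 2 / (C + 1) by positivity)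
  have h1 := (Metric.tendsto_nhds.1 (h y hyD)) (ε / 2) (by positivity)
  filter_upwards [h1] with n hn
  rw [dist_zero_right] at hn ⊢
  have e : S n x = S n (x - y) + S n y := by rw [map_sub, sub_add_cancel]
  rw [e]
  rw [dist_eq_norm, lt_div_iff₀ (by positivity)] at hy
  have h2 : ‖S n (x - y)‖ ≤ C * ‖x - y‖ :=
    (ContinuousLinearMap.le_opNorm _ _).trans (by gcongr; exact hS n)
  have := norm_add_le (S n (x - y)) (S n y)
  nlinarith [norm_nonneg (x - y)]

theorem tendsto_mul_apply {S T : ℕ → X →L[ℂ] X} {C : ℝ} (hS : ∀ n, ‖S n‖ ≤ C) {x y z : X}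
    (h1 : Tendsto (fun n => S n y) atTop (𝓝 z)) (h2 : Tendsto (fun n => T n x) atTop (𝓝 y)) :
    Tendsto (fun n => (S n * T n) x) atTop (𝓝 z) := by
  have hC : 0 ≤ C := (norm_nonneg _).trans (hS 0)
  have h3 : Tendsto (fun n => S n (T n x - y)) atTop (𝓝 0) := by
    refine squeeze_zero_norm (a := fun n => C * ‖T n x - y‖) (fun n => ?_) ?_
    · exact (ContinuousLinearMap.le_opNorm _ _).trans (by gcongr; exact hS n)
    · simpa using (tendsto_iff_norm_sub_tendsto_zero.1 h2).const_mul C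
  have h4 := h3.add h1
  rw [zero_add] at h4
  refine h4.congr fun n => ?_
  rw [map_sub, sub_add_cancel]
  rfl

/-- Every power of `S n` sends x to y in the limit, since y is asymptotically fixed; the
coefficients 10 - 15 + 6 add up to 1 and there is no constant term. -/
theorem tendsto_smoothStep {S : ℕ → X →L[ℂ] X} {C : ℝ} (hS : ∀ n, ‖S n‖ ≤ C) {x y : X}
    (h : Tendsto (fun n => S n x) atTop (𝓝 y)) (h' : Tendsto (fun n => S n y) atTop (𝓝 y)) :
    Tendsto (fun n => smoothStep (S n) x) atTop (𝓝 y) := by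
  have h2 := tendsto_mul_apply hS h' h
  have h3 := tendsto_mul_apply hS h' h2
  have h4 := tendsto_mul_apply hS h' h3
  have h5 := tendsto_mul_apply hS h' h4
  have h6 := ((h3.const_smul (10 : ℕ)).sub (h4.const_smul (15 : ℕ))).add (h5.const_smul (6 : ℕ))
  have e : (10 : ℕ) • y - (15 : ℕ) • y + (6 : ℕ) • y = y := by module
  rw [e] at h6
  refine h6.congr fun n => ?_
  have c10 := fun z : X => natCast_clm_apply 10 z
  have c15 := fun z : X => natCast_clm_apply 15 z
  have c6 := fun z : X => natCast_clm_apply 6 z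
  rw [Nat.cast_ofNat] at c10 c15 c6
  simp only [smoothStep, sub_apply, add_apply, mul_apply_eq_comp, c10, c15, c6]

theorem norm_expRes_le (hA : ResolventBoundOn A (outside ν) M) (hν : ν < Real.pi) (τ : ℝ) :
    ‖expRes A τ‖ ≤ M := by
  have := (hA _ (neg_ofReal_mem_outside hν (Real.exp_pos τ))).2
  rw [neg_smul, ← smul_neg] at this
  exact this

theorem tendsto_expRes_atTop (hA : ResolventBoundOn A (outside ν) M) (hν : ν < Real.pi)
    (hd : Dense (A.domain : Set X)) (w : X) :
    Tendsto (fun n : ℕ => expRes A n w) atTop (𝓝 w) := by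
  have key := tendsto_of_dense (S := fun n : ℕ => expRes A n - 1) (C := M + 1) (fun n => ?_) hd
    (fun x hx => ?_) w
  · have := key.add_const w
    simpa using this
  · refine (norm_sub_le _ _).trans (add_le_add (norm_expRes_le hA hν _)
      ContinuousLinearMap.norm_id_le)
  · refine squeeze_zero_norm (a := fun n : ℕ => M * ‖A ⟨x, hx⟩‖ * Real.exp (-n)) (fun n => ?_) ?_
    · have hr := (hA _ (neg_ofReal_mem_outside hν (Real.exp_pos n))).1
      -- On the domain, s(s + A)⁻¹x - x = -s⁻¹ · s(s + A)⁻¹Ax with s = e^n.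
      have e : (expRes A n - 1) x = -((Real.exp (-n) : ℝ) : ℂ) • expRes A n (A ⟨x, hx⟩) := by
        rw [expRes, shiftInv, sub_apply, smul_apply, smul_apply, neg_apply, neg_apply, res_map hr,
          one_apply_eq_self, smul_smul, neg_mul, ← Complex.ofReal_mul, ← Real.exp_add,
          neg_add_cancel, Real.exp_zero]
        push_cast
        module
      rw [e, norm_smul, norm_neg, Complex.norm_real, Real.norm_of_nonneg (Real.exp_pos _).le,
        mul_comm]
      gcongr
      exact (ContinuousLinearMap.le_opNorm _ _).trans (by gcongr; exact norm_expRes_le hA hν _)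
    · have h1 : Tendsto (fun n : ℕ => Real.exp (-(n : ℝ))) atTop (𝓝 0) :=
        Real.tendsto_exp_neg_atTop_nhds_zero.comp tendsto_natCast_atTop_atTop
      simpa using h1.const_mul (M * ‖A ⟨x, hx⟩‖)

theorem tendsto_expRes_atBot (hA : ResolventBoundOn A (outside ν) M) (hν : ν < Real.pi)
    (hd : DenseRange A) (w : X) :
    Tendsto (fun n : ℕ => expRes A (-(n : ℝ)) w) atTop (𝓝 0) := by
  refine tendsto_of_dense (S := fun n : ℕ => expRes A (-(n : ℝ)))
    (fun n => norm_expRes_le hA hν _) hd ?_ w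
  rintro _ ⟨x, rfl⟩
  refine squeeze_zero_norm (a := fun n : ℕ => Real.exp (-n) * ((M + 1) * ‖(x : X)‖))
    (fun n => ?_) ?_
  · have hr := (hA _ (neg_ofReal_mem_outside hν (Real.exp_pos (-(n : ℝ))))).1
    -- On the range, s(s + A)⁻¹Ax = s(x - s(s + A)⁻¹x) with s = e^{-n}.
    have e : expRes A (-(n : ℝ)) (A x) =
        ((Real.exp (-n) : ℝ) : ℂ) • ((x : X) - expRes A (-(n : ℝ)) x) := by
      rw [expRes, shiftInv, smul_apply, smul_apply, neg_apply, neg_apply, res_map hr]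
      module
    rw [e, norm_smul, Complex.norm_real, Real.norm_of_nonneg (Real.exp_pos _).le]
    gcongr
    refine (norm_sub_le _ _).trans ?_
    have : ‖expRes A (-(n : ℝ)) x‖ ≤ M * ‖(x : X)‖ :=
      (ContinuousLinearMap.le_opNorm _ _).trans (by gcongr; exact norm_expRes_le hA hν _)
    linarith
  · have h1 : Tendsto (fun n : ℕ => Real.exp (-(n : ℝ))) atTop (𝓝 0) :=
      Real.tendsto_exp_neg_atTop_nhds_zero.comp tendsto_natCast_atTop_atTop
    simpa using h1.mul_const ((M + 1) * ‖(x : X)‖)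

theorem tendsto_integral_bumpCube [CompleteSpace X] (hA : ResolventBoundOn A (outside ν) M)
    (h0 : 0 < ν) (hν : ν < Real.pi) (hd : Dense (A.domain : Set X)) (hd' : DenseRange A) (w : X) :
    Tendsto (fun n : ℕ => (30 : ℝ) • ∫ τ in (-(n : ℝ))..n, bumpCube A τ w) atTop (𝓝 w) := by
  simp only [integral_bumpCube hA h0 hν]
  have t1 := tendsto_expRes_atTop hA hν hd
  have t2 := tendsto_expRes_atBot hA hν hd'
  have h1 := tendsto_smoothStep (fun n => norm_expRes_le hA hν n) (t1 w) (t1 w)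
  have h2 := tendsto_smoothStep (fun n => norm_expRes_le hA hν (-(n : ℝ))) (t2 w) (t2 0)
  simpa using h1.sub h2

end

end SectorialSum

namespace SectorialSum

open MeasureTheory Set Filter Topology

noncomputable section

variable {X : Type*} [NormedAddCommGroup X] [NormedSpace ℂ X]

/-! ### The a priori estimate -/

/-- The standing assumptions on `A` (with contour angle `ν`) and `B` (with resolvent bound on
`S`). -/
structure SumData (A B : X →ₗ.[ℂ] X) (ν M K L : ℝ) (S : Set ℂ) : Prop where
  pos : 0 < ν
  lt_pi : ν < Real.pi
  bound : ResolventBoundOn A (outside ν) M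
  unconditional : UnconditionalBound A ν K
  dense_domain : Dense (A.domain : Set X)
  dense_range : DenseRange A
  comm : ResolventsCommute A B
  bound' : ResolventBoundOn B S L
  zero_notMem : (0 : ℂ) ∉ S

/-- `l - z` stays in `S`, away from `0`, for `z` in the closed sector. -/
def Admissible (S : Set ℂ) (ν c : ℝ) (l : ℂ) : Prop :=
  ∀ z ∈ closedSector ν, l - z ∈ S ∧ ‖z‖ ≤ c * ‖l - z‖

/-- The operator `(z + B - l)⁻¹`. -/
def shiftRes (B : X →ₗ.[ℂ] X) (l z : ℂ) : X →L[ℂ] X := -res B (l - z)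

variable {A B : X →ₗ.[ℂ] X} {ν M K L c : ℝ} {S : Set ℂ}

namespace SumData

variable (h : SumData A B ν M K L S)
include h

theorem resolvent_left {z : ℂ} (hz : z ∈ contour ν) : z ∈ resolventSet A :=
  (h.bound z (contour_subset_outside ν hz)).1

theorem bound_nonneg : 0 ≤ M :=
  (norm_nonneg _).trans (h.bound _ (neg_ofReal_mem_outside h.lt_pi one_pos)).2

theorem differentiableOn_shiftRes {l : ℂ} (hl : Admissible S ν c l) :
    DifferentiableOn ℂ (shiftRes B l) (closedSector ν) := by
  have h1 := differentiableOn_res h.bound' h.zero_notMem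
  have h2 : DifferentiableOn ℂ (fun z : ℂ => l - z) (closedSector ν) := by fun_prop
  exact (h1.comp h2 fun z hz => (hl z hz).1).neg

theorem norm_smul_shiftRes_le {l : ℂ} (hl : Admissible S ν c l) {z : ℂ}
    (hz : z ∈ closedSector ν) : ‖z • shiftRes B l z‖ ≤ c * L := by
  obtain ⟨h1, h2⟩ := hl z hz
  have h3 := (h.bound' _ h1).2
  have hp : 0 < ‖l - z‖ := by
    rw [norm_pos_iff]; intro h0; rw [h0] at h1; exact h.zero_notMem h1
  have hc : 0 ≤ c := by
    by_contra! hc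
    have := norm_nonneg z
    nlinarith
  rw [norm_smul] at h3
  rw [norm_smul, shiftRes, norm_neg]
  calc _ ≤ (c * ‖l - z‖) * ‖res B (l - z)‖ := by gcongr
    _ = c * (‖l - z‖ * ‖res B (l - z)‖) := by ring
    _ ≤ _ := by gcongr

theorem commute_shiftRes {l z w : ℂ} (hz : z ∈ resolventSet A) (hw : l - w ∈ S) :
    Commute (res A z) (shiftRes B l w) :=
  (h.comm z hz _ (h.bound' _ hw).1).neg_right

theorem commute_bumpOp_shiftRes {l w : ℂ} {s : ℝ} (hs : 0 < s) (hw : l - w ∈ S) :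
    Commute (bumpOp A s) (shiftRes B l w) := by
  have h1 : Commute (shiftInv A s) (shiftRes B l w) :=
    (h.commute_shiftRes (h.bound _ (neg_ofReal_mem_outside h.lt_pi hs)).1 hw).neg_left
  have h2 := h1.smul_left (s : ℂ)
  exact h2.sub_left (h2.mul_left h2)

theorem commute_bumpOp_res {z : ℂ} {s : ℝ} (hs : 0 < s) (hz : z ∈ resolventSet A) :
    Commute (bumpOp A s) (res A z) := by
  have h1 : Commute (shiftInv A s) (res A z) :=
    shiftInv_commute_res (h.bound _ (neg_ofReal_mem_outside h.lt_pi hs)).1 hz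
  have h2 := h1.smul_left (s : ℂ)
  exact h2.sub_left (h2.mul_left h2)

/-- With D(z) = (z + B - l)⁻¹, combine zR(z,A) = 1 + R(z,A)A with zD(z) = 1 - D(z)(B - l). This
separates a term that does not see B from one that does not see A's resolvent. -/
theorem res_shiftRes_apply {l : ℂ} (hl : Admissible S ν c l) {z : ℂ} (hz : z ∈ contour ν)
    {x : X} (hxA : x ∈ A.domain) (hxB : x ∈ B.domain) :
    res A z (z • shiftRes B l z (A ⟨x, hxA⟩ + B ⟨x, hxB⟩ - l • x)) =
      res A z (A ⟨x, hxA⟩) + shiftRes B l z (B ⟨x, hxB⟩ - l • x) := by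
  have hzA := h.resolvent_left hz
  have hzB := (hl z (contour_subset_closedSector ν hz)).1
  have e1 := res_map hzA ⟨x, hxA⟩
  have e2 := res_map (h.bound' _ hzB).1 ⟨x, hxB⟩
  have hc := fun y => DFunLike.congr_fun (h.comm z hzA _ (h.bound' _ hzB).1).eq y
  simp only [mul_apply_eq_comp] at hc
  simp only at e1 e2
  simp only [shiftRes, neg_apply, map_add, map_sub, map_smul, smul_neg, map_neg, e2, hc, e1]
  module

/-- The term containing only the resolvent of B is holomorphic and decaying inside the sector, so
Cauchy's theorem deletes it and the calculus of A evaluates the rest. -/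
theorem bumpOp_apply_eq [CompleteSpace X] {l : ℂ} (hl : Admissible S ν c l) {s : ℝ} (hs : 0 < s)
    {x : X} (hxA : x ∈ A.domain) (hxB : x ∈ B.domain) :
    ContourIntegrable ν (fun z => bump s z • res A z (z • shiftRes B l z
      (A ⟨x, hxA⟩ + B ⟨x, hxB⟩ - l • x))) ∧
    contourIntegral ν (fun z => bump s z • res A z (z • shiftRes B l z
      (A ⟨x, hxA⟩ + B ⟨x, hxB⟩ - l • x))) = bumpOp A s (A ⟨x, hxA⟩) := by
  have hb := isCalculus_bump h.bound h.pos h.lt_pi hs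
  set w := B ⟨x, hxB⟩ - l • x with hw
  obtain ⟨C, hC⟩ := hb.bound
  have hdiff : DifferentiableOn ℂ (fun z => bump s z • shiftRes B l z w) (closedSector ν) :=
    hb.diff.smul ((h.differentiableOn_shiftRes hl).clm_apply (differentiableOn_const w))
  have hdec : DecaysOn (closedSector ν) (fun z => bump s z • shiftRes B l z w) := by
    refine ⟨C * (c * L * ‖w‖), fun z hz => ?_⟩
    have h1 := hC z hz
    calc ‖z • bump s z • shiftRes B l z w‖ = ‖bump s z‖ * ‖(z • shiftRes B l z) w‖ := by
          rw [smul_comm, norm_smul, smul_apply]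
      _ ≤ (C * min ‖z‖ ‖z‖⁻¹) * (c * L * ‖w‖) := by
          gcongr
          · exact (norm_nonneg _).trans h1
          · exact (ContinuousLinearMap.le_opNorm _ _).trans
              (by gcongr; exact h.norm_smul_shiftRes_le hl hz)
      _ = _ := by ring
  have i1 := hb.contourIntegrable h.bound h.pos h.lt_pi (A ⟨x, hxA⟩)
  have i2 := contourIntegrable_of_decaysOn h.pos.le h.lt_pi
    (hdiff.continuousOn.mono (contour_subset_closedSector ν))
    (hdec.mono (contour_subset_closedSector ν))
  have e : ∀ z ∈ contour ν, bump s z • res A z (z • shiftRes B l z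
      (A ⟨x, hxA⟩ + B ⟨x, hxB⟩ - l • x)) =
      bump s z • res A z (A ⟨x, hxA⟩) + bump s z • shiftRes B l z w := fun z hz => by
    rw [h.res_shiftRes_apply hl hz hxA hxB, smul_add]
  refine ⟨?_, ?_⟩
  · have := i1.add i2
    unfold ContourIntegrable at this ⊢
    simpa only [e _ (polar_mem_contour h.pos.le h.lt_pi _),
      e _ (polar_neg_mem_contour h.pos.le h.lt_pi _)] using this
  · rw [contourIntegral_congr h.pos.le h.lt_pi e, contourIntegral_add i1 i2, hb.eq,
      contourIntegral_inside h.pos.le h.lt_pi hdiff hdec, add_zero]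

end SumData

/-! ### The diagonal representation and the Rademacher estimate -/

theorem bump_polar_add (θ r τ : ℝ) : bump (Real.exp τ) (polar θ (r + τ)) = bump 1 (polar θ r) := by
  rw [polar_add, bump, bump]
  have : (Real.exp τ : ℂ) ≠ 0 := by exact_mod_cast (Real.exp_pos τ).ne'
  generalize (Real.exp τ : ℂ) = a at *
  have e : (a + a * polar θ r) ^ 2 = a ^ 2 * (1 + polar θ r) ^ 2 := by ring
  have e2 : a * (a * polar θ r) = a ^ 2 * polar θ r := by ring
  rw [e, e2, mul_div_mul_left _ _ (pow_ne_zero 2 this)]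
  push_cast
  rw [one_mul]

/-- The integrand of the diagonal representation. -/
def piece (A B : X →ₗ.[ℂ] X) (l : ℂ) (θ r τ : ℝ) (y : X) : X :=
  bumpOp A (Real.exp τ) ((polar θ (r + τ) • shiftRes B l (polar θ (r + τ)))
    ((polar θ (r + τ) • (res A (polar θ (r + τ)) * bumpOp A (Real.exp τ))) y))

namespace SumData

variable (h : SumData A B ν M K L S)
include h

/-- Apply two further bump factors to the contour formula and translate r by τ. By homogeneity the
scalar weight no longer depends on τ, so pieces at different scales share the same r-integral.
Commutation places one factor on each side of the resolvent of B. -/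
theorem bumpCube_apply_eq [CompleteSpace X] {l : ℂ} (hl : Admissible S ν c l) (τ : ℝ)
    {x : X} (hxA : x ∈ A.domain) (hxB : x ∈ B.domain) :
    (∀ θ, θ = ν ∨ θ = -ν → Integrable (fun r : ℝ => bump 1 (polar θ r) •
      piece A B l θ r τ (A ⟨x, hxA⟩ + B ⟨x, hxB⟩ - l • x))) ∧
    bumpCube A τ (A ⟨x, hxA⟩) = (-1 / (2 * Real.pi * Complex.I) : ℂ) •
      ((∫ r : ℝ, bump 1 (polar ν r) •
          piece A B l ν r τ (A ⟨x, hxA⟩ + B ⟨x, hxB⟩ - l • x)) -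
        ∫ r : ℝ, bump 1 (polar (-ν) r) •
          piece A B l (-ν) r τ (A ⟨x, hxA⟩ + B ⟨x, hxB⟩ - l • x)) := by
  obtain ⟨i, e⟩ := h.bumpOp_apply_eq hl (Real.exp_pos τ) hxA hxB
  set y := A ⟨x, hxA⟩ + B ⟨x, hxB⟩ - l • x with hy
  set P := bumpOp A (Real.exp τ) with hP
  have e2 := contourIntegral_clm (P * P) i
  have i2 := i.clm (P * P)
  have key : ∀ θ r : ℝ, polar θ (r + τ) ∈ contour ν →
      polar θ (r + τ) • (P * P) (bump (Real.exp τ) (polar θ (r + τ)) •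
        res A (polar θ (r + τ)) (polar θ (r + τ) • shiftRes B l (polar θ (r + τ)) y)) =
      bump 1 (polar θ r) • piece A B l θ r τ y := by
    intro θ r hz
    rw [bump_polar_add, piece]
    set z := polar θ (r + τ) with hz'
    have hzB := (hl z (contour_subset_closedSector ν hz)).1
    have c1 := fun v => DFunLike.congr_fun (h.commute_bumpOp_shiftRes (Real.exp_pos τ) hzB).eq v
    have c2 := fun v => DFunLike.congr_fun
      (h.commute_shiftRes (h.resolvent_left hz) hzB).eq v
    have c3 := fun v => DFunLike.congr_fun
      (h.commute_bumpOp_res (Real.exp_pos τ) (h.resolvent_left hz)).eq v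
    simp only [mul_apply_eq_comp, ← hP] at c1 c2 c3
    simp only [mul_apply_eq_comp, smul_apply, map_smul, ← hP, c2, c1, c3]
    rw [smul_comm]
  have shift : ∀ θ : ℝ, (∀ r, polar θ r ∈ contour ν) →
      (fun r : ℝ => (fun r => polar θ r • (P * P) (bump (Real.exp τ) (polar θ r) •
        res A (polar θ r) (polar θ r • shiftRes B l (polar θ r) y))) (r + τ)) =
      fun r => bump 1 (polar θ r) • piece A B l θ r τ y := fun θ hθ => by
    ext r
    exact key θ r (hθ _)
  have s1 := shift ν (polar_mem_contour h.pos.le h.lt_pi)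
  have s2 := shift (-ν) (polar_neg_mem_contour h.pos.le h.lt_pi)
  refine ⟨?_, ?_⟩
  · rintro θ (rfl | rfl)
    · rw [← s1]; exact i2.1.comp_add_right τ
    · rw [← s2]; exact i2.2.comp_add_right τ
  · rw [← s1, ← s2, integral_add_right_eq_self (μ := volume) (fun r => polar ν r •
      (P * P) (bump (Real.exp τ) (polar ν r) •
        res A (polar ν r) (polar ν r • shiftRes B l (polar ν r) y))) τ,
      integral_add_right_eq_self (μ := volume) (fun r => polar (-ν) r •
      (P * P) (bump (Real.exp τ) (polar (-ν) r) •
        res A (polar (-ν) r) (polar (-ν) r • shiftRes B l (polar (-ν) r) y))) τ]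
    rw [contourIntegral, rayIntegral, rayIntegral, e] at e2
    exact e2.symm

/-- Rademacher bound for the truncated reproducing integrals, when the operators
`z (z + B - l_j)⁻¹` on the contour are R-bounded for double Rademacher sums. -/
theorem radMap_bumpCube_le [CompleteSpace X] {ι : Type*} [Fintype ι] [DecidableEq ι] {R Cb : ℝ}
    (hR : 0 ≤ R)
    (hCb : ∀ θ : ℝ, |θ| = ν → ∀ r : ℝ, ‖bump 1 (polar θ r)‖ ≤ Cb * Real.exp (-|r|))
    {l : ι → ℂ} (hl : ∀ j, Admissible S ν c (l j))
    (hT : ∀ (n : ℕ) (ζ : Fin n → ℂ), (∀ k, ζ k ∈ contour ν) →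
      RBound₂ (fun (j : ι) k => ζ k • shiftRes B (l j) (ζ k)) R)
    (x : ι → X) (hxA : ∀ j, x j ∈ A.domain) (hxB : ∀ j, x j ∈ B.domain) (N : ℕ) (t : ℝ) :
    ‖radMap (fun j => ∑ k : Fin N, bumpCube A ((k : ℕ) + t) (A ⟨x j, hxA j⟩))‖ ≤
      Cb * (K ^ 2 * R) * expMass *
        ‖radMap (fun j => A ⟨x j, hxA j⟩ + B ⟨x j, hxB j⟩ - l j • x j)‖ := by
  set y : ι → X := fun j => A ⟨x j, hxA j⟩ + B ⟨x j, hxB j⟩ - l j • x j with hy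
  have hK := h.unconditional
  have hK0 := hK.nonneg
  have ray : ∀ θ, θ = ν ∨ θ = -ν →
      ‖radMap (fun j => ∫ r : ℝ, ∑ k : Fin N, bump 1 (polar θ r) •
        piece A B (l j) θ r ((k : ℕ) + t) (y j))‖ ≤
      Cb * (K ^ 2 * R) * expMass * ‖radMap y‖ := by
    intro θ hθ
    have hθ' : |θ| = ν := by
      rcases hθ with rfl | rfl
      · exact abs_of_pos h.pos
      · rw [abs_neg, abs_of_pos h.pos]
    have hmem : ∀ r, polar θ r ∈ contour ν := by
      rcases hθ with rfl | rfl
      · exact polar_mem_contour h.pos.le h.lt_pi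
      · exact polar_neg_mem_contour h.pos.le h.lt_pi
    have hle : ∀ r : ℝ, ‖radMap (fun j => ∑ k : Fin N, bump 1 (polar θ r) •
        piece A B (l j) θ r ((k : ℕ) + t) (y j))‖ ≤
        (Cb * (K ^ 2 * R) * ‖radMap y‖) * Real.exp (-|r|) := by
      intro r
      have e1 : (fun j => ∑ k : Fin N, bump 1 (polar θ r) •
          piece A B (l j) θ r ((k : ℕ) + t) (y j)) =
          bump 1 (polar θ r) • fun j => ∑ k : Fin N, piece A B (l j) θ r ((k : ℕ) + t) (y j) := by
        ext j
        rw [Pi.smul_apply, Finset.smul_sum]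
      -- For fixed r the sum over scales is a diagonal sum; both outer families are unconditionally
      -- bounded, uniformly in r and t.
      have e2 := radMap_sum_le (ι := ι) (κ := Fin N) hK0 hR
        (Ψ := fun k => bumpOp A (Real.exp ((k : ℕ) + t)))
        (Χ := fun k => polar θ (r + ((k : ℕ) + t)) • (res A (polar θ (r + ((k : ℕ) + t))) *
          bumpOp A (Real.exp ((k : ℕ) + t))))
        (T := fun j k => polar θ (r + ((k : ℕ) + t)) •
          shiftRes B (l j) (polar θ (r + ((k : ℕ) + t))))
        (fun η => hK.bump N η t) (fun η => hK.res_bump N η t r θ hθ')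
        (hT N _ fun k => hmem _) y
      rw [e1, map_smul, norm_smul]
      have h1 := hCb θ hθ' r
      calc _ ≤ (Cb * Real.exp (-|r|)) * (K ^ 2 * R * ‖radMap y‖) := by
            refine mul_le_mul h1 e2 (norm_nonneg _) ((norm_nonneg _).trans h1)
        _ = _ := by ring
    have hint := radMap_integral_le (μ := volume) (fun j => integrable_finsetSum Finset.univ
      fun (k : Fin N) _ => (h.bumpCube_apply_eq (hl j) ((k : ℕ) + t) (hxA j) (hxB j)).1 θ hθ)
      (integrable_exp_neg_abs.const_mul (Cb * (K ^ 2 * R) * ‖radMap y‖)) hle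
    refine hint.trans (le_of_eq ?_)
    rw [integral_const_mul, ← expMass]
    ring
  have e : (fun j => ∑ k : Fin N, bumpCube A ((k : ℕ) + t) (A ⟨x j, hxA j⟩)) =
      (-1 / (2 * Real.pi * Complex.I) : ℂ) • ((fun j => ∫ r : ℝ, ∑ k : Fin N,
        bump 1 (polar ν r) • piece A B (l j) ν r ((k : ℕ) + t) (y j)) -
        fun j => ∫ r : ℝ, ∑ k : Fin N,
        bump 1 (polar (-ν) r) • piece A B (l j) (-ν) r ((k : ℕ) + t) (y j)) := by
    ext j
    have hj := fun k : Fin N => h.bumpCube_apply_eq (hl j) ((k : ℕ) + t) (hxA j) (hxB j)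
    rw [Pi.smul_apply, Pi.sub_apply,
      integral_finsetSum _ fun k _ => (hj k).1 ν (Or.inl rfl),
      integral_finsetSum _ fun k _ => (hj k).1 (-ν) (Or.inr rfl),
      ← Finset.sum_sub_distrib, Finset.smul_sum]
    exact Finset.sum_congr rfl fun k _ => (hj k).2
  have r1 := ray ν (Or.inl rfl)
  have r2 := ray (-ν) (Or.inr rfl)
  rw [e, map_smul, map_sub, norm_smul]
  have hp : ‖(-1 / (2 * Real.pi * Complex.I) : ℂ)‖ ≤ 1 / 2 := by
    rw [norm_div, norm_neg, norm_one, norm_mul, norm_mul, Complex.norm_I, Complex.norm_real,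
      Real.norm_of_nonneg Real.pi_pos.le, Complex.norm_ofNat]
    have := Real.two_le_pi
    rw [mul_one]
    exact one_div_le_one_div_of_le (by norm_num) (by linarith)
  refine (mul_le_mul hp (norm_sub_le _ _) (norm_nonneg _) (by norm_num)).trans ?_
  linarith

/-- The reproducing integral over [-n, n] is an average over t of sums over the scales k + t - n,
each bounded independently of n. Letting n tend to infinity recovers Ax. -/
theorem radMap_le [CompleteSpace X] {ι : Type*} [Fintype ι] [DecidableEq ι] {R Cb : ℝ}
    (hR : 0 ≤ R)
    (hCb : ∀ θ : ℝ, |θ| = ν → ∀ r : ℝ, ‖bump 1 (polar θ r)‖ ≤ Cb * Real.exp (-|r|))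
    {l : ι → ℂ} (hl : ∀ j, Admissible S ν c (l j))
    (hT : ∀ (n : ℕ) (ζ : Fin n → ℂ), (∀ k, ζ k ∈ contour ν) →
      RBound₂ (fun (j : ι) k => ζ k • shiftRes B (l j) (ζ k)) R)
    (x : ι → X) (hxA : ∀ j, x j ∈ A.domain) (hxB : ∀ j, x j ∈ B.domain) :
    ‖radMap (fun j => A ⟨x j, hxA j⟩)‖ ≤ 30 * (Cb * (K ^ 2 * R) * expMass) *
        ‖radMap (fun j => A ⟨x j, hxA j⟩ + B ⟨x j, hxB j⟩ - l j • x j)‖ := by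
  set C := Cb * (K ^ 2 * R) * expMass *
    ‖radMap (fun j => A ⟨x j, hxA j⟩ + B ⟨x j, hxB j⟩ - l j • x j)‖ with hC
  have hcont := fun w : X =>
    (continuous_bumpCube h.bound h.pos h.lt_pi).clm_apply (continuous_const (y := w))
  have hn : ∀ n : ℕ, ‖radMap (fun j => (30 : ℝ) • ∫ τ in (-(n : ℝ))..n,
      bumpCube A τ (A ⟨x j, hxA j⟩))‖ ≤ 30 * C := by
    intro n
    -- Cut [-n, n] into 2n unit intervals and translate each of them to (0, 1].
    have e : ∀ w : X, ∫ τ in (-(n : ℝ))..n, bumpCube A τ w =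
        ∫ t in Ioc (0 : ℝ) 1, ∑ k : Fin (2 * n), bumpCube A ((k : ℕ) + (t - n)) w := by
      intro w
      have h1 := intervalIntegral.sum_integral_adjacent_intervals (n := 2 * n) (μ := volume)
        (f := fun τ => bumpCube A τ w) (a := fun k : ℕ => (k : ℝ) - n)
        (fun k _ => (hcont w).intervalIntegrable _ _)
      have h2 : ((0 : ℕ) : ℝ) - n = -n := by simp
      have h3 : ((2 * n : ℕ) : ℝ) - n = n := by push_cast; ring
      rw [h2, h3] at h1
      rw [← h1, integral_finsetSum, ← Fin.sum_univ_eq_sum_range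
        (fun k : ℕ => ∫ τ in ((k : ℝ) - n)..(((k + 1 : ℕ) : ℝ) - n), bumpCube A τ w)]
      · refine Finset.sum_congr rfl fun k _ => ?_
        rw [← intervalIntegral.integral_of_le zero_le_one]
        have h4 := intervalIntegral.integral_comp_add_right (a := 0) (b := 1)
          (fun τ => bumpCube A τ w) (((k : ℕ) : ℝ) - n)
        rw [zero_add] at h4
        have h5 : (1 : ℝ) + (((k : ℕ) : ℝ) - n) = (((k : ℕ) + 1 : ℕ) : ℝ) - n := by push_cast; ring
        rw [h5] at h4
        rw [← h4]
        refine intervalIntegral.integral_congr fun t _ => ?_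
        congr 2
        ring
      · intro k _
        have : Continuous fun t : ℝ => bumpCube A ((k : ℕ) + (t - n)) w :=
          (hcont w).comp (by fun_prop)
        exact (this.intervalIntegrable 0 1).1
    have e2 : (fun j => (30 : ℝ) • ∫ τ in (-(n : ℝ))..n, bumpCube A τ (A ⟨x j, hxA j⟩)) =
        (30 : ℂ) • fun j => ∫ t in Ioc (0 : ℝ) 1, ∑ k : Fin (2 * n),
          bumpCube A ((k : ℕ) + (t - n)) (A ⟨x j, hxA j⟩) := by
      ext j
      rw [e, Pi.smul_apply]
      have : (30 : ℂ) = ((30 : ℝ) : ℂ) := by norm_num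
      rw [this, Complex.coe_smul]
    rw [e2, map_smul, norm_smul, Complex.norm_ofNat]
    refine mul_le_mul_of_nonneg_left ?_ (by norm_num)
    have h6 := radMap_integral_le (μ := volume.restrict (Ioc (0 : ℝ) 1)) (g := fun _ => C)
      (f := fun j t => ∑ k : Fin (2 * n), bumpCube A ((k : ℕ) + (t - n)) (A ⟨x j, hxA j⟩))
      (fun j => integrable_finsetSum _ fun k _ => by
        have : Continuous fun t : ℝ => bumpCube A ((k : ℕ) + (t - n)) (A ⟨x j, hxA j⟩) :=
          (hcont _).comp (by fun_prop)
        exact (this.intervalIntegrable 0 1).1)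
      (integrable_const _)
      (fun t => h.radMap_bumpCube_le hR hCb hl hT x hxA hxB (2 * n) (t - n))
    refine h6.trans (le_of_eq ?_)
    simp
  have hlim : Tendsto (fun n : ℕ => fun j => (30 : ℝ) • ∫ τ in (-(n : ℝ))..n,
      bumpCube A τ (A ⟨x j, hxA j⟩)) atTop (𝓝 fun j => A ⟨x j, hxA j⟩) :=
    tendsto_pi_nhds.2 fun j =>
      tendsto_integral_bumpCube h.bound h.pos h.lt_pi h.dense_domain h.dense_range _
  have := le_of_tendsto ((radMap.continuous.tendsto _).comp hlim).norm (Eventually.of_forall hn)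
  rw [mul_assoc]
  exact this

end SumData

end

end SectorialSum

namespace SectorialSum

open MeasureTheory Set Filter Topology

noncomputable section

variable {X : Type*} [NormedAddCommGroup X] [NormedSpace ℂ X]

/-! ### Closedness and invertibility of the sum -/

/-- The estimate makes Ax_n Cauchy whenever (A + B)x_n converges; then Bx_n converges as well, and
both operators are closed. -/
theorem isClosed_add {A B : X →ₗ.[ℂ] X} (hA : A.IsClosed) (hB : B.IsClosed) [CompleteSpace X]
    {C : ℝ} (h : ∀ (x : X) (hxA : x ∈ A.domain) (hxB : x ∈ B.domain),
      ‖A ⟨x, hxA⟩‖ ≤ C * ‖A ⟨x, hxA⟩ + B ⟨x, hxB⟩‖) : (A + B).IsClosed := by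
  refine IsSeqClosed.isClosed fun u p hu hp => ?_
  have hu' : ∀ n, ∃ x : (A + B).domain, (x : X) = (u n).1 ∧ (A + B) x = (u n).2 := fun n =>
    (LinearPMap.mem_graph_iff _).1 (hu n)
  choose x hx1 hx2 using hu'
  have t1 : Tendsto (fun n => (x n : X)) atTop (𝓝 p.1) := by
    simp only [hx1]; exact (continuous_fst.tendsto p).comp hp
  have t2 : Tendsto (fun n => A ⟨x n, (x n).2.1⟩ + B ⟨x n, (x n).2.2⟩) atTop (𝓝 p.2) := by
    have : ∀ n, A ⟨x n, (x n).2.1⟩ + B ⟨x n, (x n).2.2⟩ = (u n).2 := fun n => hx2 n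
    simp only [this]; exact (continuous_snd.tendsto p).comp hp
  have hcau : CauchySeq (fun n => A ⟨x n, (x n).2.1⟩) := by
    have hc2 := t2.cauchySeq
    rw [Metric.cauchySeq_iff] at hc2 ⊢
    intro ε hε
    obtain ⟨N, hN⟩ := hc2 (ε / (|C| + 1)) (by positivity)
    refine ⟨N, fun m hm n hn => ?_⟩
    have h1 := hN m hm n hn
    rw [dist_eq_norm, lt_div_iff₀ (by positivity)] at h1
    rw [dist_eq_norm]
    have h2 := h _ (A.domain.sub_mem (x m).2.1 (x n).2.1) (B.domain.sub_mem (x m).2.2 (x n).2.2)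
    have e1 : A ⟨(x m : X) - x n, A.domain.sub_mem (x m).2.1 (x n).2.1⟩ =
        A ⟨x m, (x m).2.1⟩ - A ⟨x n, (x n).2.1⟩ := A.map_sub ⟨x m, (x m).2.1⟩ ⟨x n, (x n).2.1⟩
    have e2 : B ⟨(x m : X) - x n, B.domain.sub_mem (x m).2.2 (x n).2.2⟩ =
        B ⟨x m, (x m).2.2⟩ - B ⟨x n, (x n).2.2⟩ := B.map_sub ⟨x m, (x m).2.2⟩ ⟨x n, (x n).2.2⟩
    rw [e1, e2] at h2
    have e3 : A ⟨x m, (x m).2.1⟩ - A ⟨x n, (x n).2.1⟩ + (B ⟨x m, (x m).2.2⟩ - B ⟨x n, (x n).2.2⟩) =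
        A ⟨x m, (x m).2.1⟩ + B ⟨x m, (x m).2.2⟩ - (A ⟨x n, (x n).2.1⟩ + B ⟨x n, (x n).2.2⟩) := by
      abel
    rw [e3] at h2
    set d := ‖A ⟨x m, (x m).2.1⟩ + B ⟨x m, (x m).2.2⟩ - (A ⟨x n, (x n).2.1⟩ + B ⟨x n, (x n).2.2⟩)‖
    have hd0 : 0 ≤ d := norm_nonneg _
    nlinarith [le_abs_self C]
  obtain ⟨a, ta⟩ := cauchySeq_tendsto_of_complete hcau
  have tb : Tendsto (fun n => B ⟨x n, (x n).2.2⟩) atTop (𝓝 (p.2 - a)) := by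
    refine (t2.sub ta).congr fun n => ?_
    abel
  have gA : (p.1, a) ∈ A.graph := hA.isSeqClosed
    (fun n => A.mem_graph ⟨x n, (x n).2.1⟩) (t1.prodMk_nhds ta)
  have gB : (p.1, p.2 - a) ∈ B.graph := hB.isSeqClosed
    (fun n => B.mem_graph ⟨x n, (x n).2.2⟩) (t1.prodMk_nhds tb)
  obtain ⟨y, hy1, hy2⟩ := (LinearPMap.mem_graph_iff _).1 gA
  obtain ⟨z, hz1, hz2⟩ := (LinearPMap.mem_graph_iff _).1 gB
  simp only at hy1 hy2 hz1 hz2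
  refine (LinearPMap.mem_graph_iff _).2 ⟨⟨p.1, ?_, ?_⟩, rfl, ?_⟩
  · rw [← hy1]; exact y.2
  · rw [← hz1]; exact z.2
  · have ey : A ⟨p.1, by rw [← hy1]; exact y.2⟩ = a := by
      rw [← hy2]; congr 1; exact Subtype.ext hy1.symm
    have ez : B ⟨p.1, by rw [← hz1]; exact z.2⟩ = p.2 - a := by
      rw [← hz2]; congr 1; exact Subtype.ext hz1.symm
    change A ⟨p.1, _⟩ + B ⟨p.1, _⟩ = p.2
    rw [ey, ez]
    abel

theorem mem_resolventSet_of_bound [CompleteSpace X] {T : X →ₗ.[ℂ] X} (hT : T.IsClosed) {l : ℂ}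
    {c : ℝ} (hb : ∀ x : T.domain, ‖(x : X)‖ ≤ c * ‖l • (x : X) - T x‖)
    (hd : Dense {y : X | ∃ x : T.domain, l • (x : X) - T x = y}) : l ∈ resolventSet T := by
  let L : T.domain →ₗ[ℂ] X := l • T.domain.subtype - T.toFun
  have hL : ∀ x, L x = l • (x : X) - T x := fun x => rfl
  have hinj : Function.Injective L := by
    refine (injective_iff_map_eq_zero L).2 fun x hx => ?_
    have := hb x
    rw [← hL, hx, norm_zero, mul_zero, norm_le_zero_iff] at this
    exact Subtype.ext this
  have hsurj : Function.Surjective L := by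
    intro y
    obtain ⟨v, hv, tv⟩ := mem_closure_iff_seq_limit.1 (hd y)
    choose x hx using hv
    have hcau : CauchySeq (fun n => (x n : X)) := by
      have hc2 := tv.cauchySeq
      rw [Metric.cauchySeq_iff] at hc2 ⊢
      intro ε hε
      obtain ⟨N, hN⟩ := hc2 (ε / (|c| + 1)) (by positivity)
      refine ⟨N, fun m hm n hn => ?_⟩
      have h1 := hN m hm n hn
      rw [dist_eq_norm, lt_div_iff₀ (by positivity)] at h1
      rw [dist_eq_norm]
      have h2 := hb (x m - x n)
      rw [← hL, map_sub, hL, hL, hx, hx] at h2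
      have h3 : ((x m - x n : T.domain) : X) = x m - x n := rfl
      rw [h3] at h2
      nlinarith [le_abs_self c, norm_nonneg (v m - v n)]
    obtain ⟨a, ta⟩ := cauchySeq_tendsto_of_complete hcau
    have tT : Tendsto (fun n => T (x n)) atTop (𝓝 (l • a - y)) := by
      refine ((ta.const_smul l).sub tv).congr fun n => ?_
      rw [← hx n]; abel
    have g : (a, l • a - y) ∈ T.graph := hT.isSeqClosed
      (fun n => T.mem_graph (x n)) (ta.prodMk_nhds tT)
    obtain ⟨w, hw1, hw2⟩ := (LinearPMap.mem_graph_iff _).1 g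
    simp only at hw1 hw2
    refine ⟨w, ?_⟩
    rw [hL, hw1, hw2]
    abel
  let e := LinearEquiv.ofBijective L ⟨hinj, hsurj⟩
  have he : ∀ y, L (e.symm y) = y := fun y => e.apply_symm_apply y
  refine ⟨(T.domain.subtype ∘ₗ e.symm.toLinearMap).mkContinuous c fun y => ?_, fun y => ?_,
    fun x => ?_⟩
  · have := hb (e.symm y)
    rw [← hL, he] at this
    exact this
  · exact ⟨(e.symm y).2, he y⟩
  · have : e.symm (L x) = x := e.symm_apply_apply x
    change ((e.symm (L x) : T.domain) : X) = x
    rw [this]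

/-- Closed operators pass under the integral: G(z) = R(z₀,A)(z₀G(z) - F(z)), and the bounded
operator R(z₀,A) commutes with integration. -/
theorem contourIntegral_mem_domain [CompleteSpace X] {A : X →ₗ.[ℂ] X} {ν : ℝ} (h0 : 0 ≤ ν)
    (hν : ν < Real.pi) {z₀ : ℂ} (hz₀ : z₀ ∈ resolventSet A) {G F : ℂ → X}
    (hG : ContourIntegrable ν G) (hF : ContourIntegrable ν F)
    (h : ∀ z ∈ contour ν, ∃ hm : G z ∈ A.domain, A ⟨G z, hm⟩ = F z) :
    ∃ hm : contourIntegral ν G ∈ A.domain, A ⟨contourIntegral ν G, hm⟩ = contourIntegral ν F := by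
  have i1 := hG.clm (z₀ • (1 : X →L[ℂ] X))
  have i2 := hF.clm (-(1 : X →L[ℂ] X))
  have e1 := contourIntegral_clm (z₀ • (1 : X →L[ℂ] X)) hG
  have e2 := contourIntegral_clm (-(1 : X →L[ℂ] X)) hF
  have e3 := contourIntegral_add i1 i2
  have e4 := contourIntegral_clm (res A z₀) (i1.add i2)
  have e5 : contourIntegral ν G = res A z₀ (z₀ • contourIntegral ν G - contourIntegral ν F) := by
    rw [e3, e1, e2] at e4
    simp only [smul_apply, neg_apply, one_apply_eq_self, ← sub_eq_add_neg] at e4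
    rw [← e4]
    refine contourIntegral_congr h0 hν fun z hz => ?_
    obtain ⟨hm, hz'⟩ := h z hz
    rw [← hz', map_sub, map_smul, res_map hz₀]
    module
  have hm : contourIntegral ν G ∈ A.domain := by
    rw [e5]; exact res_mem_domain hz₀ _
  refine ⟨hm, ?_⟩
  have e6 := map_res hz₀ (z₀ • contourIntegral ν G - contourIntegral ν F)
  simp only [← e5] at e6
  rw [e6]
  abel

variable {A B : X →ₗ.[ℂ] X} {ν M K L c : ℝ} {S : Set ℂ}

namespace SumData

variable (h : SumData A B ν M K L S)
include h

/-- The solution is x = -1/(2πi) ∫ g(z) R(z,A) D(z) y dz with D(z) = (z + B - l)⁻¹. Since (A + B -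
l) R(z,A) D(z) = R(z,A) - D(z), the first term gives g(A)y and the second integrates to 0. -/
theorem exists_solution [CompleteSpace X] {l : ℂ} (hl : Admissible S ν c l) (y : X) :
    ∃ (x : X) (hxA : x ∈ A.domain) (hxB : x ∈ B.domain),
      A ⟨x, hxA⟩ + B ⟨x, hxB⟩ - l • x = (bumpOp A 1 * bumpOp A 1) y := by
  have hM := h.bound_nonneg
  have hb1 := isCalculus_bump h.bound h.pos h.lt_pi one_pos
  have hb := hb1.bump_mul h.bound h.pos h.lt_pi one_pos
  obtain ⟨C, hC⟩ := hb1.bound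
  set g : ℂ → ℂ := fun z => bump 1 z * bump 1 z with hg
  have hsub := contour_subset_closedSector ν
  have hz0 : ∀ z ∈ closedSector ν, 0 < ‖z‖ := fun z hz => norm_pos_iff.2 hz.1
  have hC0 : 0 ≤ C := by
    have h1 : (1 : ℂ) ∈ closedSector ν := ⟨one_ne_zero, by simpa using h.pos.le⟩
    have := (norm_nonneg _).trans (hC 1 h1)
    simpa using this
  have hmin1 : ∀ z ∈ closedSector ν, min ‖z‖ ‖z‖⁻¹ ≤ 1 := fun z hz => by
    rcases le_total ‖z‖ 1 with h1 | h1
    · exact (min_le_left _ _).trans h1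
    · exact (min_le_right _ _).trans (inv_le_one_of_one_le₀ h1)
  have hg1 : ∀ z ∈ closedSector ν, ‖g z‖ ≤ C ^ 2 * (min ‖z‖ ‖z‖⁻¹ * min ‖z‖ ‖z‖⁻¹) := by
    intro z hz
    rw [hg, norm_mul]
    have h1 := hC z hz
    calc _ ≤ (C * min ‖z‖ ‖z‖⁻¹) * (C * min ‖z‖ ‖z‖⁻¹) :=
          mul_le_mul h1 h1 (norm_nonneg _) ((norm_nonneg _).trans h1)
      _ = _ := by ring
  have hg2 : ∀ z ∈ closedSector ν, ‖g z‖ ≤ C ^ 2 * min ‖z‖ ‖z‖⁻¹ := by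
    intro z hz
    refine (hg1 z hz).trans ?_
    gcongr
    have := hmin1 z hz
    have h2 : 0 ≤ min ‖z‖ ‖z‖⁻¹ := by positivity
    nlinarith
  -- The reason for squaring the bump: R(z,A)D(z) is of size |z|⁻², so one extra power of |z| is
  -- needed for integrability at 0.
  have hg3 : ∀ z ∈ closedSector ν, ‖g z‖ * ‖z‖⁻¹ ≤ C ^ 2 * min ‖z‖ ‖z‖⁻¹ := by
    intro z hz
    have hp := hz0 z hz
    have h3 : min ‖z‖ ‖z‖⁻¹ * ‖z‖⁻¹ ≤ 1 := by
      calc _ ≤ ‖z‖ * ‖z‖⁻¹ := by gcongr; exact min_le_left _ _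
        _ = 1 := mul_inv_cancel₀ hp.ne'
    calc _ ≤ C ^ 2 * (min ‖z‖ ‖z‖⁻¹ * min ‖z‖ ‖z‖⁻¹) * ‖z‖⁻¹ := by gcongr; exact hg1 z hz
      _ = C ^ 2 * min ‖z‖ ‖z‖⁻¹ * (min ‖z‖ ‖z‖⁻¹ * ‖z‖⁻¹) := by ring
      _ ≤ C ^ 2 * min ‖z‖ ‖z‖⁻¹ * 1 := by gcongr
      _ = _ := mul_one _
  have hDc : ContinuousOn (shiftRes B l) (contour ν) :=
    (h.differentiableOn_shiftRes hl).continuousOn.mono hsub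
  have hRc : ContinuousOn (res A) (contour ν) :=
    (differentiableOn_res h.bound (zero_notMem_outside h.pos)).continuousOn.mono
      (contour_subset_outside ν)
  have hgc : ContinuousOn g (contour ν) := hb.diff.continuousOn.mono hsub
  have hRb : ∀ z ∈ contour ν, ∀ v : X, ‖z • res A z v‖ ≤ M * ‖v‖ := fun z hz v => by
    rw [← smul_apply]
    exact (ContinuousLinearMap.le_opNorm _ _).trans
      (by gcongr; exact (h.bound z (contour_subset_outside ν hz)).2)
  have hDb : ∀ z ∈ contour ν, ∀ v : X, ‖z • shiftRes B l z v‖ ≤ c * L * ‖v‖ := fun z hz v => by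
    rw [← smul_apply]
    exact (ContinuousLinearMap.le_opNorm _ _).trans
      (by gcongr; exact h.norm_smul_shiftRes_le hl (hsub hz))
  have hcL : 0 ≤ c * L := (norm_nonneg _).trans (h.norm_smul_shiftRes_le hl
    (z := 1) ⟨one_ne_zero, by simpa using h.pos.le⟩)
  have hcL' : 0 ≤ L := (norm_nonneg _).trans (h.bound' _ (hl 1
    ⟨one_ne_zero, by simpa using h.pos.le⟩).1).2
  have hDR : ∀ z ∈ contour ν, ∀ v, res A z (shiftRes B l z v) = shiftRes B l z (res A z v) :=
    fun z hz v => DFunLike.congr_fun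
      (h.commute_shiftRes (h.resolvent_left hz) (hl z (hsub hz)).1).eq v
  have iD : ContourIntegrable ν (fun z => g z • shiftRes B l z y) := by
    refine contourIntegrable_of_decaysOn h.pos.le h.lt_pi
      (hgc.smul (hDc.clm_apply continuousOn_const)) ⟨C ^ 2 * (c * L * ‖y‖), fun z hz => ?_⟩
    rw [smul_comm, norm_smul]
    calc _ ≤ (C ^ 2 * min ‖z‖ ‖z‖⁻¹) * (c * L * ‖y‖) := by
          gcongr
          · exact hg2 z (hsub hz)
          · exact hDb z hz y
      _ = _ := by ring
  have iRD : ContourIntegrable ν (fun z => g z • res A z (shiftRes B l z y)) := by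
    refine contourIntegrable_of_decaysOn h.pos.le h.lt_pi
      (hgc.smul (hRc.clm_apply (hDc.clm_apply continuousOn_const)))
      ⟨C ^ 2 * (M * (c * L * ‖y‖)), fun z hz => ?_⟩
    have hp := hz0 z (hsub hz)
    have h1 : ‖z • res A z (shiftRes B l z y)‖ ≤ ‖z‖⁻¹ * (M * (c * L * ‖y‖)) := by
      refine (hRb z hz _).trans ?_
      have h2 := hDb z hz y
      rw [norm_smul] at h2
      rw [inv_mul_eq_div, le_div_iff₀ hp]
      calc _ = M * (‖z‖ * ‖shiftRes B l z y‖) := by ring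
        _ ≤ _ := by gcongr
    rw [smul_comm, norm_smul]
    calc _ ≤ ‖g z‖ * (‖z‖⁻¹ * (M * (c * L * ‖y‖))) := by gcongr
      _ = (‖g z‖ * ‖z‖⁻¹) * (M * (c * L * ‖y‖)) := by ring
      _ ≤ (C ^ 2 * min ‖z‖ ‖z‖⁻¹) * (M * (c * L * ‖y‖)) := by
          gcongr ?_ * _
          exact hg3 z (hsub hz)
      _ = _ := by ring
  have izRD : ContourIntegrable ν (fun z => g z • (z • res A z (shiftRes B l z y))) := by
    refine contourIntegrable_of_decaysOn h.pos.le h.lt_pi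
      (hgc.smul (continuousOn_id.smul (hRc.clm_apply (hDc.clm_apply continuousOn_const))))
      ⟨C ^ 2 * (M * (c * L * ‖y‖)), fun z hz => ?_⟩
    have h1 : ‖z • z • res A z (shiftRes B l z y)‖ ≤ M * (c * L * ‖y‖) := by
      rw [← map_smul]
      refine (hRb z hz _).trans ?_
      gcongr
      exact hDb z hz y
    rw [smul_comm, norm_smul]
    calc _ ≤ (C ^ 2 * min ‖z‖ ‖z‖⁻¹) * (M * (c * L * ‖y‖)) := by
          gcongr
          exact hg2 z (hsub hz)
      _ = _ := by ring
  have iR := hb.contourIntegrable h.bound h.pos h.lt_pi y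
  have iA : ContourIntegrable ν (fun z => g z • (z • res A z (shiftRes B l z y)) +
      (-(1 : X →L[ℂ] X)) (g z • shiftRes B l z y)) := izRD.add (iD.clm _)
  have iB : ContourIntegrable ν (fun z => (l • (1 : X →L[ℂ] X))
      (g z • res A z (shiftRes B l z y)) +
      ((-(1 : X →L[ℂ] X)) (g z • (z • res A z (shiftRes B l z y))) + g z • res A z y)) :=
    (iRD.clm _).add ((izRD.clm _).add iR)
  obtain ⟨zA, hzA⟩ : ∃ z₀, z₀ ∈ resolventSet A :=
    ⟨_, (h.bound _ (neg_ofReal_mem_outside h.lt_pi one_pos)).1⟩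
  obtain ⟨zB, hzB⟩ : ∃ z₀, z₀ ∈ resolventSet B :=
    ⟨_, (h.bound' _ (hl 1 ⟨one_ne_zero, by simpa using h.pos.le⟩).1).1⟩
  obtain ⟨mA, eA⟩ := contourIntegral_mem_domain h.pos.le h.lt_pi hzA iRD iA fun z hz => by
    have hzA' := h.resolvent_left hz
    refine ⟨A.domain.smul_mem _ (res_mem_domain hzA' _), ?_⟩
    have e1 := A.map_smul (g z) ⟨_, res_mem_domain hzA' (shiftRes B l z y)⟩
    have e2 : A ⟨g z • res A z (shiftRes B l z y), A.domain.smul_mem _ (res_mem_domain hzA' _)⟩ =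
      g z • A ⟨_, res_mem_domain hzA' (shiftRes B l z y)⟩ := e1
    rw [e2, map_res hzA', neg_apply, one_apply_eq_self]
    module
  obtain ⟨mB, eB⟩ := contourIntegral_mem_domain h.pos.le h.lt_pi hzB iRD iB fun z hz => by
    have hzB' := (h.bound' _ (hl z (hsub hz)).1).1
    have e0 : g z • res A z (shiftRes B l z y) = (-g z) • res B (l - z) (res A z y) := by
      rw [hDR z hz, shiftRes, neg_apply]; module
    have hm : g z • res A z (shiftRes B l z y) ∈ B.domain := by
      rw [e0]; exact B.domain.smul_mem _ (res_mem_domain hzB' _)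
    refine ⟨hm, ?_⟩
    have e1 := B.map_smul (-g z) ⟨_, res_mem_domain hzB' (res A z y)⟩
    have e2 : B ⟨g z • res A z (shiftRes B l z y), hm⟩ =
        (-g z) • B ⟨_, res_mem_domain hzB' (res A z y)⟩ := by
      rw [← e1]; congr 1; exact Subtype.ext e0
    rw [e2, map_res hzB', neg_apply, smul_apply, one_apply_eq_self, one_apply_eq_self, hDR z hz,
      shiftRes, neg_apply]
    module
  refine ⟨_, mA, mB, ?_⟩
  have hzero : contourIntegral ν (fun z => g z • shiftRes B l z y) = 0 := by
    refine contourIntegral_inside h.pos.le h.lt_pi (hb.diff.smul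
      ((h.differentiableOn_shiftRes hl).clm_apply (differentiableOn_const y)))
      ⟨C ^ 2 * (c * L * ‖y‖), fun z hz => ?_⟩
    rw [smul_comm, norm_smul]
    have : ‖z • shiftRes B l z y‖ ≤ c * L * ‖y‖ := by
      rw [← smul_apply]
      exact (ContinuousLinearMap.le_opNorm _ _).trans
        (by gcongr; exact h.norm_smul_shiftRes_le hl hz)
    calc _ ≤ (C ^ 2 * min ‖z‖ ‖z‖⁻¹) * (c * L * ‖y‖) := by
          gcongr
          exact hg2 z hz
      _ = _ := by ring
  rw [eA, eB, contourIntegral_add izRD (iD.clm _), contourIntegral_add (iRD.clm _)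
    ((izRD.clm _).add iR), contourIntegral_add (izRD.clm _) iR, contourIntegral_clm _ iD,
    contourIntegral_clm _ iRD, contourIntegral_clm _ izRD, hzero, hb.eq]
  simp only [neg_apply, smul_apply, one_apply_eq_self]
  module

theorem dense_range_sub [CompleteSpace X] {l : ℂ} (hl : Admissible S ν c l) :
    Dense {y : X | ∃ x : (A + B).domain, l • (x : X) - (A + B) x = y} := by
  have hd := denseRange_bumpOp one_pos
    (h.bound _ (neg_ofReal_mem_outside h.lt_pi one_pos)).1 h.dense_domain h.dense_range
  refine (denseRange_mul hd hd).mono ?_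
  rintro _ ⟨y, rfl⟩
  obtain ⟨x, hxA, hxB, e⟩ := h.exists_solution hl (-y)
  refine ⟨⟨x, hxA, hxB⟩, ?_⟩
  have : (A + B) ⟨x, hxA, hxB⟩ = A ⟨x, hxA⟩ + B ⟨x, hxB⟩ := rfl
  rw [map_neg] at e
  rw [this, ← neg_inj, ← e]
  abel

end SumData

end

end SectorialSum

namespace SectorialSum

open MeasureTheory Set Filter Topology

noncomputable section

variable {X : Type*} [NormedAddCommGroup X] [NormedSpace ℂ X]

variable {A B : X →ₗ.[ℂ] X} {ν ρ σ θ M K L c : ℝ} {S : Set ℂ}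

/-! ### Choice of the angles -/

theorem exists_sumData [CompleteSpace X] (hcomm : ResolventsCommute A B) (hA : IsSectorial A)
    (hσ : HasHInftyCalculus A σ) (hσν : σ < ν) (hν : ν < Real.pi)
    (hρ0 : 0 < ρ) (hB : HasRBoundedResolvent B ρ) :
    ∃ M K L, SumData A B ν M K L {w : ℂ | ρ < |w.arg|} := by
  obtain ⟨ω, hω, hωσ⟩ := exists_lt_of_csInf_lt hA hσ.1
  have hω0 : 0 ≤ ω := hω.nonneg
  -- The contour angle must exceed an angle of sectoriality and stay below the angle of the
  -- calculus.
  set ν₀ := (ω + σ) / 2 with hν₀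
  have h1 : ω < ν₀ := by rw [hν₀]; linarith
  have h2 : ν₀ < σ := by rw [hν₀]; linarith
  have h3 : 0 < ν₀ := hω0.trans_lt h1
  have h4 : sectorialAngle A < ν₀ :=
    (csInf_le ⟨0, fun _ h => IsSectorialOfType.nonneg h⟩ hω).trans_lt h1
  obtain ⟨M, hM⟩ := hω.resolvent_bound ν₀ h1
  have hbd : ResolventBoundOn A (outside ν₀) M := fun z hz =>
    ⟨hω.mem_resolventSet z (h1.trans_le hz), hM z hz⟩
  obtain ⟨K, hK⟩ := exists_unconditionalBound hbd h3 h2 hσν hν hω.dense_domain hω.dense_range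
    fun f hf => by
      obtain ⟨T, hT⟩ := hσ.2 f hf
      refine ⟨T, fun x => ?_⟩
      obtain ⟨D, -, hD⟩ := regularized_integral hbd h3 (h2.trans (hσν.trans hν)) h2 (n := 2)
        (by norm_num)
      obtain ⟨b, hb⟩ := hf.2
      rw [hT 2 (by norm_num) ν₀ h4 h2 x, cauchyIntegral_eq]
      exact (hD f hf.1 |b| (abs_nonneg b) (fun z hz => (hb z hz).trans (le_abs_self b)) x).1
  obtain ⟨L, -, hL⟩ := hB.2.exists_norm_le
  refine ⟨M, K, L, h3.trans (h2.trans hσν), hν, hbd.mono fun z hz => (h2.trans hσν).le.trans hz, hK,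
    hω.dense_domain, hω.dense_range, hcomm, fun z hz => ⟨hB.1 z hz, hL _ ⟨z, hz, rfl⟩⟩, ?_⟩
  simpa using hρ0.le

theorem exists_angles [CompleteSpace X] (hcomm : ResolventsCommute A B)
    (hA : IsHInftySectorial A) (hB : IsRSectorial B)
    (hangle : hInftyAngle A + rAngle B < Real.pi) (hθ : max (hInftyAngle A) (rAngle B) < θ) :
    ∃ ν ρ M K L, 0 < ρ ∧ ν < θ ∧ ρ < θ ∧ ν + ρ < Real.pi ∧ HasRBoundedResolvent B ρ ∧
      SumData A B ν M K L {w : ℂ | ρ < |w.arg|} := by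
  obtain ⟨h1, h2⟩ := max_lt_iff.1 hθ
  -- The caps (ω_H + π - ω_R)/2 for σ and (ω_R + π - ω_H)/2 for ρ add up to π, so σ + ρ < π and
  -- there is room for ν between σ and π - ρ.
  obtain ⟨σ, ⟨hσ0, hσπ, hσ⟩, hσl⟩ := exists_lt_of_csInf_lt hA.2
    (lt_min h1 (by linarith : hInftyAngle A < (hInftyAngle A + (Real.pi - rAngle B)) / 2))
  obtain ⟨ρ, ⟨hρ0, hρπ, hρ⟩, hρl⟩ := exists_lt_of_csInf_lt hB.2
    (lt_min h2 (by linarith : rAngle B < (rAngle B + (Real.pi - hInftyAngle A)) / 2))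
  obtain ⟨s1, s2⟩ := lt_min_iff.1 hσl
  obtain ⟨r1, r2⟩ := lt_min_iff.1 hρl
  obtain ⟨ν, hν1, hν2⟩ := exists_between (lt_min s1 (by linarith : σ < Real.pi - ρ))
  obtain ⟨n1, n2⟩ := lt_min_iff.1 hν2
  obtain ⟨M, K, L, h⟩ := exists_sumData hcomm hA.1 hσ hν1 (by linarith) hρ0 hρ
  exact ⟨ν, ρ, M, K, L, hρ0, n1, r1, by linarith, hρ, h⟩

theorem cos_arg_neg {z : ℂ} (hz : z ≠ 0) : Real.cos (-z).arg = -Real.cos z.arg := by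
  rw [Complex.cos_arg hz, Complex.cos_arg (neg_ne_zero.2 hz), norm_neg, Complex.neg_re, neg_div]

/-- Passing from z to -z replaces |arg z| by π - |arg z| ≥ π - ν > ρ; the comparison is made through
cosines. -/
theorem admissible_zero (hρ0 : 0 ≤ ρ) (h : ν + ρ < Real.pi) :
    Admissible {w : ℂ | ρ < |w.arg|} ν 1 0 := by
  rintro z ⟨hz, hzν⟩
  rw [zero_sub, norm_neg, one_mul]
  refine ⟨?_, le_rfl⟩
  by_contra! hcon
  replace hcon : |(-z).arg| ≤ ρ := not_lt.1 hcon
  have hν0 := (abs_nonneg _).trans hzν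
  have e := cos_arg_neg hz
  rw [← Real.cos_abs, ← Real.cos_abs z.arg] at e
  have h1 : Real.cos ν ≤ Real.cos |z.arg| :=
    Real.cos_le_cos_of_nonneg_of_le_pi (abs_nonneg _) (by linarith) hzν
  have h2 : Real.cos ρ ≤ Real.cos |(-z).arg| :=
    Real.cos_le_cos_of_nonneg_of_le_pi (abs_nonneg _) (by linarith) hcon
  have h3 : Real.cos (Real.pi - ν) < Real.cos ρ :=
    Real.cos_lt_cos_of_nonneg_of_le_pi hρ0 (by linarith) (by linarith)
  rw [Real.cos_pi_sub] at h3
  linarith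

theorem exists_admissible (hν0 : 0 < ν) (hρ0 : 0 < ρ) (hνθ : ν < θ) (hρθ : ρ < θ)
    (hθ : θ < Real.pi) (h : ν + ρ < Real.pi) :
    ∃ c, 0 ≤ c ∧ ∀ l : ℂ, θ < |l.arg| → Admissible {w : ℂ | ρ < |w.arg|} ν c l := by
  obtain ⟨c, hc, hs⟩ := sector_sep hν0.le hνθ hθ.le
  refine ⟨c⁻¹, by positivity, fun l hl z hz => ⟨?_, ?_⟩⟩
  -- Otherwise l = z + (l - z) would be a sum of points of the closed sectors of angles ν and ρ,
  -- hence of argument at most max(ν, ρ) < θ.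
  · by_contra! hcon
    have := abs_arg_add_le hν0 hρ0 hz.2 (not_lt.1 hcon) h
    rw [add_sub_cancel] at this
    exact absurd (hl.trans_le this) (not_lt.2 (max_lt hνθ hρθ).le)
  · have h1 := hs z l hz.2 hl.le
    rw [norm_sub_rev] at h1
    rw [inv_mul_eq_div, le_div_iff₀ hc]
    nlinarith [norm_nonneg l]

/-! ### The estimates for the sum -/

theorem exists_bump_polar_le (h0 : 0 ≤ ν) (hν : ν < Real.pi) :
    ∃ Cb, 0 ≤ Cb ∧ ∀ θ : ℝ, |θ| = ν → ∀ r : ℝ,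
      ‖bump 1 (polar θ r)‖ ≤ Cb * Real.exp (-|r|) := by
  obtain ⟨C, hC0, hC⟩ := norm_bump_le h0 hν
  refine ⟨C, hC0, fun θ hθ r => ?_⟩
  have hm : polar θ r ∈ closedSector ν := by
    refine contour_subset_closedSector ν ?_
    rcases abs_choice θ with e | e <;> rw [hθ] at e
    · rw [← e]; exact polar_mem_contour h0 hν r
    · rw [← neg_eq_iff_eq_neg.2 e]; exact polar_neg_mem_contour h0 hν r
  simpa [norm_polar] using hC 0 _ hm

theorem SumData.exists_norm_le [CompleteSpace X] (h : SumData A B ν M K L {w : ℂ | ρ < |w.arg|})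
    (hρ0 : 0 ≤ ρ) (hνρ : ν + ρ < Real.pi) (hB : HasRBoundedResolvent B ρ) :
    ∃ C, 0 ≤ C ∧ ∀ (x : X) (hxA : x ∈ A.domain) (hxB : x ∈ B.domain),
      ‖A ⟨x, hxA⟩‖ ≤ C * ‖A ⟨x, hxA⟩ + B ⟨x, hxB⟩‖ := by
  have hadm := admissible_zero hρ0 hνρ
  obtain ⟨Cb, hCb0, hCb⟩ := exists_bump_polar_le h.pos.le h.lt_pi
  obtain ⟨R, hR0, hR⟩ := hB.2.exists_rBound₂_fin_one
  have hC0 : 0 ≤ 30 * (Cb * (K ^ 2 * R) * expMass) := by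
    have := expMass_nonneg; positivity
  refine ⟨_, hC0, fun x hxA hxB => ?_⟩
  -- A single index with l = 0 turns the Rademacher estimate into a norm estimate.
  have key := h.radMap_le hR0 hCb (l := fun _ : Fin 1 => 0) (fun _ => hadm)
    (fun n ζ hζ => hR n _ fun _ k => ⟨0 - ζ k,
      (hadm _ (contour_subset_closedSector ν (hζ k))).1, by rw [shiftRes]; module⟩)
    (fun _ => x) (fun _ => hxA) fun _ => hxB
  have key2 := pow_le_pow_left₀ (norm_nonneg _) key 2
  rw [mul_pow, norm_radMap_fin_one, norm_radMap_fin_one, zero_smul, sub_zero] at key2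
  refine abs_le_of_sq_le_sq' ?_ (by positivity) |>.2
  rw [mul_pow]
  linarith

theorem SumData.exists_radMap_le [CompleteSpace X]
    (h : SumData A B ν M K L {w : ℂ | ρ < |w.arg|}) (hB : HasRBoundedResolvent B ρ)
    (hα : PropertyAlpha X) (hc : 0 ≤ c) (hρ0 : 0 ≤ ρ) :
    ∃ C, 0 ≤ C ∧ ∀ (m : ℕ) (l : Fin m → ℂ),
      (∀ j, Admissible {w : ℂ | ρ < |w.arg|} ν c (l j)) →
      ∀ (x : Fin m → X) (hxA : ∀ j, x j ∈ A.domain) (hxB : ∀ j, x j ∈ B.domain),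
        ‖radMap (fun j => A ⟨x j, hxA j⟩)‖ ≤
          C * ‖radMap (fun j => A ⟨x j, hxA j⟩ + B ⟨x j, hxB j⟩ - l j • x j)‖ := by
  obtain ⟨Cb, hCb0, hCb⟩ := exists_bump_polar_le h.pos.le h.lt_pi
  obtain ⟨R, hR0, hR⟩ := hα.exists_rBound₂ hB.2 c hc
  have hC0 : 0 ≤ 30 * (Cb * (K ^ 2 * R) * expMass) := by
    have := expMass_nonneg; positivity
  refine ⟨_, hC0, fun m l hl x hxA hxB => h.radMap_le hR0 hCb hl (fun n ζ hζ => ?_) x hxA hxB⟩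
  have hadm := fun j k => hl j _ (contour_subset_closedSector ν (hζ k))
  have hne : ∀ j k, l j - ζ k ≠ 0 := fun j k h0 => by
    have h1 : ρ < |(l j - ζ k).arg| := (hadm j k).1
    rw [h0, Complex.arg_zero, abs_zero] at h1
    exact absurd h1 (not_lt.2 hρ0)
  -- Here z(z + B - l)⁻¹ = (-z/(l - z)) · (l - z)R(l - z, B), with scalar factors bounded by c.
  have := hR m n (fun j k => (l j - ζ k) • res B (l j - ζ k)) (fun j k => -ζ k / (l j - ζ k))
    (fun j k => ⟨_, (hadm j k).1, rfl⟩) fun j k => by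
      rw [norm_div, norm_neg, div_le_iff₀ (norm_pos_iff.2 (hne j k))]
      exact (hadm j k).2
  convert this using 3 with j k
  rw [smul_smul, div_mul_cancel₀ _ (hne j k), shiftRes]
  module

theorem dense_domain_add {a : ℝ} (hA : -(a : ℂ) ∈ resolventSet A) (hB : -(a : ℂ) ∈ resolventSet B)
    (hcomm : ResolventsCommute A B) (hdA : Dense (A.domain : Set X))
    (hdB : Dense (B.domain : Set X)) : Dense ((A + B).domain : Set X) := by
  refine (denseRange_mul (denseRange_shiftInv hA hdA) (denseRange_shiftInv hB hdB)).mono ?_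
  rintro _ ⟨y, rfl⟩
  have e : (shiftInv A a * shiftInv B a) y = (res A (-(a : ℂ)) * res B (-(a : ℂ))) y := by
    rw [shiftInv, shiftInv, neg_mul_neg]
  rw [e]
  refine ⟨res_mem_domain hA _, ?_⟩
  rw [(hcomm _ hA _ hB).eq]
  exact res_mem_domain hB _

end

end SectorialSum

namespace SectorialSum

open MeasureTheory Set Filter Topology

noncomputable section

variable {X : Type*} [NormedAddCommGroup X] [NormedSpace ℂ X]

variable {A B : X →ₗ.[ℂ] X} {ν ρ σ θ M K L c : ℝ} {S : Set ℂ}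

/-! ### R-sectoriality of the sum -/

theorem add_mk {x : X} (hxA : x ∈ A.domain) (hxB : x ∈ B.domain) :
    (A + B) ⟨x, hxA, hxB⟩ = A ⟨x, hxA⟩ + B ⟨x, hxB⟩ := rfl

theorem radNorm_eq_norm_radMap {n : ℕ} (x : Fin n → X) :
    radNorm x = ‖radMap x‖ / √(2 ^ n) := by
  rw [radNorm_eq, ← norm_radMap_sq, Real.sqrt_div' _ (by positivity),
    Real.sqrt_sq (norm_nonneg _)]

/-- Factor l R(l, A+B) = l R(l,B) · (l - B) R(l, A+B), where (l - B) R(l, A+B) = 1 + A R(l, A+B).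
The a priori estimate bounds the second factor under random signs, R-sectoriality of B the first.
The case of one index also gives the lower bound needed for l to be in the resolvent set. -/
theorem SumData.exists_forall_mem_resolventSet [CompleteSpace X]
    (h : SumData A B ν M K L {w : ℂ | ρ < |w.arg|}) (hB : HasRBoundedResolvent B ρ)
    (hα : PropertyAlpha X) (hc : 0 ≤ c) (hρ0 : 0 ≤ ρ) (hcl : (A + B).IsClosed) :
    ∃ C, 0 ≤ C ∧ ∀ (m : ℕ) (l : Fin m → ℂ),
      (∀ j, Admissible {w : ℂ | ρ < |w.arg|} ν c (l j) ∧ ρ < |(l j).arg|) →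
      (∀ j, l j ∈ resolventSet (A + B)) ∧
      ∀ x : Fin m → X,
        ‖radMap (fun j => (l j • res (A + B) (l j)) (x j))‖ ≤ C * ‖radMap x‖ := by
  obtain ⟨C, hC0, hC⟩ := h.exists_radMap_le hB hα hc hρ0
  obtain ⟨D, hD0, hD⟩ := hB.2.exists_radSq_le
  have hD' : ∀ (m : ℕ) (l : Fin m → ℂ), (∀ j, ρ < |(l j).arg|) → ∀ x : Fin m → X,
      ‖radMap (fun j => (l j • res B (l j)) (x j))‖ ≤ D * ‖radMap x‖ := fun m l hl x => by
    refine abs_le_of_sq_le_sq' ?_ (by positivity) |>.2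
    rw [mul_pow, norm_radMap_sq, norm_radMap_sq]
    exact hD (Fin m) _ x fun j => ⟨l j, hl j, rfl⟩
  have hle : ∀ (m : ℕ) (l : Fin m → ℂ), (∀ j, Admissible {w : ℂ | ρ < |w.arg|} ν c (l j)) →
      ∀ (x : Fin m → X) (hxA : ∀ j, x j ∈ A.domain) (hxB : ∀ j, x j ∈ B.domain),
        ‖radMap (fun j => l j • x j - B ⟨x j, hxB j⟩)‖ ≤
          (1 + C) * ‖radMap (fun j => A ⟨x j, hxA j⟩ + B ⟨x j, hxB j⟩ - l j • x j)‖ :=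
    fun m l hl x hxA hxB => by
      have e : (fun j => l j • x j - B ⟨x j, hxB j⟩) = (fun j => A ⟨x j, hxA j⟩) -
          fun j => A ⟨x j, hxA j⟩ + B ⟨x j, hxB j⟩ - l j • x j := by
        funext j; simp only [Pi.sub_apply]; abel
      rw [e, map_sub]
      refine (norm_sub_le _ _).trans ?_
      linarith [hC m l hl x hxA hxB]
  have hmem : ∀ l : ℂ, Admissible {w : ℂ | ρ < |w.arg|} ν c l → ρ < |l.arg| →
      l ∈ resolventSet (A + B) := fun l hl hρ => by
    refine mem_resolventSet_of_bound hcl (c := ‖res B l‖ * (1 + C)) (fun x => ?_)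
      (h.dense_range_sub hl)
    obtain ⟨x, hxA, hxB⟩ := x
    have key := pow_le_pow_left₀ (norm_nonneg _)
      (hle 1 (fun _ => l) (fun _ => hl) (fun _ => x) (fun _ => hxA) fun _ => hxB) 2
    rw [mul_pow, norm_radMap_fin_one, norm_radMap_fin_one] at key
    have key2 : ‖l • x - B ⟨x, hxB⟩‖ ≤ (1 + C) * ‖A ⟨x, hxA⟩ + B ⟨x, hxB⟩ - l • x‖ := by
      refine abs_le_of_sq_le_sq' ?_ (by positivity) |>.2
      rw [mul_pow]
      linarith
    have e : res B l (l • x - B ⟨x, hxB⟩) = x :=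
      (isResolventAt_res (hB.1 l hρ)).2 ⟨x, hxB⟩
    rw [add_mk hxA hxB, norm_sub_rev (l • x), mul_assoc]
    calc ‖x‖ = ‖res B l (l • x - B ⟨x, hxB⟩)‖ := by rw [e]
      _ ≤ ‖res B l‖ * ‖l • x - B ⟨x, hxB⟩‖ := ContinuousLinearMap.le_opNorm _ _
      _ ≤ _ := by gcongr
  refine ⟨D * (1 + C), by positivity, fun m l hl => ⟨fun j => hmem _ (hl j).1 (hl j).2,
    fun x => ?_⟩⟩
  have hres := fun j => isResolventAt_res (hmem _ (hl j).1 (hl j).2)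
  set u := fun j => res (A + B) (l j) (x j) with hu
  have hdom : ∀ j, u j ∈ (A + B).domain := fun j => ((hres j).1 (x j)).choose
  have hval : ∀ j, A ⟨u j, (hdom j).1⟩ + B ⟨u j, (hdom j).2⟩ - l j • u j = -x j := fun j => by
    have := ((hres j).1 (x j)).choose_spec
    rw [← this]
    exact (neg_sub _ _).symm
  have h1 := hle m l (fun j => (hl j).1) u (fun j => (hdom j).1) fun j => (hdom j).2
  simp only [hval] at h1
  have e1 : (fun j => -x j) = -x := rfl
  rw [e1, map_neg, norm_neg] at h1
  have h2 := hD' m l (fun j => (hl j).2) fun j => l j • u j - B ⟨u j, (hdom j).2⟩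
  have e2 : ∀ j, res B (l j) (l j • u j - B ⟨u j, (hdom j).2⟩) = u j := fun j =>
    (isResolventAt_res (hB.1 _ (hl j).2)).2 ⟨u j, (hdom j).2⟩
  simp only [smul_apply, e2] at h2
  calc _ ≤ _ := h2
    _ ≤ D * ((1 + C) * ‖radMap x‖) := by gcongr
    _ = _ := by ring

theorem SumData.hasRBoundedResolvent_add [CompleteSpace X]
    (h : SumData A B ν M K L {w : ℂ | ρ < |w.arg|}) (hB : HasRBoundedResolvent B ρ)
    (hα : PropertyAlpha X) (hρ0 : 0 < ρ) (hcl : (A + B).IsClosed) (hνθ : ν < θ) (hρθ : ρ < θ)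
    (hθ : θ < Real.pi) (hνρ : ν + ρ < Real.pi) : HasRBoundedResolvent (A + B) θ := by
  obtain ⟨c, hc0, hc⟩ := exists_admissible h.pos hρ0 hνθ hρθ hθ hνρ
  obtain ⟨C, -, hC⟩ := h.exists_forall_mem_resolventSet hB hα hc0 hρ0.le hcl
  refine ⟨fun z hz => (hC 1 (fun _ => z) fun _ => ⟨hc z hz, hρθ.trans hz⟩).1 0, C,
    fun n T x hT => ?_⟩
  choose l hl hTl using hT
  have := (hC n l fun j => ⟨hc _ (hl j), hρθ.trans (hl j)⟩).2 x
  simp only [← hTl] at this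
  rw [radNorm_eq_norm_radMap, radNorm_eq_norm_radMap, mul_div_assoc']
  gcongr

theorem isSectorialOfType_of_hasRBoundedResolvent {T : X →ₗ.[ℂ] X} (hθ0 : 0 ≤ θ)
    (hθ : θ < Real.pi) (hcl : T.IsClosed) (hd : Dense (T.domain : Set X))
    (hi : Function.Injective T) (hr : DenseRange T) (h : HasRBoundedResolvent T θ) :
    IsSectorialOfType T θ where
  nonneg := hθ0
  lt_pi := hθ
  isClosed := hcl
  dense_domain := hd
  injective := hi
  dense_range := hr
  mem_resolventSet := h.1
  resolvent_bound σ hσ := by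
    obtain ⟨C, -, hC⟩ := h.2.exists_norm_le
    exact ⟨C, fun z hz => hC _ ⟨z, hσ.trans_le hz, rfl⟩⟩

theorem rAngle_le {T : X →ₗ.[ℂ] X} (hθ0 : 0 < θ) (hθ : θ < Real.pi)
    (h : HasRBoundedResolvent T θ) : rAngle T ≤ θ :=
  csInf_le ⟨0, fun _ h => h.1.le⟩ ⟨hθ0, hθ, h⟩

theorem hInftyAngle_nonneg (A : X →ₗ.[ℂ] X) : 0 ≤ hInftyAngle A :=
  Real.sInf_nonneg fun _ h => h.1.le

theorem rAngle_nonneg (A : X →ₗ.[ℂ] X) : 0 ≤ rAngle A :=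
  Real.sInf_nonneg fun _ h => h.1.le

end

end SectorialSum

/-! ### The theorem -/

theorem theorem5p2 {X : Type*} [NormedAddCommGroup X] [NormedSpace ℂ X] [CompleteSpace X]
    (A B : X →ₗ.[ℂ] X) (hcomm : ResolventsCommute A B)
    (hA : IsHInftySectorial A) (hB : IsRSectorial B)
    (hangle : hInftyAngle A + rAngle B < Real.pi) :
    (A + B).IsClosed ∧
    (∃ C : ℝ, ∀ (x : X) (hxA : x ∈ A.domain) (hxB : x ∈ B.domain),
      ‖A ⟨x, hxA⟩‖ + ‖B ⟨x, hxB⟩‖ ≤ C * ‖A ⟨x, hxA⟩ + B ⟨x, hxB⟩‖) ∧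
    (IsInvertible A ∨ IsInvertible B → IsInvertible (A + B)) ∧
    (PropertyAlpha X →
      IsRSectorial (A + B) ∧ rAngle (A + B) ≤ max (hInftyAngle A) (rAngle B)) := by
  have hmax : max (hInftyAngle A) (rAngle B) < Real.pi :=
    max_lt (by linarith [rAngle_nonneg B]) (by linarith [hInftyAngle_nonneg A])
  have hmax0 : 0 ≤ max (hInftyAngle A) (rAngle B) := le_max_of_le_left (hInftyAngle_nonneg A)
  obtain ⟨ωA, hωA⟩ := hA.1
  obtain ⟨ωB, hωB⟩ := hB.1
  obtain ⟨θ, hθ1, hθ2⟩ := exists_between hmax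
  -- For the claims at l = 0 any admissible pair ν, ρ with ν + ρ < π will do.
  obtain ⟨ν, ρ, M, K, L, hρ0, -, hρθ, hνρ, hBρ, h⟩ := exists_angles hcomm hA hB hangle hθ1
  obtain ⟨C, hC0, hC⟩ := h.exists_norm_le hρ0.le hνρ hBρ
  have hadm := admissible_zero hρ0.le hνρ
  have hcl := isClosed_add hωA.isClosed hωB.isClosed hC
  have hCB : ∀ (x : X) (hxA : x ∈ A.domain) (hxB : x ∈ B.domain),
      ‖B ⟨x, hxB⟩‖ ≤ (1 + C) * ‖A ⟨x, hxA⟩ + B ⟨x, hxB⟩‖ := fun x hxA hxB => by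
    have e : B ⟨x, hxB⟩ = (A ⟨x, hxA⟩ + B ⟨x, hxB⟩) - A ⟨x, hxA⟩ := by abel
    have h1 := norm_sub_le (A ⟨x, hxA⟩ + B ⟨x, hxB⟩) (A ⟨x, hxA⟩)
    rw [← e] at h1
    linarith [hC x hxA hxB]
  have hres : ∀ (T : X →ₗ.[ℂ] X) (x : X) (hx : x ∈ T.domain), (0 : ℂ) ∈ resolventSet T →
      ‖x‖ ≤ ‖res T 0‖ * ‖T ⟨x, hx⟩‖ := fun T x hx hT => by
    have e : res T 0 (-T ⟨x, hx⟩) = x := by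
      have := (isResolventAt_res hT).2 ⟨x, hx⟩
      rwa [zero_smul, zero_sub] at this
    calc ‖x‖ = ‖res T 0 (-T ⟨x, hx⟩)‖ := by rw [e]
      _ ≤ _ := by
        have := (res T 0).le_opNorm (-T ⟨x, hx⟩)
        rwa [norm_neg] at this
  refine ⟨hcl, ⟨C + (1 + C), fun x hxA hxB => ?_⟩, fun hinv => ?_, fun hα => ?_⟩
  · rw [add_mul]
    exact add_le_add (hC x hxA hxB) (hCB x hxA hxB)
  · rcases hinv with hinv | hinv
    · refine mem_resolventSet_of_bound hcl (c := ‖res A 0‖ * C) (fun ⟨x, hxA, hxB⟩ => ?_)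
        (h.dense_range_sub hadm)
      rw [zero_smul, zero_sub, norm_neg, add_mk hxA hxB, mul_assoc]
      exact (hres A x hxA hinv).trans (by gcongr; exact hC x hxA hxB)
    · refine mem_resolventSet_of_bound hcl (c := ‖res B 0‖ * (1 + C)) (fun ⟨x, hxA, hxB⟩ => ?_)
        (h.dense_range_sub hadm)
      rw [zero_smul, zero_sub, norm_neg, add_mk hxA hxB, mul_assoc]
      exact (hres B x hxB hinv).trans (by gcongr; exact hCB x hxA hxB)
  -- For R-boundedness near the optimal angle, ν and ρ are chosen anew below each τ.
  · have hR : ∀ τ, max (hInftyAngle A) (rAngle B) < τ → τ < Real.pi →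
        HasRBoundedResolvent (A + B) τ := fun τ h1 h2 => by
      obtain ⟨ν, ρ, M, K, L, hρ0, hντ, hρτ, hνρ, hBρ, h⟩ := exists_angles hcomm hA hB hangle h1
      exact h.hasRBoundedResolvent_add hBρ hα hρ0 hcl hντ hρτ h2 hνρ
    have hθ0 := hmax0.trans_lt hθ1
    have hdom : Dense ((A + B).domain : Set X) := by
      have hneg := neg_ofReal_mem_outside h.lt_pi one_pos
      have hnegB : -((1 : ℝ) : ℂ) ∈ resolventSet B := hBρ.1 _ <| by
        rw [arg_neg_ofReal one_pos, abs_of_pos Real.pi_pos]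
        exact hρθ.trans hθ2
      exact dense_domain_add (h.bound _ hneg).1 hnegB hcomm hωA.dense_domain hωB.dense_domain
    have hinj : Function.Injective (A + B) := by
      refine (injective_iff_map_eq_zero (A + B).toFun).2 fun ⟨x, hxA, hxB⟩ hx => ?_
      have h1 := hC x hxA hxB
      have h2 : A ⟨x, hxA⟩ + B ⟨x, hxB⟩ = 0 := hx
      rw [h2, norm_zero, mul_zero, norm_le_zero_iff] at h1
      have h3 := hωA.injective (h1.trans A.map_zero.symm)
      have h4 : x = 0 := congrArg (fun w : A.domain => (w : X)) h3
      exact Subtype.ext h4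
    have hran : DenseRange (A + B) := by
      -- For l = 0 the dense set consists of the vectors -(A + B)x.
      refine (h.dense_range_sub hadm).mono ?_
      rintro _ ⟨x, rfl⟩
      refine ⟨-x, ?_⟩
      rw [LinearPMap.map_neg, zero_smul, zero_sub]
    refine ⟨⟨⟨θ, isSectorialOfType_of_hasRBoundedResolvent hθ0.le hθ2 hcl hdom hinj hran
      (hR θ hθ1 hθ2)⟩, θ, hθ0, hθ2, hR θ hθ1 hθ2⟩, ?_⟩
    refine le_of_forall_gt_imp_ge_of_dense fun τ hτ => ?_
    -- The given τ may exceed π, so an angle below both τ and π is used.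
    obtain ⟨τ', h1, h2⟩ := exists_between (lt_min hτ hmax)
    obtain ⟨h3, h4⟩ := lt_min_iff.1 h2
    exact (rAngle_le (hmax0.trans_lt h1) h4 (hR τ' h1 h4)).trans h3.le
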